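/- Let $\mathcal H$ be a finite-dimensional or separable infinite-dimensional complex Hilbert space and let $H$ be a positive self-adjoint (possibly unbounded) operator on $\mathcal H$ with $\operatorname{Tr}e^{-\lambda H}<+\infty$ for some $\lambda>0$. Let $\mathfrak S(\mathcal H)$ be the set of states (positive operators of unit trace) with the trace norm $\|\cdot\|_1$, and write $E(\rho)=\operatorname{Tr}H\rho\in[0,+\infty]$, $H(\rho)=-\operatorname{Tr}\rho\log\rho$ for the von Neumann entropy, $H(\rho\|\sigma)$ for the quantum relative entropy, $E_0=\inf_{\|\varphi\|=1}\langle\varphi|H|\varphi\rangle$ and $F_H(E)=\sup\{H(\rho):\rho\in\mathfrak S(\mathcal H),\ E(\rho)\le E\}$. Let $\widehat F_H$ be a real function on $[0,+\infty)$, twice continuously differentiable on $(0,+\infty)$ (for example smooth), such that $\widehat F_H(E)\ge F_H(E)$ for all $E\ge E_0$ and $$\widehat F_H(E)>0,\qquad \widehat F_H'(E)>0,\qquad \widehat F_H''(E)\le 0\qquad\text{for all }E>0 .$$ Let $\mu$ be a generalized ensemble, i.e. a Borel probability measure on $\mathfrak S(\mathcal H)$, with average state $\bar\rho(\mu)=\int\rho\,\mu(d\rho)$,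 Holevo quantity $\chi(\mu)=\int H(\rho\|\bar\rho(\mu))\,\mu(d\rho)$ and average energy $\bar E(\mu)=E(\bar\rho(\mu))$, where $0<\bar E(\mu)<+\infty$, and let $\sigma\in\mathfrak S(\mathcal H)$ be a state with $E(\sigma)<+\infty$. Put $$\varepsilon=D(\mu|\sigma)=\tfrac12\int\|\rho-\sigma\|_1\,\mu(d\rho),\qquad \kappa=\tfrac12\Bigl(1+\frac{E(\sigma)}{\bar E(\mu)}\Bigr),$$ and assume $\varepsilon>0$. Then $$\chi(\mu)\le\inf_{t\in(0,\,1/(2\varepsilon)]}\left[\varepsilon\Bigl(\frac{1+\kappa t}{1-\varepsilon t}+t\Bigr)\widehat F_H\!\Bigl(\frac{\bar E(\mu)}{\varepsilon t}\Bigr)+h_2(\varepsilon t)+g\!\Bigl(\frac{1+\kappa t}{1-\varepsilon t}\,\varepsilon\Bigr)\right],$$ where $h_2(p)=-p\log p-(1-p)\log(1-p)$ and $g(p)=(1+p)\,h_2\!\bigl(\tfrac{p}{1+p}\bigr)$ (natural logarithms). If $\dim\mathcal H=\infty$, the infimum is attained, i.e. it is a minimum. -/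

import Mathlib

open scoped ENNReal InnerProductSpace

noncomputable section

namespace HolevoBound

variable {𝓗 : Type*} [NormedAddCommGroup 𝓗] [InnerProductSpace ℂ 𝓗] [CompleteSpace 𝓗]

/-- The trace `∑ᵢ ⟨bᵢ, T bᵢ⟩ ∈ [0, ∞]` of a positive bounded operator `T`, computed in some
Hilbert basis `b` (for positive `T` the value does not depend on the basis). -/
def opTrace (T : 𝓗 →L[ℂ] 𝓗) : ℝ≥0∞ :=
  ∑' i, ENNReal.ofReal
    (⟪(exists_hilbertBasis ℂ 𝓗).choose_spec.choose i,
      T ((exists_hilbertBasis ℂ 𝓗).choose_spec.choose i)⟫_ℂ).re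

/-- The trace norm `‖A‖₁ = Tr |A|`, where `|A| = √(A* A)`. -/
def traceNorm (A : 𝓗 →L[ℂ] 𝓗) : ℝ≥0∞ :=
  opTrace (CFC.abs A)

variable (𝓗) in
/-- Quantum states: positive operators with unit trace. -/
structure QState where
  op : 𝓗 →L[ℂ] 𝓗
  isPositive : op.IsPositive
  trace_eq_one : opTrace op = 1

/-- The trace-norm topology on the set of states, generated by the open trace-norm balls. -/
instance : TopologicalSpace (QState 𝓗) :=
  TopologicalSpace.generateFrom
    {U | ∃ (ρ : QState 𝓗) (r : ℝ≥0∞), U = {τ | traceNorm (τ.op - ρ.op) < r}}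

instance : MeasurableSpace (QState 𝓗) := borel _

instance : BorelSpace (QState 𝓗) := ⟨rfl⟩

/-- The von Neumann entropy `Tr η(ρ)`, `η(x) = -x log x`. -/
def entropy (ρ : 𝓗 →L[ℂ] 𝓗) : ℝ≥0∞ :=
  opTrace (cfc Real.negMulLog ρ)

/-- `b` is an orthonormal basis of eigenvectors of `ρ`. -/
def IsEigenbasis (ρ : 𝓗 →L[ℂ] 𝓗) {w : Set 𝓗} (b : HilbertBasis w ℂ 𝓗) : Prop :=
  ∀ i, ρ (b i) = ⟪b i, ρ (b i)⟫_ℂ • b i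

/-- `p log p - p log s + s - p ∈ [0, ∞]` for `p, s ≥ 0`, with value `+∞` for `p > 0 = s`. -/
def relTerm (p s : ℝ) : ℝ≥0∞ :=
  if s = 0 then (if p = 0 then 0 else ⊤)
  else ENNReal.ofReal (p * Real.log p - p * Real.log s + s - p)

/-- The quantum relative entropy `∑ᵢ ⟨eᵢ| ρ log ρ - ρ log σ |eᵢ⟩` of two states, with `e` an
eigenbasis of `ρ`, and `log σ` evaluated in an eigenbasis `f` of `σ`: with eigenvalues `pᵢ`, `sⱼ`
it is `∑ᵢⱼ |⟨eᵢ, fⱼ⟩|² (pᵢ log pᵢ - pᵢ log sⱼ)`, and `+∞` when the support of `ρ` is not contained in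
that of `σ`. The added terms `sⱼ - pᵢ` make all the summands nonnegative, and their total
contribution is `Tr σ - Tr ρ = 0`. All pairs of eigenbases give the same value, so that the
infimum is over a constant family. -/
def relEntropy (ρ σ : 𝓗 →L[ℂ] 𝓗) : ℝ≥0∞ :=
  ⨅ (w : Set 𝓗) (e : HilbertBasis w ℂ 𝓗) (_ : IsEigenbasis ρ e)
    (v : Set 𝓗) (f : HilbertBasis v ℂ 𝓗) (_ : IsEigenbasis σ f),
    ∑' i, ∑' j, ENNReal.ofReal (‖⟪e i, f j⟫_ℂ‖ ^ 2) *
      relTerm (⟪e i, ρ (e i)⟫_ℂ).re (⟪f j, σ (f j)⟫_ℂ).re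

/-- The average state `∫ ρ μ(dρ)` of a generalized ensemble (Bochner integral). -/
def barycenter (μ : MeasureTheory.Measure (QState 𝓗)) : 𝓗 →L[ℂ] 𝓗 :=
  ∫ ρ, ρ.op ∂μ

/-- The Holevo quantity `∫ H(ρ ‖ ρ̄(μ)) μ(dρ)`. -/
def holevo (μ : MeasureTheory.Measure (QState 𝓗)) : ℝ≥0∞ :=
  ∫⁻ ρ, relEntropy ρ.op (barycenter μ) ∂μ

/-- The metric divergence `½ ∫ ‖ρ - σ‖₁ μ(dρ)`. The integrand is at most `2`. -/
def metricDivergence (μ : MeasureTheory.Measure (QState 𝓗)) (σ : QState 𝓗) : ℝ :=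
  (1 / 2) * (∫⁻ ρ, traceNorm (ρ.op - σ.op) ∂μ).toReal

variable (𝓗) in
/-- Hamiltonians: positive self-adjoint, possibly unbounded operators. Self-adjointness
includes that the domain is dense. -/
structure Hamiltonian where
  op : 𝓗 →ₗ.[ℂ] 𝓗
  isSelfAdjoint : IsSelfAdjoint op
  nonneg : ∀ x : op.domain, 0 ≤ (⟪(x : 𝓗), op x⟫_ℂ).re

namespace Hamiltonian

theorem norm_le_add (H : Hamiltonian 𝓗) (x : H.op.domain) : ‖(x : 𝓗)‖ ≤ ‖(x : 𝓗) + H.op x‖ := by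
  by_cases hx : ‖(x : 𝓗)‖ = 0
  · rw [hx]; positivity
  have h1 : ‖(x : 𝓗)‖ ^ 2 ≤ (⟪(x : 𝓗), (x : 𝓗) + H.op x⟫_ℂ).re := by
    rw [inner_add_right, Complex.add_re]
    have := H.nonneg x
    have h2 : (⟪(x : 𝓗), (x : 𝓗)⟫_ℂ).re = ‖(x : 𝓗)‖ ^ 2 := inner_self_eq_norm_sq (𝕜 := ℂ) (x : 𝓗)
    linarith
  have h3 : (⟪(x : 𝓗), (x : 𝓗) + H.op x⟫_ℂ).re ≤ ‖(x : 𝓗)‖ * ‖(x : 𝓗) + H.op x‖ :=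
    re_inner_le_norm (𝕜 := ℂ) _ _
  have h4 : 0 < ‖(x : 𝓗)‖ := lt_of_le_of_ne (norm_nonneg _) (Ne.symm hx)
  nlinarith

/-- `1 + H` is a bijection of the domain of `H` onto `𝓗` with a bounded inverse. -/
theorem exists_resolvent (H : Hamiltonian 𝓗) :
    ∃ R : 𝓗 →L[ℂ] 𝓗, ∀ x, (R x, x - R x) ∈ H.op.graph := by
  let L : H.op.domain →ₗ[ℂ] 𝓗 := H.op.domain.subtype + H.op.toFun
  have hL : ∀ x, L x = (x : 𝓗) + H.op x := fun x => rfl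
  have hd : Dense (H.op.domain : Set 𝓗) := H.isSelfAdjoint.dense_domain
  have hclosed : IsClosed (LinearMap.range L : Set 𝓗) := by
    rw [← isSeqClosed_iff_isClosed]
    intro u y hu hy
    choose x hx using hu
    have hc : CauchySeq (fun n => (x n : 𝓗)) := by
      rw [Metric.cauchySeq_iff']
      intro e he
      obtain ⟨N, hN⟩ := Metric.cauchySeq_iff'.1 hy.cauchySeq e he
      refine ⟨N, fun n hn => lt_of_le_of_lt ?_ (hN n hn)⟩
      rw [dist_eq_norm, dist_eq_norm, ← hx n, ← hx N, ← map_sub, hL]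
      exact H.norm_le_add (x n - x N)
    obtain ⟨z, hz⟩ := cauchySeq_tendsto_of_complete hc
    have hcl : IsClosed (H.op.graph : Set (𝓗 × 𝓗)) := H.isSelfAdjoint.isClosed
    have hmem : (z, y - z) ∈ (H.op.graph : Set (𝓗 × 𝓗)) := by
      refine hcl.mem_of_tendsto (hz.prodMk_nhds (hy.sub hz))
        (Filter.Eventually.of_forall fun n => ?_)
      have : u n - (x n : 𝓗) = H.op (x n) := by rw [← hx n, hL]; abel
      rw [this]
      exact H.op.mem_graph (x n)
    obtain ⟨z', h1, h2⟩ := (LinearPMap.mem_graph_iff _).1 hmem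
    refine ⟨z', ?_⟩
    rw [hL, h2, h1]
    exact add_sub_cancel z y
  have horth : (LinearMap.range L)ᗮ = ⊥ := by
    rw [Submodule.eq_bot_iff]
    intro y hy
    have hy' : ∀ x : H.op.domain, ⟪-y, (x : 𝓗)⟫_ℂ = ⟪y, H.op x⟫_ℂ := by
      intro x
      have h0 : ⟪y, L x⟫_ℂ = 0 :=
        Submodule.inner_left_of_mem_orthogonal (LinearMap.mem_range_self L x) hy
      rw [hL, inner_add_right] at h0
      rw [inner_neg_left]
      linear_combination -h0
    have hyd : y ∈ H.op.adjoint.domain := LinearPMap.mem_adjoint_domain_of_exists y ⟨-y, hy'⟩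
    have hya : H.op.adjoint ⟨y, hyd⟩ = -y := LinearPMap.adjoint_apply_eq hd _ hy'
    have hsa : H.op.adjoint = H.op := LinearPMap.isSelfAdjoint_def.1 H.isSelfAdjoint
    have hg : (y, -y) ∈ H.op.graph := by
      rw [← hsa, LinearPMap.mem_graph_iff]
      exact ⟨⟨y, hyd⟩, rfl, hya⟩
    obtain ⟨y', h1, h2⟩ := (LinearPMap.mem_graph_iff _).1 hg
    have := H.norm_le_add y'
    simp only at h1 h2
    rw [h2, h1] at this
    simpa using this
  have hrange : LinearMap.range L = ⊤ := by
    have : (LinearMap.range L).topologicalClosure = ⊤ :=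
      Submodule.topologicalClosure_eq_top_iff.2 horth
    rwa [hclosed.submodule_topologicalClosure_eq] at this
  have hinj : Function.Injective L := by
    rw [← LinearMap.ker_eq_bot, LinearMap.ker_eq_bot']
    intro x hx
    have := H.norm_le_add x
    rw [← hL, hx, norm_zero, norm_le_zero_iff] at this
    exact Subtype.ext this
  let e := LinearEquiv.ofBijective L ⟨hinj, LinearMap.range_eq_top.1 hrange⟩
  have he : ∀ x, ((e.symm x : H.op.domain) : 𝓗) + H.op (e.symm x) = x := fun x =>
    e.apply_symm_apply x
  refine ⟨(H.op.domain.subtype ∘ₗ e.symm.toLinearMap).mkContinuous 1 fun x => ?_, fun x => ?_⟩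
  · have := H.norm_le_add (e.symm x)
    rw [he x] at this
    simpa using this
  · have h := H.op.mem_graph (e.symm x)
    rw [eq_sub_of_add_eq' (he x)] at h
    exact h

/-- The resolvent `(1 + H)⁻¹`. It is a self-adjoint operator with spectrum in `[0, 1]`, so that a
function `f` of `H` is the function `r ↦ f (1 / r - 1)` of the resolvent. -/
def resolvent (H : Hamiltonian 𝓗) : 𝓗 →L[ℂ] 𝓗 := H.exists_resolvent.choose

/-- The operator `e^{-lH}`, for `l > 0`, by the continuous functional calculus of `(1 + H)⁻¹`. -/
def expNeg (H : Hamiltonian 𝓗) (l : ℝ) : 𝓗 →L[ℂ] 𝓗 :=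
  cfc (fun r : ℝ => if r ≤ 0 then 0 else Real.exp (-l * (1 / r - 1))) H.resolvent

/-- The bounded operator `H (1 + sH)⁻¹`, for `s > 0`, by the continuous functional calculus of
`(1 + H)⁻¹`: with `h = 1 / r - 1` one has `h / (1 + s h) = (1 - r) / (r + s (1 - r))`. -/
def yosida (H : Hamiltonian 𝓗) (s : ℝ) : 𝓗 →L[ℂ] 𝓗 :=
  cfc (fun r : ℝ => (1 - r) / (r + s * (1 - r))) H.resolvent

/-- The energy `Tr Hρ ∈ [0, ∞]` of a positive operator `ρ`, the supremum (and limit as `s → 0`) of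
`Tr H (1 + sH)⁻¹ ρ`, as `H (1 + sH)⁻¹` increases to `H`. -/
def energy (H : Hamiltonian 𝓗) (ρ : 𝓗 →L[ℂ] 𝓗) : ℝ≥0∞ :=
  ⨆ (s : ℝ) (_ : 0 < s), opTrace (CFC.sqrt ρ * H.yosida s * CFC.sqrt ρ)

/-- `E₀ = inf ⟨φ, Hφ⟩` over unit vectors `φ`. -/
def groundEnergy (H : Hamiltonian 𝓗) : ℝ :=
  sInf {a | ∃ φ : H.op.domain, ‖(φ : 𝓗)‖ = 1 ∧ a = (⟪(φ : 𝓗), H.op φ⟫_ℂ).re}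

/-- `F_H(E)`, the supremum of the entropy over all states of energy at most `E`. -/
def maxEntropy (H : Hamiltonian 𝓗) (E : ℝ) : ℝ≥0∞ :=
  ⨆ (ρ : QState 𝓗) (_ : H.energy ρ.op ≤ ENNReal.ofReal E), entropy ρ.op

/-- `F` is a smooth, positive, increasing, concave upper bound for `F_H`. Two continuous derivatives
on `(0, ∞)` are enough, and no smoothness at the endpoint `0` is asked for. -/
structure IsEntropyBound (H : Hamiltonian 𝓗) (F : ℝ → ℝ) : Prop where
  contDiffOn : ContDiffOn ℝ 2 F (Set.Ioi 0)
  maxEntropy_le : ∀ E, H.groundEnergy ≤ E → H.maxEntropy E ≤ ENNReal.ofReal (F E)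
  pos : ∀ E, 0 < E → 0 < F E
  deriv_pos : ∀ E, 0 < E → 0 < deriv F E
  deriv_deriv_nonpos : ∀ E, 0 < E → deriv (deriv F) E ≤ 0

end Hamiltonian

/-- `g(p) = (1 + p) h₂(p / (1 + p))`, where `h₂` is the binary entropy. -/
def gFun (p : ℝ) : ℝ := (1 + p) * Real.binEntropy (p / (1 + p))

end HolevoBound

end

set_option linter.unusedSectionVars false

noncomputable section

/-! The Holevo quantity is the entropy of the average state minus the average entropy of the
members. It is therefore enough to bound the entropy of a member `ρ` from below by an expression
that is affine in `ρ` up to a multiple of `‖ρ - σ‖₁`: integrated over `μ`, such a bound sees only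
the barycenter and `ε`.

Put `δ = ε t ≤ 1/2` and cut at the energy `c = E / δ`. The span `K` of the energy eigenvectors up to
`c` has a finite dimension `d`, and `log d ≤ F c` because the maximally mixed state on `K` has
energy at most `c` (`log_finrank_le`). By Markov's inequality the average state has weight `r ≤ δ`
outside `K`; with `η x = -x log x`, that part adds at most `r F(E/r) + η r ≤ δ F(E/δ) + η r` to its
entropy (`tail_entropy_le`, `IsEntropyBound.mul_div_le`).

On `K` let `A` be the compression of `ρ`, of trace `a`, let `τ` be the normalized compression of
`σ`, and `e = ½‖ρ - σ‖₁`. A padded Jordan decomposition gives `A + D₋ = a τ + D₊` with positive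
`D₋`, `D₊` of trace `e`. Subadditivity of the entropy `S` yields `S(A) ≥ S(a τ + D₊) - S(D₋)`; the
first term is bounded below by a case of joint convexity of the relative entropy
(`negMulLog_sum_add_le`), the second above by Klein's inequality. All the reference operators are
multiples of one operator `T = p τ + ε / d`, where `p` is the weight of the average state in `K`. In
`afw_bound` the terms `e log e` then cancel, and only `-a log a` is not affine. It is absorbed by
`H(ρ) ≥ S(A) - η a` (`entropy_compress_le`), which gives `affine_le_entropy_compress`.

Klein's inequality for the average state with the same `T` cancels the logarithm of `T`, and what
remains is `χ ≤ (ε + δ) F(E/δ) + h₂(δ) + g(ε)` (`IsEnergyBasis.holevo_le`). The stated bound follows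
because `(1 + κ t) / (1 - ε t) ≥ 1` and `g` is increasing. In infinite dimension `F` exceeds `log d`
for every `d`, so the bound blows up as `t → 0` and continuity on a compact interval gives a
minimum. -/

namespace HolevoBound

open Filter Topology MeasureTheory

/-! ### Traces, expectation values and finite-rank approximation -/

section Basics

variable {𝓗 : Type*} [NormedAddCommGroup 𝓗] [InnerProductSpace ℂ 𝓗] [CompleteSpace 𝓗]
variable {ι ι' : Type*}

/-- The expectation value `⟨x, T x⟩` of a self-adjoint operator. -/
def expVal (T : 𝓗 →L[ℂ] 𝓗) (x : 𝓗) : ℝ := (⟪x, T x⟫_ℂ).re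

theorem expVal_nonneg {T : 𝓗 →L[ℂ] 𝓗} (hT : T.IsPositive) (x : 𝓗) : 0 ≤ expVal T x :=
  hT.re_inner_nonneg_right x

theorem expVal_add (S T : 𝓗 →L[ℂ] 𝓗) (x : 𝓗) : expVal (S + T) x = expVal S x + expVal T x := by
  simp [expVal]

theorem expVal_sub (S T : 𝓗 →L[ℂ] 𝓗) (x : 𝓗) : expVal (S - T) x = expVal S x - expVal T x := by
  simp [expVal]

theorem expVal_smul (c : ℝ) (T : 𝓗 →L[ℂ] 𝓗) (x : 𝓗) :
    expVal ((c : ℂ) • T) x = c * expVal T x := by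
  simp [expVal]

theorem inner_apply_eq_expVal {T : 𝓗 →L[ℂ] 𝓗} (hT : IsSelfAdjoint T) (x : 𝓗) :
    ⟪x, T x⟫_ℂ = (expVal T x : ℂ) := by
  have h : (starRingEnd ℂ) ⟪x, T x⟫_ℂ = ⟪x, T x⟫_ℂ := by
    rw [inner_conj_symm]
    exact hT.isSymmetric x x
  exact (Complex.conj_eq_iff_re.1 h).symm

theorem hasSum_norm_inner_sq (b : HilbertBasis ι ℂ 𝓗) (x : 𝓗) :
    HasSum (fun i => ‖⟪b i, x⟫_ℂ‖ ^ 2) (‖x‖ ^ 2) := by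
  have h := Complex.hasSum_re (b.hasSum_inner_mul_inner x x)
  have h2 : (⟪x, x⟫_ℂ).re = ‖x‖ ^ 2 := inner_self_eq_norm_sq (𝕜 := ℂ) x
  rw [h2] at h
  refine h.congr_fun fun i => ?_
  rw [← inner_conj_symm x (b i), ← Complex.normSq_eq_conj_mul_self, Complex.ofReal_re,
    Complex.normSq_eq_norm_sq]

theorem tsum_norm_inner_sq (b : HilbertBasis ι ℂ 𝓗) (x : 𝓗) :
    ∑' i, ENNReal.ofReal (‖⟪b i, x⟫_ℂ‖ ^ 2) = ENNReal.ofReal (‖x‖ ^ 2) := by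
  rw [← ENNReal.ofReal_tsum_of_nonneg (fun i => by positivity) (hasSum_norm_inner_sq b x).summable,
    (hasSum_norm_inner_sq b x).tsum_eq]

theorem tsum_norm_inner_sq' (b : HilbertBasis ι ℂ 𝓗) (x : 𝓗) :
    ∑' i, ENNReal.ofReal (‖⟪x, b i⟫_ℂ‖ ^ 2) = ENNReal.ofReal (‖x‖ ^ 2) := by
  rw [← tsum_norm_inner_sq b x]
  exact tsum_congr fun i => by rw [norm_inner_symm]

theorem expVal_eq_norm_sqrt_sq {T : 𝓗 →L[ℂ] 𝓗} (hT : T.IsPositive) (x : 𝓗) :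
    expVal T x = ‖CFC.sqrt T x‖ ^ 2 := by
  have h0 : 0 ≤ T := (ContinuousLinearMap.nonneg_iff_isPositive T).2 hT
  have hs : IsSelfAdjoint (CFC.sqrt T) := (CFC.sqrt_nonneg T).isSelfAdjoint
  have h1 : CFC.sqrt T * CFC.sqrt T = T := CFC.sqrt_mul_sqrt_self T
  have h2 : (⟪CFC.sqrt T x, CFC.sqrt T x⟫_ℂ).re = ‖CFC.sqrt T x‖ ^ 2 :=
    inner_self_eq_norm_sq (𝕜 := ℂ) _
  rw [← h2, expVal]
  conv_lhs => rw [← h1]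
  exact congrArg Complex.re (hs.isSymmetric x (CFC.sqrt T x)).symm

/-- By Parseval both sides are the double sum of `|⟨c j, X (b i)⟩|²`. With `X` the square root of a
positive operator this makes the trace independent of the basis. -/
theorem tsum_norm_apply_sq_comm {X : 𝓗 →L[ℂ] 𝓗} (hX : IsSelfAdjoint X)
    (b : HilbertBasis ι ℂ 𝓗) (c : HilbertBasis ι' ℂ 𝓗) :
    ∑' i, ENNReal.ofReal (‖X (b i)‖ ^ 2) = ∑' j, ENNReal.ofReal (‖X (c j)‖ ^ 2) := by
  simp_rw [← tsum_norm_inner_sq c (X (b _)), ← tsum_norm_inner_sq b (X (c _))]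
  rw [ENNReal.tsum_comm]
  refine tsum_congr fun j => tsum_congr fun i => ?_
  rw [← norm_inner_symm, hX.isSymmetric.apply_clm (b i) (c j)]

theorem opTrace_eq_tsum {T : 𝓗 →L[ℂ] 𝓗} (hT : T.IsPositive) (b : HilbertBasis ι ℂ 𝓗) :
    opTrace T = ∑' i, ENNReal.ofReal (expVal T (b i)) := by
  have hs : IsSelfAdjoint (CFC.sqrt T) := (CFC.sqrt_nonneg T).isSelfAdjoint
  simp_rw [expVal_eq_norm_sqrt_sq hT]
  rw [tsum_norm_apply_sq_comm hs b (exists_hilbertBasis ℂ 𝓗).choose_spec.choose]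
  simp_rw [← expVal_eq_norm_sqrt_sq hT]
  rfl

theorem opTrace_add {S T : 𝓗 →L[ℂ] 𝓗} (hS : S.IsPositive) (hT : T.IsPositive) :
    opTrace (S + T) = opTrace S + opTrace T := by
  obtain ⟨w, b, -⟩ := exists_hilbertBasis ℂ 𝓗
  rw [opTrace_eq_tsum (hS.add hT) b, opTrace_eq_tsum hS b, opTrace_eq_tsum hT b, ← ENNReal.tsum_add]
  refine tsum_congr fun i => ?_
  rw [expVal_add, ENNReal.ofReal_add (expVal_nonneg hS _) (expVal_nonneg hT _)]

theorem isPositive_smul {T : 𝓗 →L[ℂ] 𝓗} (hT : T.IsPositive) {c : ℝ} (hc : 0 ≤ c) :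
    ((c : ℂ) • T).IsPositive :=
  hT.smul_of_nonneg (by exact_mod_cast hc)

theorem opTrace_smul {T : 𝓗 →L[ℂ] 𝓗} (hT : T.IsPositive) {c : ℝ} (hc : 0 ≤ c) :
    opTrace ((c : ℂ) • T) = ENNReal.ofReal c * opTrace T := by
  obtain ⟨w, b, -⟩ := exists_hilbertBasis ℂ 𝓗
  rw [opTrace_eq_tsum (isPositive_smul hT hc) b, opTrace_eq_tsum hT b, ← ENNReal.tsum_mul_left]
  refine tsum_congr fun i => ?_
  rw [expVal_smul, ENNReal.ofReal_mul hc]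

theorem ofReal_expVal_le_opTrace {T : 𝓗 →L[ℂ] 𝓗} (hT : T.IsPositive) {x : 𝓗} (hx : ‖x‖ = 1) :
    ENNReal.ofReal (expVal T x) ≤ opTrace T := by
  have ho : Orthonormal ℂ ((↑) : ({x} : Set 𝓗) → 𝓗) := by
    constructor
    · rintro ⟨y, rfl⟩; exact hx
    · rintro ⟨y, rfl⟩ ⟨z, rfl⟩ h; exact (h rfl).elim
  obtain ⟨w, b, hw, hb⟩ := ho.exists_hilbertBasis_extension
  rw [opTrace_eq_tsum hT b]
  have hxw : x ∈ w := hw rfl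
  have := ENNReal.le_tsum (f := fun i => ENNReal.ofReal (expVal T (b i))) ⟨x, hxw⟩
  simpa only [hb] using this

/-- Every unit vector belongs to some orthonormal basis, so `‖√T x‖² ≤ Tr T` for unit `x`, and `‖T‖
≤ ‖√T‖²`. -/
theorem norm_le_opTrace {T : 𝓗 →L[ℂ] 𝓗} (hT : T.IsPositive) :
    ENNReal.ofReal ‖T‖ ≤ opTrace T := by
  by_cases htop : opTrace T = ⊤
  · rw [htop]; exact le_top
  have h0 : 0 ≤ T := (ContinuousLinearMap.nonneg_iff_isPositive T).2 hT
  have hs : IsSelfAdjoint (CFC.sqrt T) := (CFC.sqrt_nonneg T).isSelfAdjoint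
  have h1 : ∀ x, ‖CFC.sqrt T x‖ ≤ √(opTrace T).toReal * ‖x‖ := by
    intro x
    by_cases hx : x = 0
    · simp [hx]
    have hx' : ‖x‖ ≠ 0 := norm_ne_zero_iff.2 hx
    have h2 : ‖((‖x‖⁻¹ : ℝ) : ℂ) • x‖ = 1 := by
      rw [norm_smul, Complex.norm_real, norm_inv, norm_norm, inv_mul_cancel₀ hx']
    have h3 := ofReal_expVal_le_opTrace hT h2
    rw [expVal_eq_norm_sqrt_sq hT, ENNReal.ofReal_le_iff_le_toReal htop, map_smul, norm_smul,
      Complex.norm_real, norm_inv, norm_norm] at h3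
    have h4 := Real.le_sqrt_of_sq_le h3
    rwa [inv_mul_le_iff₀ (by positivity), mul_comm] at h4
  have h5 : ‖CFC.sqrt T‖ ≤ √(opTrace T).toReal :=
    ContinuousLinearMap.opNorm_le_bound _ (Real.sqrt_nonneg _) h1
  rw [ENNReal.ofReal_le_iff_le_toReal htop, ← CFC.sqrt_mul_sqrt_self T]
  calc ‖CFC.sqrt T * CFC.sqrt T‖ ≤ ‖CFC.sqrt T‖ * ‖CFC.sqrt T‖ := norm_mul_le _ _
    _ ≤ √(opTrace T).toReal * √(opTrace T).toReal := by gcongr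
    _ = (opTrace T).toReal := Real.mul_self_sqrt ENNReal.toReal_nonneg
    _ = _ := by rw [CFC.sqrt_mul_sqrt_self T]

theorem norm_le_traceNorm (A : 𝓗 →L[ℂ] 𝓗) : ENNReal.ofReal ‖A‖ ≤ traceNorm A := by
  have h : (CFC.abs A).IsPositive :=
    (ContinuousLinearMap.nonneg_iff_isPositive _).1 (CFC.abs_nonneg A)
  have := norm_le_opTrace h
  rwa [CFC.norm_abs] at this

/-- The orthogonal projection onto the span of finitely many vectors of an orthonormal basis. -/
def finProj (b : HilbertBasis ι ℂ 𝓗) (s : Finset ι) : 𝓗 →L[ℂ] 𝓗 :=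
  ∑ i ∈ s, InnerProductSpace.rankOne ℂ (b i) (b i)

theorem finProj_apply (b : HilbertBasis ι ℂ 𝓗) (s : Finset ι) (x : 𝓗) :
    finProj b s x = ∑ i ∈ s, ⟪b i, x⟫_ℂ • b i := by
  simp [finProj]

theorem inner_finProj [DecidableEq ι] (b : HilbertBasis ι ℂ 𝓗) (s : Finset ι) (x : 𝓗) (i : ι) :
    ⟪b i, finProj b s x⟫_ℂ = if i ∈ s then ⟪b i, x⟫_ℂ else 0 := by
  simp_rw [finProj_apply, inner_sum, inner_smul_right, orthonormal_iff_ite.1 b.orthonormal]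
  simp

theorem isSelfAdjoint_finProj (b : HilbertBasis ι ℂ 𝓗) (s : Finset ι) :
    IsSelfAdjoint (finProj b s) :=
  (ContinuousLinearMap.isPositive_sum s fun _ _ =>
    InnerProductSpace.isPositive_rankOne_self _).isSelfAdjoint

/-- A Hilbert–Schmidt operator is a norm limit of finite-rank ones: by Parseval and Cauchy–Schwarz
the squared error is at most the tail of the sum of `‖X (b i)‖²` over `i ∉ s`. -/
theorem tendsto_finProj_mul {X : 𝓗 →L[ℂ] 𝓗} (hX : IsSelfAdjoint X) (b : HilbertBasis ι ℂ 𝓗)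
    (hs : Summable fun i => ‖X (b i)‖ ^ 2) :
    Tendsto (fun s => finProj b s * X) atTop (𝓝 X) := by
  classical
  rw [tendsto_iff_norm_sub_tendsto_zero]
  have h1 := (tendsto_tsum_compl_atTop_zero fun i => ‖X (b i)‖ ^ 2).sqrt
  rw [Real.sqrt_zero] at h1
  refine squeeze_zero (fun _ => norm_nonneg _) (fun s => ?_) h1
  refine ContinuousLinearMap.opNorm_le_bound _ (Real.sqrt_nonneg _) fun x => ?_
  refine abs_le_of_sq_le_sq' ?_ (by positivity) |>.2
  rw [mul_pow, Real.sq_sqrt (tsum_nonneg fun _ => by positivity),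
    ← (hasSum_norm_inner_sq b _).tsum_eq]
  have h2 : ∀ i, ‖⟪b i, (finProj b s * X - X) x⟫_ℂ‖ ^ 2
      = ((↑s)ᶜ : Set ι).indicator (fun i => ‖⟪b i, X x⟫_ℂ‖ ^ 2) i := by
    intro i
    rw [sub_apply, mul_apply_eq_comp, inner_sub_right,
      inner_finProj]
    by_cases hi : i ∈ s <;> simp [hi]
  simp_rw [h2]
  rw [← tsum_subtype, ← tsum_mul_right]
  refine Summable.tsum_le_tsum (fun i => ?_) ((hasSum_norm_inner_sq b (X x)).summable.subtype _)
    ((hs.subtype _).mul_right _)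
  rw [← mul_pow]
  gcongr
  rw [← hX.isSymmetric.apply_clm]
  exact norm_inner_le_norm _ _

end Basics

/-! ### Eigenbases, functional calculus and compactness of trace-class operators -/

section Eigenbasis

variable {𝓗 : Type*} [NormedAddCommGroup 𝓗] [InnerProductSpace ℂ 𝓗] [CompleteSpace 𝓗]
variable {ι : Type*}

/-- `b` is an orthonormal basis of eigenvectors of `T`, with real eigenvalues `t`. -/
def IsDiagonal (T : 𝓗 →L[ℂ] 𝓗) (b : HilbertBasis ι ℂ 𝓗) (t : ι → ℝ) : Prop :=
  ∀ i, T (b i) = (t i : ℂ) • b i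

theorem HilbertBasis.norm_eq_one (b : HilbertBasis ι ℂ 𝓗) (i : ι) : ‖b i‖ = 1 :=
  b.orthonormal.1 i

theorem HilbertBasis.ne_zero (b : HilbertBasis ι ℂ 𝓗) (i : ι) : b i ≠ 0 :=
  b.orthonormal.ne_zero i

theorem inner_self_eq_one (b : HilbertBasis ι ℂ 𝓗) (i : ι) : ⟪b i, b i⟫_ℂ = 1 := by
  rw [inner_self_eq_norm_sq_to_K, HilbertBasis.norm_eq_one]; simp

theorem IsDiagonal.expVal_eq {T : 𝓗 →L[ℂ] 𝓗} {b : HilbertBasis ι ℂ 𝓗} {t : ι → ℝ}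
    (h : IsDiagonal T b t) (i : ι) : expVal T (b i) = t i := by
  rw [expVal, h i, inner_smul_right, inner_self_eq_one]; simp

theorem IsDiagonal.nonneg {T : 𝓗 →L[ℂ] 𝓗} {b : HilbertBasis ι ℂ 𝓗} {t : ι → ℝ}
    (h : IsDiagonal T b t) (hT : T.IsPositive) (i : ι) : 0 ≤ t i := by
  rw [← h.expVal_eq i]; exact expVal_nonneg hT _

theorem IsDiagonal.hasSum_expVal {T : 𝓗 →L[ℂ] 𝓗} {b : HilbertBasis ι ℂ 𝓗} {t : ι → ℝ}
    (h : IsDiagonal T b t) (hT : IsSelfAdjoint T) (x : 𝓗) :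
    HasSum (fun i => t i * ‖⟪b i, x⟫_ℂ‖ ^ 2) (expVal T x) := by
  refine (Complex.hasSum_re (b.hasSum_inner_mul_inner x (T x))).congr_fun fun i => ?_
  rw [← hT.isSymmetric.apply_clm, h i, inner_smul_left, Complex.conj_ofReal, mul_left_comm,
    ← inner_conj_symm x (b i), ← Complex.normSq_eq_conj_mul_self, Complex.normSq_eq_norm_sq,
    ← Complex.ofReal_mul, Complex.ofReal_re]

theorem IsDiagonal.tsum_expVal {T : 𝓗 →L[ℂ] 𝓗} {b : HilbertBasis ι ℂ 𝓗} {t : ι → ℝ}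
    (h : IsDiagonal T b t) (hT : T.IsPositive) (x : 𝓗) :
    ∑' i, ENNReal.ofReal (t i) * ENNReal.ofReal (‖⟪b i, x⟫_ℂ‖ ^ 2)
      = ENNReal.ofReal (expVal T x) := by
  have h1 := h.hasSum_expVal hT.isSelfAdjoint x
  simp_rw [← ENNReal.ofReal_mul (h.nonneg hT _)]
  rw [← ENNReal.ofReal_tsum_of_nonneg (fun i => mul_nonneg (h.nonneg hT i) (by positivity))
    h1.summable, h1.tsum_eq]

theorem isDiagonal_of_isEigenbasis {T : 𝓗 →L[ℂ] 𝓗} (hT : IsSelfAdjoint T) {w : Set 𝓗}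
    {b : HilbertBasis w ℂ 𝓗} (h : IsEigenbasis T b) :
    IsDiagonal T b fun i => expVal T (b i) := fun i => by
  rw [← inner_apply_eq_expVal hT]; exact h i

/-- Bases of all the eigenspaces, kernel included, are glued together; by the spectral theorem for
compact operators nothing is orthogonal to all eigenspaces. -/
theorem exists_isEigenbasis {T : 𝓗 →L[ℂ] 𝓗} (hc : IsCompactOperator T) (hT : IsSelfAdjoint T) :
    ∃ (w : Set 𝓗) (b : HilbertBasis w ℂ 𝓗), IsEigenbasis T b := by
  have hsym : (T : 𝓗 →ₗ[ℂ] 𝓗).IsSymmetric := hT.isSymmetric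
  let V : ℂ → Submodule ℂ 𝓗 := fun μ => Module.End.eigenspace (T : Module.End ℂ 𝓗) μ
  have hVc : ∀ μ, IsClosed (V μ : Set 𝓗) := fun μ => by
    have : (V μ : Set 𝓗) = {x | T x = μ • x} := by
      ext x; simp [V]
    rw [this]
    exact isClosed_eq T.continuous (continuous_const_smul μ)
  have hcomp : ∀ μ, CompleteSpace (V μ) := fun μ => (hVc μ).completeSpace_coe
  choose w b hb using fun μ => exists_hilbertBasis ℂ (V μ)
  let v : (Σ μ, w μ) → 𝓗 := fun a => (b a.1 a.2 : 𝓗)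
  have hv : Orthonormal ℂ v :=
    hsym.orthogonalFamily_eigenspaces.orthonormal_sigma_orthonormal fun μ => (b μ).orthonormal
  have hveig : ∀ a, T (v a) = a.1 • v a := fun a =>
    Module.End.mem_eigenspace_iff.1 (b a.1 a.2).2
  have hperp : (Submodule.span ℂ (Set.range v))ᗮ = ⊥ := by
    rw [eq_bot_iff, ← ContinuousLinearMap.orthogonalComplement_iSup_eigenspaces_eq_bot hc hT.isSymmetric]
    intro x hx
    have hx' : ∀ a, ⟪v a, x⟫_ℂ = 0 := fun a =>
      (Submodule.mem_orthogonal _ _).1 hx _ (Submodule.subset_span ⟨a, rfl⟩)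
    rw [← Submodule.iInf_orthogonal, Submodule.mem_iInf]
    intro μ
    rw [Submodule.mem_orthogonal']
    intro y hy
    have h1 := ((b μ).hasSum_repr ⟨y, hy⟩).mapL (V μ).subtypeL |>.mapL (innerSL ℂ x)
    refine h1.unique ?_
    convert hasSum_zero with i
    have h2 : ⟪x, (b μ i : 𝓗)⟫_ℂ = 0 := by
      rw [← inner_conj_symm, show ⟪(b μ i : 𝓗), x⟫_ℂ = 0 from hx' ⟨μ, i⟩, map_zero]
    simp [h2]
  have hr : Orthonormal ℂ ((↑) : Set.range v → 𝓗) := hv.toSubtypeRange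
  refine ⟨Set.range v, HilbertBasis.mkOfOrthogonalEqBot hr (by rwa [Subtype.range_coe]), ?_⟩
  rintro ⟨_, a, rfl⟩
  have hn : ⟪v a, v a⟫_ℂ = 1 := by rw [inner_self_eq_norm_sq_to_K, hv.1 a]; simp
  rw [HilbertBasis.coe_mkOfOrthogonalEqBot]
  simp only [hveig, inner_smul_right, hn, mul_one]

/-- The property holds for polynomials in `T` and is closed under uniform limits, so
Stone–Weierstrass gives it for all continuous functions on the spectrum. -/
theorem cfc_apply_eigenvector {T : 𝓗 →L[ℂ] 𝓗} (hT : IsSelfAdjoint T) {x : 𝓗} (hx : x ≠ 0) {t : ℝ}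
    (h : T x = (t : ℂ) • x) {f : ℝ → ℝ} (hf : ContinuousOn f (spectrum ℝ T)) :
    t ∈ spectrum ℝ T ∧ cfc f T x = (f t : ℂ) • x := by
  have hmem : t ∈ spectrum ℝ T := by
    rw [spectrum.mem_iff]
    rintro ⟨u, hu⟩
    have h1 : (u : 𝓗 →L[ℂ] 𝓗) x = 0 := by
      rw [hu, sub_apply, h, sub_eq_zero]
      simp [Algebra.algebraMap_eq_smul_one]
    have h2 : ((u⁻¹ : (𝓗 →L[ℂ] 𝓗)ˣ) : 𝓗 →L[ℂ] 𝓗) ((u : 𝓗 →L[ℂ] 𝓗) x) = x := by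
      rw [← mul_apply_eq_comp, Units.inv_mul]; rfl
    rw [h1, map_zero] at h2
    exact hx h2.symm
  refine ⟨hmem, ?_⟩
  rw [cfc_apply f T hT hf]
  have key : ∀ g : C(spectrum ℝ T, ℝ), cfcHom (a := T) hT g x = (g ⟨t, hmem⟩ : ℂ) • x := by
    intro g
    induction g using ContinuousMap.induction_on_of_compact with
    | const r =>
      have : (ContinuousMap.const (spectrum ℝ T) r) = algebraMap ℝ C(spectrum ℝ T, ℝ) r := rfl
      rw [this, AlgHomClass.commutes]
      simp [Algebra.algebraMap_eq_smul_one]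
    | id => rw [cfcHom_id]; exact h
    | star_id => rw [map_star, cfcHom_id, hT.star_eq]; exact h
    | add f g hf hg => rw [map_add, add_apply, hf, hg, ← add_smul]; simp
    | mul f g hf hg =>
      rw [map_mul, mul_apply_eq_comp, hg, map_smul, hf, smul_smul]; simp [mul_comm]
    | frequently f hf =>
      have hcl : IsClosed {g : C(spectrum ℝ T, ℝ) | cfcHom (a := T) hT g x
          = (g ⟨t, hmem⟩ : ℂ) • x} := by
        refine isClosed_eq ?_ ?_
        · exact (ContinuousLinearMap.apply ℂ 𝓗 x).continuous.comp (cfcHom_continuous hT)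
        · exact (Complex.continuous_ofReal.comp (continuous_eval_const _)).smul
            continuous_const
      exact hcl.closure_subset (mem_closure_iff_frequently.2 hf)
  exact key _

theorem IsDiagonal.cfc {T : 𝓗 →L[ℂ] 𝓗} {b : HilbertBasis ι ℂ 𝓗} {t : ι → ℝ}
    (h : IsDiagonal T b t) (hT : IsSelfAdjoint T) {f : ℝ → ℝ} (hf : ContinuousOn f (spectrum ℝ T)) :
    IsDiagonal (cfc f T) b fun i => f (t i) := fun i =>
  (cfc_apply_eigenvector hT (HilbertBasis.ne_zero b i) (h i) hf).2

theorem summable_norm_sqrt_apply_sq {T : 𝓗 →L[ℂ] 𝓗} (hT : T.IsPositive) (htr : opTrace T ≠ ⊤)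
    (b : HilbertBasis ι ℂ 𝓗) : Summable fun i => ‖CFC.sqrt T (b i)‖ ^ 2 := by
  rw [opTrace_eq_tsum hT b] at htr
  refine (ENNReal.summable_toReal htr).congr fun i => ?_
  rw [ENNReal.toReal_ofReal (expVal_nonneg hT _), expVal_eq_norm_sqrt_sq hT]

/-- The square root is Hilbert–Schmidt, hence compact, and `T` is its square. -/
theorem isCompactOperator_of_opTrace_ne_top {T : 𝓗 →L[ℂ] 𝓗} (hT : T.IsPositive)
    (htr : opTrace T ≠ ⊤) : IsCompactOperator T := by
  obtain ⟨w, b, -⟩ := exists_hilbertBasis ℂ 𝓗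
  have h0 : 0 ≤ T := (ContinuousLinearMap.nonneg_iff_isPositive T).2 hT
  have hs : IsSelfAdjoint (CFC.sqrt T) := (CFC.sqrt_nonneg T).isSelfAdjoint
  have h1 := tendsto_finProj_mul hs b (summable_norm_sqrt_apply_sq hT htr b)
  have h2 : IsCompactOperator (CFC.sqrt T : 𝓗 →L[ℂ] 𝓗) := by
    refine isCompactOperator_of_tendsto h1 (Eventually.of_forall fun s => ?_)
    refine IsCompactOperator.comp_clm (f := finProj b s) ?_ (CFC.sqrt T)
    have : IsCompactOperator (∑ i ∈ s, InnerProductSpace.rankOne ℂ (b i) (b i) : 𝓗 →L[ℂ] 𝓗) := by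
      refine Submodule.sum_mem (compactOperator (RingHom.id ℂ) 𝓗 𝓗) fun i _ => ?_
      have h3 : InnerProductSpace.rankOne ℂ (b i) (b i)
          = (ContinuousLinearMap.toSpanSingleton ℂ (b i)).comp (innerSL ℂ (b i)) := by
        ext x; simp
      rw [h3]
      exact (isCompactOperator_of_locallyCompactSpace_rng
        (ContinuousLinearMap.toSpanSingleton ℂ (b i))).comp_clm (innerSL ℂ (b i))
    exact this
  have h4 : (T : 𝓗 → 𝓗) = (CFC.sqrt T : 𝓗 →L[ℂ] 𝓗) ∘ (CFC.sqrt T : 𝓗 →L[ℂ] 𝓗) := by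
    ext x; rw [Function.comp_apply, ← mul_apply_eq_comp, CFC.sqrt_mul_sqrt_self T]
  rw [h4]
  exact h2.comp_clm (CFC.sqrt T)

theorem exists_isEigenbasis_of_opTrace_ne_top {T : 𝓗 →L[ℂ] 𝓗} (hT : T.IsPositive)
    (htr : opTrace T ≠ ⊤) : ∃ (w : Set 𝓗) (b : HilbertBasis w ℂ 𝓗), IsEigenbasis T b :=
  exists_isEigenbasis (isCompactOperator_of_opTrace_ne_top hT htr) hT.isSelfAdjoint

/-- The truncations `P T P` converge to `T` in norm. For a countable basis this puts all states into
one separable set of operators, as the Bochner integral requires. -/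
theorem mem_closure_span_rankOne {T : 𝓗 →L[ℂ] 𝓗} (hT : T.IsPositive) (htr : opTrace T ≠ ⊤)
    (b : HilbertBasis ι ℂ 𝓗) :
    T ∈ closure (Submodule.span ℂ (Set.range fun ij : ι × ι =>
      InnerProductSpace.rankOne ℂ (b ij.1) (b ij.2)) : Set (𝓗 →L[ℂ] 𝓗)) := by
  have h0 : 0 ≤ T := (ContinuousLinearMap.nonneg_iff_isPositive T).2 hT
  have hs : IsSelfAdjoint (CFC.sqrt T) := (CFC.sqrt_nonneg T).isSelfAdjoint
  have h1 := tendsto_finProj_mul hs b (summable_norm_sqrt_apply_sq hT htr b)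
  have h2 := h1.mul h1.star
  rw [hs.star_eq, CFC.sqrt_mul_sqrt_self T] at h2
  refine mem_closure_of_tendsto h2 (Eventually.of_forall fun s => ?_)
  have h3 : finProj b s * CFC.sqrt T * star (finProj b s * CFC.sqrt T)
      = ∑ i ∈ s, ∑ j ∈ s, ⟪b i, T (b j)⟫_ℂ • InnerProductSpace.rankOne ℂ (b i) (b j) := by
    rw [star_mul, hs.star_eq, (isSelfAdjoint_finProj b s).star_eq, mul_assoc,
      ← mul_assoc (CFC.sqrt T), CFC.sqrt_mul_sqrt_self T]
    ext x
    simp only [mul_apply_eq_comp, finProj_apply, map_sum, map_smul, sum_apply, smul_apply,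
      InnerProductSpace.rankOne_apply, smul_smul, Finset.smul_sum]
    rw [Finset.sum_comm]
    refine Finset.sum_congr rfl fun i _ => Finset.sum_congr rfl fun j _ => ?_
    rw [mul_comm]
  rw [h3]
  exact Submodule.sum_mem _ fun i _ => Submodule.sum_mem _ fun j _ =>
    Submodule.smul_mem _ _ (Submodule.subset_span ⟨(i, j), rfl⟩)

end Eigenbasis

/-! ### Measurability of states and the average state -/

section States

variable {𝓗 : Type*} [NormedAddCommGroup 𝓗] [InnerProductSpace ℂ 𝓗] [CompleteSpace 𝓗]
variable {ι : Type*}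

theorem traceNorm_zero : traceNorm (0 : 𝓗 →L[ℂ] 𝓗) = 0 := by
  simp [traceNorm, opTrace]

theorem measurable_traceNorm_sub (σ : QState 𝓗) :
    Measurable fun ρ : QState 𝓗 => traceNorm (ρ.op - σ.op) := by
  refine measurable_of_Iio fun r => IsOpen.measurableSet ?_
  exact TopologicalSpace.isOpen_generateFrom_of_mem ⟨σ, r, rfl⟩

theorem continuous_op : Continuous (QState.op : QState 𝓗 → 𝓗 →L[ℂ] 𝓗) := by
  refine continuous_iff_continuousAt.2 fun ρ => Metric.tendsto_nhds.2 fun r hr => ?_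
  have h1 : IsOpen {τ : QState 𝓗 | traceNorm (τ.op - ρ.op) < ENNReal.ofReal r} :=
    TopologicalSpace.isOpen_generateFrom_of_mem ⟨ρ, _, rfl⟩
  have h2 : ρ ∈ {τ : QState 𝓗 | traceNorm (τ.op - ρ.op) < ENNReal.ofReal r} := by
    simp [traceNorm_zero, hr]
  filter_upwards [h1.mem_nhds h2] with τ hτ
  rw [dist_eq_norm]
  exact (ENNReal.ofReal_lt_ofReal_iff hr).1 ((norm_le_traceNorm _).trans_lt hτ)

theorem countable_of_hilbertBasis [TopologicalSpace.SeparableSpace 𝓗] (b : HilbertBasis ι ℂ 𝓗) :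
    Countable ι := by
  refine Pairwise.countable_of_isOpen_disjoint (s := fun i => Metric.ball (b i) (1 / 2)) ?_
    (fun i => Metric.isOpen_ball) fun i => Metric.nonempty_ball.2 (by norm_num)
  intro i j hij
  refine Metric.ball_disjoint_ball ?_
  have h1 := norm_sub_sq (𝕜 := ℂ) (b i) (b j)
  -- Distinct basis vectors are at distance `√2`, so balls of radius `1/2` around them are disjoint.
  rw [b.orthonormal.2 hij, HilbertBasis.norm_eq_one, HilbertBasis.norm_eq_one, map_zero] at h1
  rw [dist_eq_norm]
  nlinarith [norm_nonneg (b i - b j)]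

theorem aestronglyMeasurable_op [TopologicalSpace.SeparableSpace 𝓗] (μ : Measure (QState 𝓗)) :
    AEStronglyMeasurable (QState.op : QState 𝓗 → 𝓗 →L[ℂ] 𝓗) μ := by
  borelize (𝓗 →L[ℂ] 𝓗)
  refine (stronglyMeasurable_iff_measurable_separable.2
    ⟨continuous_op.measurable, ?_⟩).aestronglyMeasurable
  obtain ⟨w, b, -⟩ := exists_hilbertBasis ℂ 𝓗
  have := countable_of_hilbertBasis b
  refine TopologicalSpace.IsSeparable.mono (TopologicalSpace.IsSeparable.span
    (R := ℂ) (Set.countable_range fun ij : w × w =>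
      InnerProductSpace.rankOne ℂ (b ij.1) (b ij.2)).isSeparable).closure ?_
  rintro _ ⟨ρ, rfl⟩
  exact mem_closure_span_rankOne ρ.isPositive (by simp [ρ.trace_eq_one]) b

theorem QState.norm_op_le (ρ : QState 𝓗) : ‖ρ.op‖ ≤ 1 := by
  have := norm_le_opTrace ρ.isPositive
  rwa [ρ.trace_eq_one, ENNReal.ofReal_le_one] at this

variable [TopologicalSpace.SeparableSpace 𝓗] (μ : Measure (QState 𝓗)) [IsProbabilityMeasure μ]

theorem integrable_op : Integrable (QState.op : QState 𝓗 → 𝓗 →L[ℂ] 𝓗) μ :=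
  .of_bound (aestronglyMeasurable_op μ) 1 (Eventually.of_forall QState.norm_op_le)

theorem integrable_expVal (x : 𝓗) : Integrable (fun ρ : QState 𝓗 => expVal ρ.op x) μ := by
  have h := ((integrable_op μ).apply_continuousLinearMap x)
  exact (h.const_inner (𝕜 := ℂ) x).re

theorem continuous_expVal (x : 𝓗) : Continuous fun ρ : QState 𝓗 => expVal ρ.op x := by
  unfold expVal
  have := continuous_op (𝓗 := 𝓗)
  fun_prop

theorem inner_barycenter (x y : 𝓗) :
    ⟪x, barycenter μ y⟫_ℂ = ∫ ρ, ⟪x, QState.op ρ y⟫_ℂ ∂μ := by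
  rw [barycenter, ContinuousLinearMap.integral_apply (integrable_op μ)]
  exact (integral_inner ((integrable_op μ).apply_continuousLinearMap y) x).symm

theorem expVal_barycenter (x : 𝓗) :
    expVal (barycenter μ) x = ∫ ρ, expVal (QState.op ρ) x ∂μ := by
  rw [expVal, inner_barycenter]
  have h := ((integrable_op μ).apply_continuousLinearMap x).const_inner (𝕜 := ℂ) x
  exact (integral_re h).symm

theorem ofReal_expVal_barycenter (x : 𝓗) :
    ENNReal.ofReal (expVal (barycenter μ) x) = ∫⁻ ρ, ENNReal.ofReal (expVal (QState.op ρ) x) ∂μ := by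
  rw [expVal_barycenter, ofReal_integral_eq_lintegral_ofReal (integrable_expVal μ x)
    (Eventually.of_forall fun ρ => expVal_nonneg ρ.isPositive x)]

theorem isPositive_barycenter : (barycenter μ).IsPositive := by
  have h : ∀ x, ⟪x, barycenter μ x⟫_ℂ = ((∫ ρ, expVal (QState.op ρ) x ∂μ : ℝ) : ℂ) := fun x => by
    rw [inner_barycenter, ← integral_complex_ofReal]
    exact integral_congr_ae (Eventually.of_forall fun ρ =>
      inner_apply_eq_expVal ρ.isPositive.isSelfAdjoint x)
  rw [ContinuousLinearMap.isPositive_iff_complex]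
  intro x
  rw [← inner_conj_symm, h]
  have h0 : 0 ≤ ∫ ρ, expVal (QState.op ρ) x ∂μ :=
    integral_nonneg fun ρ => expVal_nonneg ρ.isPositive x
  simpa using h0

theorem opTrace_barycenter : opTrace (barycenter μ) = 1 := by
  obtain ⟨w, b, -⟩ := exists_hilbertBasis ℂ 𝓗
  have := countable_of_hilbertBasis b
  rw [opTrace_eq_tsum (isPositive_barycenter μ) b]
  simp_rw [ofReal_expVal_barycenter]
  rw [← lintegral_tsum fun i => (continuous_expVal (b i)).measurable.ennreal_ofReal.aemeasurable]
  simp_rw [← opTrace_eq_tsum (QState.isPositive _) b, QState.trace_eq_one]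
  simp

/-- The average state of a generalized ensemble, as a state. -/
def meanState : QState 𝓗 := ⟨barycenter μ, isPositive_barycenter μ, opTrace_barycenter μ⟩

end States

/-! ### Energy eigenbases and the energy as a series -/

section HamiltonianBasis

variable {𝓗 : Type*} [NormedAddCommGroup 𝓗] [InnerProductSpace ℂ 𝓗] [CompleteSpace 𝓗]
variable {ι : Type*}

namespace Hamiltonian

variable (H : Hamiltonian 𝓗)

theorem resolvent_mem_graph (x : 𝓗) : (H.resolvent x, x - H.resolvent x) ∈ H.op.graph :=
  H.exists_resolvent.choose_spec x

theorem exists_domain_eq_resolvent (x : 𝓗) :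
    ∃ y : H.op.domain, (y : 𝓗) = H.resolvent x ∧ H.op y = x - H.resolvent x :=
  (LinearPMap.mem_graph_iff _).1 (H.resolvent_mem_graph x)

theorem inner_op_left (x y : H.op.domain) : ⟪H.op x, (y : 𝓗)⟫_ℂ = ⟪(x : 𝓗), H.op y⟫_ℂ := by
  have h := H.op.adjoint_isFormalAdjoint H.isSelfAdjoint.dense_domain
  rw [LinearPMap.isSelfAdjoint_def.1 H.isSelfAdjoint] at h
  exact h x y

theorem isSelfAdjoint_resolvent : IsSelfAdjoint H.resolvent := by
  refine ContinuousLinearMap.isSelfAdjoint_iff_isSymmetric.2 fun x y => ?_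
  obtain ⟨x', hx1, hx2⟩ := H.exists_domain_eq_resolvent x
  obtain ⟨y', hy1, hy2⟩ := H.exists_domain_eq_resolvent y
  have h := H.inner_op_left x' y'
  rw [hx1, hx2, hy1, hy2, inner_sub_left, inner_sub_right] at h
  exact (sub_left_inj.1 h).symm

theorem isPositive_resolvent : H.resolvent.IsPositive := by
  rw [ContinuousLinearMap.isPositive_def']
  refine ⟨H.isSelfAdjoint_resolvent, fun x => ?_⟩
  obtain ⟨x', hx1, hx2⟩ := H.exists_domain_eq_resolvent x
  have h := H.nonneg x'
  rw [hx1, hx2, inner_sub_right, Complex.sub_re] at h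
  have h2 : (⟪H.resolvent x, H.resolvent x⟫_ℂ).re = ‖H.resolvent x‖ ^ 2 :=
    inner_self_eq_norm_sq (𝕜 := ℂ) _
  rw [ContinuousLinearMap.reApplyInnerSelf]
  change 0 ≤ (⟪H.resolvent x, x⟫_ℂ).re
  nlinarith [sq_nonneg ‖H.resolvent x‖]

theorem norm_resolvent_le : ‖H.resolvent‖ ≤ 1 := by
  refine ContinuousLinearMap.opNorm_le_bound _ zero_le_one fun x => ?_
  obtain ⟨x', hx1, hx2⟩ := H.exists_domain_eq_resolvent x
  have h := H.norm_le_add x'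
  rw [hx1, hx2, add_sub_cancel] at h
  rwa [one_mul]

theorem resolvent_injective : Function.Injective H.resolvent := by
  rw [injective_iff_map_eq_zero]
  intro x hx
  obtain ⟨x', hx1, hx2⟩ := H.exists_domain_eq_resolvent x
  rw [hx] at hx1 hx2
  have : x' = 0 := Subtype.ext hx1
  rw [this, LinearPMap.map_zero, sub_zero] at hx2
  exact hx2.symm

theorem spectrum_resolvent_subset : spectrum ℝ H.resolvent ⊆ Set.Icc 0 1 := by
  intro r hr
  have h0 : 0 ≤ H.resolvent :=
    (ContinuousLinearMap.nonneg_iff_isPositive _).2 H.isPositive_resolvent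
  refine ⟨spectrum_nonneg_of_nonneg h0 hr, ?_⟩
  have h1 := spectrum.norm_le_norm_mul_of_mem hr
  have h2 : ‖(1 : 𝓗 →L[ℂ] 𝓗)‖ ≤ 1 := ContinuousLinearMap.norm_id_le
  calc r ≤ ‖r‖ := Real.le_norm_self r
    _ ≤ ‖H.resolvent‖ * ‖(1 : 𝓗 →L[ℂ] 𝓗)‖ := h1
    _ ≤ 1 * 1 := by gcongr; exact H.norm_resolvent_le
    _ = 1 := one_mul 1

end Hamiltonian

/-- The function of `r = (1 + h)⁻¹` that is `e^{-lh}`. -/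
def expFun (l r : ℝ) : ℝ := if r ≤ 0 then 0 else Real.exp (-l * (1 / r - 1))

/-- The inverse of `expFun l`. -/
def expFunInv (l x : ℝ) : ℝ := if x ≤ 0 then 0 else (1 - Real.log x / l)⁻¹

theorem continuous_expFun {l : ℝ} (hl : 0 < l) : Continuous (expFun l) := by
  have h : expFun l = fun r => Real.exp l * expNegInvGlue (r / l) := by
    ext r
    rw [expFun, expNegInvGlue]
    by_cases hr : r ≤ 0
    · rw [if_pos hr, if_pos (div_nonpos_of_nonpos_of_nonneg hr hl.le), mul_zero]
    · have hr' := not_le.1 hr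
      rw [if_neg hr, if_neg (not_le.2 (by positivity)), ← Real.exp_add]
      congr 1
      field_simp
      ring
  rw [h]
  exact continuous_const.mul (expNegInvGlue.contDiff (n := 0).continuous.comp (continuous_id.div_const l))

theorem continuousOn_expFunInv {l : ℝ} (hl : 0 < l) :
    ContinuousOn (expFunInv l) (Set.Icc 0 1) := by
  intro x hx
  rcases hx.1.eq_or_lt with rfl | hx0
  · refine ContinuousWithinAt.mono ?_ Set.Icc_subset_Ici_self
    rw [← continuousWithinAt_Ioi_iff_Ici, ContinuousWithinAt]
    have h1 : Tendsto (fun x => (1 - Real.log x / l)⁻¹) (𝓝[>] 0) (𝓝 0) := by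
      refine tendsto_inv_atTop_zero.comp (tendsto_atTop_add_const_left _ _ ?_)
      refine tendsto_neg_atBot_atTop.comp (Tendsto.atBot_div_const hl ?_)
      exact Real.tendsto_log_nhdsGT_zero
    have h2 : expFunInv l 0 = 0 := by simp [expFunInv]
    rw [h2]
    refine h1.congr' ?_
    filter_upwards [self_mem_nhdsWithin] with x hx
    rw [expFunInv, if_neg (not_le.2 hx)]
  · have h1 : ContinuousAt (fun x => (1 - Real.log x / l)⁻¹) x := by
      refine ContinuousAt.inv₀ ?_ ?_
      · exact continuousAt_const.sub ((Real.continuousAt_log hx0.ne').div_const l)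
      · have := div_nonpos_of_nonpos_of_nonneg (Real.log_nonpos hx.1 hx.2) hl.le
        linarith
    refine (h1.congr ?_).continuousWithinAt
    filter_upwards [lt_mem_nhds hx0] with y hy
    rw [expFunInv, if_neg (not_le.2 hy)]

theorem expFun_mem_Icc {l r : ℝ} (hl : 0 < l) (hr : r ∈ Set.Icc (0 : ℝ) 1) :
    expFun l r ∈ Set.Icc (0 : ℝ) 1 := by
  rw [expFun]
  split_ifs with h
  · exact ⟨le_rfl, zero_le_one⟩
  · have hr' := not_le.1 h
    refine ⟨(Real.exp_pos _).le, Real.exp_le_one_iff.2 ?_⟩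
    have : 1 ≤ 1 / r := by rw [le_div_iff₀ hr']; linarith [hr.2]
    nlinarith

theorem expFunInv_expFun {l r : ℝ} (hl : 0 < l) (hr : 0 ≤ r) : expFunInv l (expFun l r) = r := by
  rw [expFun]
  split_ifs with h
  · rw [expFunInv, if_pos le_rfl]; linarith
  · rw [expFunInv, if_neg (not_le.2 (Real.exp_pos _)), Real.log_exp]
    have hr' := not_le.1 h
    field_simp
    simp

namespace Hamiltonian

variable (H : Hamiltonian 𝓗)

theorem isPositive_expNeg (l : ℝ) : (H.expNeg l).IsPositive := by
  rw [← ContinuousLinearMap.nonneg_iff_isPositive]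
  refine cfc_nonneg fun r _ => ?_
  split_ifs
  · exact le_rfl
  · exact (Real.exp_pos _).le

/-- An orthonormal basis of eigenvectors of the Hamiltonian `H`, with eigenvalues `h`: this is
expressed by `(1 + H)⁻¹`. -/
structure IsEnergyBasis (b : HilbertBasis ι ℂ 𝓗) (h : ι → ℝ) : Prop where
  nonneg : ∀ k, 0 ≤ h k
  isDiagonal : IsDiagonal H.resolvent b fun k => (1 + h k)⁻¹
  finite_le : ∀ c, {k | h k ≤ c}.Finite

/-- The trace-class operator `e^{-lH}` has an eigenbasis, and the resolvent is a continuous function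
of it, so the same vectors diagonalize the resolvent. Injectivity of the resolvent excludes the
eigenvalue `0`. -/
theorem exists_isEnergyBasis (hH : ∃ l : ℝ, 0 < l ∧ opTrace (H.expNeg l) < ⊤) :
    ∃ (w : Set 𝓗) (b : HilbertBasis w ℂ 𝓗) (h : w → ℝ), H.IsEnergyBasis b h := by
  obtain ⟨l, hl, htr⟩ := hH
  have hpos := H.isPositive_expNeg l
  obtain ⟨w, b, hb⟩ := exists_isEigenbasis_of_opTrace_ne_top hpos htr.ne
  have hd := isDiagonal_of_isEigenbasis hpos.isSelfAdjoint hb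
  have hR := H.isSelfAdjoint_resolvent
  have hcf : ContinuousOn (expFun l) (spectrum ℝ H.resolvent) :=
    (continuous_expFun hl).continuousOn
  have hcg : ContinuousOn (expFunInv l) (expFun l '' spectrum ℝ H.resolvent) := by
    refine (continuousOn_expFunInv hl).mono ?_
    rintro _ ⟨r, hr, rfl⟩
    exact expFun_mem_Icc hl (H.spectrum_resolvent_subset hr)
  have hG : H.expNeg l = cfc (expFun l) H.resolvent := rfl
  have hRG : cfc (expFunInv l) (H.expNeg l) = H.resolvent := by
    rw [hG, ← cfc_comp (expFunInv l) (expFun l) H.resolvent hR hcg hcf]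
    conv_rhs => rw [← cfc_id ℝ H.resolvent hR]
    refine cfc_congr fun r hr => ?_
    exact expFunInv_expFun hl (H.spectrum_resolvent_subset hr).1
  have hcg' : ContinuousOn (expFunInv l) (spectrum ℝ (H.expNeg l)) := by
    rw [hG, cfc_map_spectrum (expFun l) H.resolvent hR hcf]
    exact hcg
  have hd' := hd.cfc hpos.isSelfAdjoint hcg'
  rw [hRG] at hd'
  set r : w → ℝ := fun k => expFunInv l (expVal (H.expNeg l) (b k)) with hr
  have hr0 : ∀ k, r k ≠ 0 := by
    intro k h0
    have h1 := hd' k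
    rw [h0, Complex.ofReal_zero, zero_smul] at h1
    exact HilbertBasis.ne_zero b k (H.resolvent_injective (h1.trans (map_zero _).symm))
  have hrI : ∀ k, r k ∈ Set.Icc (0 : ℝ) 1 := fun k => H.spectrum_resolvent_subset
    (cfc_apply_eigenvector hR (HilbertBasis.ne_zero b k) (hd' k) hcf).1
  have hrpos : ∀ k, 0 < r k := fun k => lt_of_le_of_ne (hrI k).1 (hr0 k).symm
  have hone : ∀ k, 1 ≤ (r k)⁻¹ := fun k => (one_le_inv₀ (hrpos k)).2 (hrI k).2
  refine ⟨w, b, fun k => (r k)⁻¹ - 1, fun k => sub_nonneg.2 (hone k), ?_, fun c => ?_⟩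
  · simpa using hd'
  · have hdG : IsDiagonal (H.expNeg l) b fun k => expFun l (r k) := hd'.cfc hR hcf
    rw [opTrace_eq_tsum hpos b] at htr
    simp_rw [hdG.expVal_eq] at htr
    -- Each energy at most `c` adds at least `e^{-lc}` to the finite trace, so there are finitely
    -- many.
    have hfin := ENNReal.finite_const_le_of_tsum_ne_top htr.ne
      (ε := ENNReal.ofReal (Real.exp (-l * c))) (by simpa using Real.exp_pos _)
    refine hfin.subset fun k hk => ?_
    refine ENNReal.ofReal_le_ofReal ?_
    rw [expFun, if_neg (not_le.2 (hrpos k))]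
    refine Real.exp_le_exp.2 ?_
    rw [one_div]
    have : (r k)⁻¹ - 1 ≤ c := hk
    nlinarith

variable {H} {b : HilbertBasis ι ℂ 𝓗} {h : ι → ℝ}

/-- The vector `b k` is `1 + h k` times its image under the resolvent, so it lies in the domain of
`H` and is an eigenvector with eigenvalue `h k`. -/
theorem IsEnergyBasis.groundEnergy_le (hb : H.IsEnergyBasis b h) (k : ι) :
    H.groundEnergy ≤ h k := by
  obtain ⟨y, hy1, hy2⟩ := H.exists_domain_eq_resolvent (b k)
  have hpos : (0 : ℝ) < 1 + h k := by linarith [hb.nonneg k]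
  have hne : ((1 + h k : ℝ) : ℂ) ≠ 0 := by exact_mod_cast hpos.ne'
  have hc : ((1 + h k : ℝ) : ℂ) * (((1 + h k)⁻¹ : ℝ) : ℂ) = 1 := by
    rw [Complex.ofReal_inv, mul_inv_cancel₀ hne]
  have h1 : ((((1 + h k : ℝ) : ℂ) • y : H.op.domain) : 𝓗) = b k := by
    rw [Submodule.coe_smul, hy1, hb.isDiagonal k, smul_smul, hc, one_smul]
  have h2 : H.op (((1 + h k : ℝ) : ℂ) • y) = (h k : ℂ) • b k := by
    rw [LinearPMap.map_smul, hy2, hb.isDiagonal k, smul_sub, smul_smul, hc, one_smul]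
    push_cast
    rw [add_smul, one_smul, add_sub_cancel_left]
  refine csInf_le ⟨0, ?_⟩ ⟨((1 + h k : ℝ) : ℂ) • y, ?_, ?_⟩
  · rintro _ ⟨φ, -, rfl⟩
    exact H.nonneg φ
  · rw [h1, HilbertBasis.norm_eq_one]
  · rw [h2, h1, inner_smul_right, inner_self_eq_one]
    simp

/-- Expanding the trace in `b` gives a double series with `|⟨b k, √ρ (b i)⟩|²`; summing over `i`
first leaves `‖√ρ (b k)‖²`, the diagonal entry of `ρ`. -/
theorem IsEnergyBasis.opTrace_yosida (hb : H.IsEnergyBasis b h) {ρ : 𝓗 →L[ℂ] 𝓗}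
    (hρ : ρ.IsPositive) {s : ℝ} (hs : 0 < s) :
    opTrace (CFC.sqrt ρ * H.yosida s * CFC.sqrt ρ)
      = ∑' k, ENNReal.ofReal (h k / (1 + s * h k)) * ENNReal.ofReal (expVal ρ (b k)) := by
  have hX : IsSelfAdjoint (CFC.sqrt ρ) := (CFC.sqrt_nonneg ρ).isSelfAdjoint
  have hden : ∀ r ∈ Set.Icc (0 : ℝ) 1, 0 < r + s * (1 - r) := by
    rintro r ⟨h0, h1⟩
    rcases h0.eq_or_lt with rfl | h0
    · simpa using hs
    · nlinarith
  have hcont : ContinuousOn (fun r : ℝ => (1 - r) / (r + s * (1 - r)))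
      (spectrum ℝ H.resolvent) := by
    refine ContinuousOn.mono ?_ H.spectrum_resolvent_subset
    exact ContinuousOn.div (by fun_prop) (by fun_prop) fun r hr => (hden r hr).ne'
  have hY0 : 0 ≤ H.yosida s := by
    refine cfc_nonneg fun r hr => ?_
    have hr' := H.spectrum_resolvent_subset hr
    exact div_nonneg (by linarith [hr'.2]) (hden r hr').le
  have hY := (ContinuousLinearMap.nonneg_iff_isPositive _).1 hY0
  have hd : IsDiagonal (H.yosida s) b fun k => h k / (1 + s * h k) := by
    have h1 := hb.isDiagonal.cfc H.isSelfAdjoint_resolvent hcont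
    intro k
    refine (h1 k).trans ?_
    have := hb.nonneg k
    have h2 : (0 : ℝ) < 1 + h k := by linarith
    have h3 : (0 : ℝ) < 1 + s * h k := by positivity
    have h4 : (1 + h k)⁻¹ + s * (1 - (1 + h k)⁻¹) = (1 + s * h k) / (1 + h k) := by
      field_simp; ring
    have h5 : 1 - (1 + h k)⁻¹ = h k / (1 + h k) := by field_simp; ring
    beta_reduce
    rw [h4, h5, div_div_div_cancel_right₀ h2.ne']
  have hpos : (CFC.sqrt ρ * H.yosida s * CFC.sqrt ρ).IsPositive :=
    (ContinuousLinearMap.nonneg_iff_isPositive _).1 (hX.conjugate_nonneg hY0)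
  have he : ∀ x, expVal (CFC.sqrt ρ * H.yosida s * CFC.sqrt ρ) x
      = expVal (H.yosida s) (CFC.sqrt ρ x) := fun x =>
    congrArg Complex.re (hX.isSymmetric x (H.yosida s (CFC.sqrt ρ x))).symm
  rw [opTrace_eq_tsum hpos b]
  simp_rw [he, ← hd.tsum_expVal hY]
  rw [ENNReal.tsum_comm]
  refine tsum_congr fun k => ?_
  rw [ENNReal.tsum_mul_left, expVal_eq_norm_sqrt_sq hρ, ← tsum_norm_inner_sq' b]
  congr 1
  refine tsum_congr fun i => ?_
  rw [← hX.isSymmetric.apply_clm]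

theorem IsEnergyBasis.energy_eq (hb : H.IsEnergyBasis b h) {ρ : 𝓗 →L[ℂ] 𝓗} (hρ : ρ.IsPositive) :
    H.energy ρ = ∑' k, ENNReal.ofReal (h k) * ENNReal.ofReal (expVal ρ (b k)) := by
  apply le_antisymm
  · refine iSup₂_le fun s hs => ?_
    rw [hb.opTrace_yosida hρ hs]
    refine ENNReal.tsum_le_tsum fun k => ?_
    gcongr
    have := hb.nonneg k
    exact div_le_self this (by nlinarith)
  · rw [ENNReal.tsum_eq_iSup_sum]
    refine iSup_le fun t => ?_
    have h1 : Tendsto (fun s : ℝ => ∑ k ∈ t,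
        ENNReal.ofReal (h k / (1 + s * h k)) * ENNReal.ofReal (expVal ρ (b k))) (𝓝[>] 0)
        (𝓝 (∑ k ∈ t, ENNReal.ofReal (h k) * ENNReal.ofReal (expVal ρ (b k)))) := by
      refine tendsto_finsetSum _ fun k _ => ?_
      refine ENNReal.Tendsto.mul_const (ENNReal.tendsto_ofReal ?_) (Or.inr ENNReal.ofReal_ne_top)
      have h2 : ContinuousAt (fun s : ℝ => h k / (1 + s * h k)) 0 :=
        ContinuousAt.div (by fun_prop) (by fun_prop) (by simp)
      have h3 : Tendsto (fun s : ℝ => h k / (1 + s * h k)) (𝓝 0) (𝓝 (h k)) := by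
        simpa [ContinuousAt] using h2
      exact h3.mono_left nhdsWithin_le_nhds
    refine le_of_tendsto h1 ?_
    filter_upwards [self_mem_nhdsWithin] with s hs
    refine le_trans ?_ (le_iSup₂_of_le s hs le_rfl)
    rw [hb.opTrace_yosida hρ hs]
    exact ENNReal.sum_le_tsum t

end Hamiltonian

end HamiltonianBasis

/-! ### Entropy inequalities in finite dimension -/

section FiniteDim

open Real (negMulLog log)

theorem negMulLog_le_tangent {x y : ℝ} (hx : 0 ≤ x) (hy : 0 < y) :
    negMulLog x ≤ x * (-log y) + y - x := by
  rcases hx.eq_or_lt with rfl | hx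
  · simpa using hy.le
  · have h := Real.log_le_sub_one_of_pos (div_pos hy hx)
    rw [Real.log_div hy.ne' hx.ne'] at h
    have h2 : x * (log y - log x) ≤ x * (y / x - 1) := by gcongr
    have h3 : x * (y / x - 1) = y - x := by field_simp
    rw [negMulLog]
    linarith

theorem neg_log_ge_tangent {x y : ℝ} (hx : 0 < x) (hy : 0 < y) :
    -log y - (x - y) / y ≤ -log x := by
  have h := Real.log_le_sub_one_of_pos (div_pos hx hy)
  rw [Real.log_div hx.ne' hy.ne'] at h
  have h3 : (x - y) / y = x / y - 1 := by field_simp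
  linarith

theorem negMulLog_sum_le {ι : Type*} [Fintype ι] {x : ι → ℝ} (hx : ∀ i, 0 ≤ x i) :
    negMulLog (∑ i, x i) ≤ ∑ i, negMulLog (x i) := by
  have h : negMulLog (∑ i, x i) = ∑ i, x i * (-log (∑ j, x j)) := by
    rw [negMulLog, ← Finset.sum_mul]; ring
  rw [h]
  refine Finset.sum_le_sum fun i _ => ?_
  rcases (hx i).eq_or_lt with h0 | h0
  · rw [← h0]; simp
  · have h1 : x i ≤ ∑ j, x j := Finset.single_le_sum (fun j _ => hx j) (Finset.mem_univ i)
    have h2 := Real.log_le_log h0 h1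
    rw [negMulLog]
    nlinarith

variable {V : Type*} [NormedAddCommGroup V] [InnerProductSpace ℂ V] [CompleteSpace V]
variable {ι κ : Type*} [Fintype ι] [Fintype κ]

theorem sum_norm_inner_sq (b : HilbertBasis ι ℂ V) (x : V) :
    ∑ i, ‖⟪b i, x⟫_ℂ‖ ^ 2 = ‖x‖ ^ 2 := by
  rw [← (hasSum_norm_inner_sq b x).tsum_eq, tsum_fintype]

theorem sum_overlap_left (e : HilbertBasis ι ℂ V) (f : HilbertBasis κ ℂ V) (j : κ) :
    ∑ i, ‖⟪e i, f j⟫_ℂ‖ ^ 2 = 1 := by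
  rw [sum_norm_inner_sq, HilbertBasis.norm_eq_one, one_pow]

theorem sum_overlap_right (e : HilbertBasis ι ℂ V) (f : HilbertBasis κ ℂ V) (i : ι) :
    ∑ j, ‖⟪e i, f j⟫_ℂ‖ ^ 2 = 1 := by
  simp_rw [norm_inner_symm (e i)]
  exact sum_overlap_left f e i

theorem IsDiagonal.expVal_eq_sum {T : V →L[ℂ] V} {b : HilbertBasis ι ℂ V} {t : ι → ℝ}
    (h : IsDiagonal T b t) (hT : T.IsPositive) (x : V) :
    expVal T x = ∑ i, t i * ‖⟪b i, x⟫_ℂ‖ ^ 2 := by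
  rw [← (h.hasSum_expVal hT.isSelfAdjoint x).tsum_eq, tsum_fintype]

theorem IsDiagonal.sum_expVal {T : V →L[ℂ] V} {b : HilbertBasis ι ℂ V} {t : ι → ℝ}
    (h : IsDiagonal T b t) (hT : T.IsPositive) (f : HilbertBasis κ ℂ V) :
    ∑ j, expVal T (f j) = ∑ i, t i := by
  simp_rw [h.expVal_eq_sum hT]
  rw [Finset.sum_comm]
  simp_rw [← Finset.mul_sum, sum_overlap_right, mul_one]

theorem expVal_le {S T : V →L[ℂ] V} (h : (T - S).IsPositive) (x : V) : expVal S x ≤ expVal T x := by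
  have := expVal_nonneg h x
  rw [expVal_sub] at this
  linarith

/-- Klein's inequality with a reference operator diagonal in `f`: the tangent bound for `-x log x`
is averaged with the doubly stochastic weights `|⟨e i, f j⟩|²`. -/
theorem sum_negMulLog_le {X : V →L[ℂ] V} (hX : X.IsPositive) {e : HilbertBasis ι ℂ V} {x : ι → ℝ}
    (he : IsDiagonal X e x) (f : HilbertBasis κ ℂ V) {y : κ → ℝ} (hy : ∀ j, 0 ≤ y j)
    (hy0 : ∀ j, y j = 0 → expVal X (f j) = 0) :
    ∑ i, negMulLog (x i) ≤ ∑ j, expVal X (f j) * (-log (y j)) + ∑ j, y j - ∑ i, x i := by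
  have h1 : ∀ i j, ‖⟪e i, f j⟫_ℂ‖ ^ 2 * negMulLog (x i)
      ≤ ‖⟪e i, f j⟫_ℂ‖ ^ 2 * (x i * (-log (y j)) + y j - x i) := by
    intro i j
    rcases (hy j).eq_or_lt with h0 | h0
    · have h2 := hy0 j h0.symm
      rw [he.expVal_eq_sum hX, Finset.sum_eq_zero_iff_of_nonneg
        fun i _ => mul_nonneg (he.nonneg hX i) (by positivity)] at h2
      rcases mul_eq_zero.1 (h2 i (Finset.mem_univ i)) with h3 | h3
      · rw [h3, ← h0]; simp
      · rw [h3]; simp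
    · exact mul_le_mul_of_nonneg_left (negMulLog_le_tangent (he.nonneg hX i) h0) (by positivity)
  have h2 := Finset.sum_le_sum fun i (_ : i ∈ Finset.univ) =>
    Finset.sum_le_sum fun j (_ : j ∈ Finset.univ) => h1 i j
  have h3 : ∑ i, ∑ j, ‖⟪e i, f j⟫_ℂ‖ ^ 2 * negMulLog (x i) = ∑ i, negMulLog (x i) := by
    simp_rw [← Finset.sum_mul, sum_overlap_right, one_mul]
  have h4 : ∑ i, ∑ j, ‖⟪e i, f j⟫_ℂ‖ ^ 2 * (x i * (-log (y j)) + y j - x i)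
      = ∑ j, expVal X (f j) * (-log (y j)) + ∑ j, y j - ∑ i, x i := by
    simp_rw [mul_sub, mul_add, Finset.sum_sub_distrib, Finset.sum_add_distrib]
    congr 1
    · congr 1
      · rw [Finset.sum_comm]
        refine Finset.sum_congr rfl fun j _ => ?_
        rw [he.expVal_eq_sum hX, Finset.sum_mul]
        exact Finset.sum_congr rfl fun i _ => by ring
      · rw [Finset.sum_comm]
        simp_rw [← Finset.sum_mul, sum_overlap_left, one_mul]
    · simp_rw [← Finset.sum_mul, sum_overlap_right, one_mul]
  rwa [h3, h4] at h2

/-- Test `A ≤ W` on the vector `v = W⁻¹ e i`, the inverse being zero on the kernel. If `q` is the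
sum, then `α i * q² ≤ ⟨v, A v⟩ ≤ ⟨v, W v⟩ = q`. -/
theorem mul_sum_overlap_div_le {A W : V →L[ℂ] V} (hA : A.IsPositive) (hW : W.IsPositive)
    (hAW : (W - A).IsPositive) {e : HilbertBasis ι ℂ V} {α : ι → ℝ} (he : IsDiagonal A e α)
    {f : HilbertBasis κ ℂ V} {w : κ → ℝ} (hf : IsDiagonal W f w) (i : ι) :
    α i * ∑ j, ‖⟪e i, f j⟫_ℂ‖ ^ 2 / w j ≤ 1 := by
  set q := ∑ j, ‖⟪e i, f j⟫_ℂ‖ ^ 2 / w j with hq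
  have hq0 : 0 ≤ q := Finset.sum_nonneg fun j _ => div_nonneg (by positivity) (hf.nonneg hW j)
  set v : V := ∑ j, (⟪f j, e i⟫_ℂ / (w j : ℂ)) • f j with hv
  have h1 : ⟪e i, v⟫_ℂ = (q : ℂ) := by
    rw [hv, inner_sum, hq, Complex.ofReal_sum]
    refine Finset.sum_congr rfl fun j _ => ?_
    rw [inner_smul_right, ← inner_conj_symm (f j) (e i), div_mul_eq_mul_div,
      ← Complex.normSq_eq_conj_mul_self, Complex.normSq_eq_norm_sq, Complex.ofReal_div]
  have h2 : ∀ j, ⟪f j, v⟫_ℂ = ⟪f j, e i⟫_ℂ / (w j : ℂ) := by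
    classical
    intro j
    simp_rw [hv, inner_sum, inner_smul_right, orthonormal_iff_ite.1 f.orthonormal]
    simp
  have h3 : expVal W v = q := by
    rw [hf.expVal_eq_sum hW, hq]
    refine Finset.sum_congr rfl fun j _ => ?_
    rw [h2, norm_div, Complex.norm_real, div_pow, Real.norm_eq_abs, sq_abs, norm_inner_symm]
    by_cases hw : w j = 0
    · simp [hw]
    · field_simp
  have h4 : α i * q ^ 2 ≤ expVal A v := by
    rw [he.expVal_eq_sum hA]
    have h5 := Finset.single_le_sum (f := fun i => α i * ‖⟪e i, v⟫_ℂ‖ ^ 2)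
      (fun k _ => mul_nonneg (he.nonneg hA k) (by positivity)) (Finset.mem_univ i)
    simpa only [h1, Complex.norm_real, Real.norm_eq_abs, sq_abs] using h5
  have h5 := h4.trans ((expVal_le hAW v).trans h3.le)
  rcases hq0.eq_or_lt with h0 | h0
  · rw [← h0]; simp
  · by_contra hcon
    nlinarith

/-- A consequence of operator monotonicity of the logarithm, namely `-Tr A log W ≤ -Tr A log A` for
`A ≤ W`. It is enough to average `-log w ≤ -log α - 1 + α / w` over the overlaps, since the average
of `α / w` is at most `1`. -/
theorem sum_expVal_mul_neg_log_le {A W : V →L[ℂ] V} (hA : A.IsPositive) (hW : W.IsPositive)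
    (hAW : (W - A).IsPositive) {e : HilbertBasis ι ℂ V} {α : ι → ℝ} (he : IsDiagonal A e α)
    {f : HilbertBasis κ ℂ V} {w : κ → ℝ} (hf : IsDiagonal W f w) :
    ∑ j, expVal A (f j) * (-log (w j)) ≤ ∑ i, negMulLog (α i) := by
  have h1 : ∑ j, expVal A (f j) * (-log (w j))
      = ∑ i, α i * ∑ j, ‖⟪e i, f j⟫_ℂ‖ ^ 2 * (-log (w j)) := by
    simp_rw [he.expVal_eq_sum hA, Finset.sum_mul, Finset.mul_sum]
    rw [Finset.sum_comm]
    exact Finset.sum_congr rfl fun i _ => Finset.sum_congr rfl fun j _ => by ring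
  rw [h1]
  refine Finset.sum_le_sum fun i _ => ?_
  rcases (he.nonneg hA i).eq_or_lt with h0 | h0
  · rw [← h0]; simp
  · have h2 : ∀ j, ‖⟪e i, f j⟫_ℂ‖ ^ 2 * (-log (w j))
        ≤ ‖⟪e i, f j⟫_ℂ‖ ^ 2 * (-log (α i) - 1) + α i * (‖⟪e i, f j⟫_ℂ‖ ^ 2 / w j) := by
      intro j
      rcases (hf.nonneg hW j).eq_or_lt with hw | hw
      · have h3 : α i * ‖⟪e i, f j⟫_ℂ‖ ^ 2 ≤ 0 := by
          have h5 := Finset.single_le_sum (f := fun i => α i * ‖⟪e i, f j⟫_ℂ‖ ^ 2)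
            (fun k _ => mul_nonneg (he.nonneg hA k) (by positivity)) (Finset.mem_univ i)
          refine h5.trans ?_
          rw [← he.expVal_eq_sum hA, hw, ← hf.expVal_eq j]
          exact expVal_le hAW _
        have h4 : ‖⟪e i, f j⟫_ℂ‖ ^ 2 = 0 := by
          nlinarith [sq_nonneg ‖⟪e i, f j⟫_ℂ‖]
        rw [h4]; simp
      · have h3 := neg_log_ge_tangent (x := (w j)⁻¹) (y := (α i)⁻¹) (by positivity) (by positivity)
        rw [Real.log_inv, Real.log_inv] at h3
        have h6 : ((w j)⁻¹ - (α i)⁻¹) / (α i)⁻¹ = α i / w j - 1 := by field_simp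
        have h4 : -log (w j) ≤ -log (α i) - 1 + α i / w j := by linarith
        calc _ ≤ ‖⟪e i, f j⟫_ℂ‖ ^ 2 * (-log (α i) - 1 + α i / w j) := by gcongr
          _ = _ := by ring
    have h3 := Finset.sum_le_sum fun j (_ : j ∈ Finset.univ) => h2 j
    rw [Finset.sum_add_distrib, ← Finset.sum_mul, sum_overlap_right, ← Finset.mul_sum] at h3
    have h4 := mul_sum_overlap_div_le hA hW hAW he hf i
    rw [negMulLog, neg_mul, ← mul_neg]
    gcongr
    linarith

/-- Write the entropy of `W = A + D` as `-Tr A log W - Tr D log W`; both `A` and `D` are below `W`.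
-/
theorem sum_negMulLog_add_le {A D : V →L[ℂ] V} (hA : A.IsPositive) (hD : D.IsPositive)
    {κ' : Type*} [Fintype κ']
    {e : HilbertBasis ι ℂ V} {α : ι → ℝ} (he : IsDiagonal A e α)
    {g : HilbertBasis κ' ℂ V} {δ : κ' → ℝ} (hg : IsDiagonal D g δ)
    {f : HilbertBasis κ ℂ V} {w : κ → ℝ} (hf : IsDiagonal (A + D) f w) :
    ∑ j, negMulLog (w j) ≤ ∑ i, negMulLog (α i) + ∑ i, negMulLog (δ i) := by
  have h1 := sum_expVal_mul_neg_log_le hA (hA.add hD) (by rwa [add_sub_cancel_left]) he hf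
  have h2 := sum_expVal_mul_neg_log_le hD (hA.add hD) (by rwa [add_sub_cancel_right]) hg hf
  have h3 : ∑ j, negMulLog (w j)
      = ∑ j, expVal A (f j) * (-log (w j)) + ∑ j, expVal D (f j) * (-log (w j)) := by
    rw [← Finset.sum_add_distrib]
    refine Finset.sum_congr rfl fun j _ => ?_
    rw [← add_mul, ← expVal_add, hf.expVal_eq, negMulLog]
    ring
  linarith

/-- With `N` steps of length `1 / N` the total loss is `C / N`. This replaces differentiating the
entropy along a path of operators. -/
theorem le_of_forall_sub_sq_le {G : ℝ → ℝ} {C : ℝ}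
    (h : ∀ u v, 0 ≤ u → 0 < v → G u - C * v ^ 2 ≤ G (u + v)) : G 0 ≤ G 1 := by
  have h1 : ∀ (N : ℕ), 0 < N → G 0 - C / N ≤ G 1 := by
    intro N hN
    have hN' : (0 : ℝ) < N := by exact_mod_cast hN
    have h2 : ∀ k : ℕ, G 0 - k * (C * (1 / N) ^ 2) ≤ G (k * (1 / N)) := by
      intro k
      induction k with
      | zero => simp
      | succ k ih =>
        have h3 := h (k * (1 / N)) (1 / N) (by positivity) (by positivity)
        have h4 : ((k + 1 : ℕ) : ℝ) * (1 / N) = k * (1 / N) + 1 / N := by push_cast; ring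
        rw [h4]
        push_cast
        linarith
    have h3 := h2 N
    have h4 : (N : ℝ) * (1 / N) = 1 := by field_simp
    have h5 : (N : ℝ) * (C * (1 / N) ^ 2) = C / N := by field_simp
    rwa [h4, h5] at h3
  have h2 : Tendsto (fun N : ℕ => G 0 - C / N) atTop (𝓝 (G 0 - 0)) :=
    tendsto_const_nhds.sub (tendsto_const_div_atTop_nhds_zero_nat C)
  rw [sub_zero] at h2
  refine le_of_tendsto h2 ?_
  filter_upwards [eventually_gt_atTop 0] with N hN using h1 N hN

variable [FiniteDimensional ℂ V]

theorem exists_isDiagonal_fin {A : V →L[ℂ] V} (hA : IsSelfAdjoint A) :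
    ∃ (e : HilbertBasis (Fin (Module.finrank ℂ V)) ℂ V) (α : Fin (Module.finrank ℂ V) → ℝ),
      IsDiagonal A e α := by
  have hs : (A : V →ₗ[ℂ] V).IsSymmetric := hA.isSymmetric
  refine ⟨(hs.eigenvectorBasis rfl).toHilbertBasis, hs.eigenvalues rfl, fun i => ?_⟩
  rw [OrthonormalBasis.coe_toHilbertBasis]
  exact hs.apply_eigenvectorBasis rfl i

/-- With `X = u S + D` and `X' = X + v S`, Klein's inequality bounds the increment below by `-v Tr S
log X' - v Tr S`. Then `-log` is replaced by its tangent at `(u + v) s j + c`, averaged over the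
spectrum of `X'` in the vector `f j`. -/
theorem entropy_increment_ge {S D : V →L[ℂ] V} (hS : S.IsPositive) (hD : D.IsPositive)
    {f : HilbertBasis κ ℂ V} {s : κ → ℝ} (hf : IsDiagonal S f s) {c : ℝ} (hc : 0 < c)
    {u v : ℝ} (hu : 0 ≤ u) (hv : 0 < v) {ι' : Type*} [Fintype ι']
    {e : HilbertBasis ι ℂ V} {x : ι → ℝ} (he : IsDiagonal ((u : ℂ) • S + D) e x)
    {e' : HilbertBasis ι' ℂ V} {x' : ι' → ℝ} (he' : IsDiagonal (((u + v : ℝ) : ℂ) • S + D) e' x') :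
    v * ∑ j, s j * (-log ((u + v) * s j + c) - (expVal D (f j) - c) / ((u + v) * s j + c) - 1)
      ≤ ∑ i, negMulLog (x' i) - ∑ i, negMulLog (x i) := by
  have hX : ((u : ℂ) • S + D).IsPositive := (isPositive_smul hS hu).add hD
  have hX' : (((u + v : ℝ) : ℂ) • S + D).IsPositive := (isPositive_smul hS (by positivity)).add hD
  have hx' := he'.nonneg hX'
  have hs := hf.nonneg hS
  have hexp : ∀ z, expVal (((u + v : ℝ) : ℂ) • S + D) z
      = expVal ((u : ℂ) • S + D) z + v * expVal S z := by
    intro z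
    rw [expVal_add, expVal_add, expVal_smul, expVal_smul]; ring
  have hker : ∀ i, x' i = 0 → expVal ((u : ℂ) • S + D) (e' i) = 0 ∧ expVal S (e' i) = 0 := by
    intro i hi
    have h1 := hexp (e' i)
    rw [he'.expVal_eq, hi] at h1
    have h2 := expVal_nonneg hX (e' i)
    have h3 := expVal_nonneg hS (e' i)
    constructor <;> nlinarith
  have hK := sum_negMulLog_le hX he e' hx' fun i hi => (hker i hi).1
  have h1 : ∑ i, negMulLog (x' i) = ∑ i, expVal ((u : ℂ) • S + D) (e' i) * (-log (x' i))
      + v * ∑ i, expVal S (e' i) * (-log (x' i)) := by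
    rw [Finset.mul_sum, ← Finset.sum_add_distrib]
    refine Finset.sum_congr rfl fun i _ => ?_
    rw [← mul_assoc, ← add_mul, ← hexp, he'.expVal_eq, negMulLog]
    ring
  have h2 : ∑ i, x' i = ∑ i, x i + v * ∑ j, s j := by
    rw [← he'.sum_expVal hX' f, ← he.sum_expVal hX f, Finset.mul_sum, ← Finset.sum_add_distrib]
    exact Finset.sum_congr rfl fun j _ => by rw [hexp, hf.expVal_eq]
  have h3 : ∑ j, s j * (-log ((u + v) * s j + c)
      - (expVal D (f j) - c) / ((u + v) * s j + c))
      ≤ ∑ i, expVal S (e' i) * (-log (x' i)) := by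
    have h4 : ∑ i, expVal S (e' i) * (-log (x' i))
        = ∑ j, ∑ i, s j * ‖⟪f j, e' i⟫_ℂ‖ ^ 2 * (-log (x' i)) := by
      simp_rw [hf.expVal_eq_sum hS, Finset.sum_mul]
      rw [Finset.sum_comm]
    rw [h4]
    refine Finset.sum_le_sum fun j _ => ?_
    set y := (u + v) * s j + c with hy
    have hypos : 0 < y := by have := hs j; positivity
    have h5 : ∀ i, s j * ‖⟪f j, e' i⟫_ℂ‖ ^ 2 * (-log y - (x' i - y) / y)
        ≤ s j * ‖⟪f j, e' i⟫_ℂ‖ ^ 2 * (-log (x' i)) := by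
      intro i
      rcases (hx' i).eq_or_lt with h0 | h0
      · have h6 := (hker i h0.symm).2
        rw [hf.expVal_eq_sum hS, Finset.sum_eq_zero_iff_of_nonneg
          fun j _ => mul_nonneg (hs j) (by positivity)] at h6
        rw [h6 j (Finset.mem_univ j), zero_mul, zero_mul]
      · exact mul_le_mul_of_nonneg_left (neg_log_ge_tangent h0 hypos)
          (mul_nonneg (hs j) (by positivity))
    refine le_trans (le_of_eq ?_) (Finset.sum_le_sum fun i _ => h5 i)
    have h6 : ∑ i, ‖⟪f j, e' i⟫_ℂ‖ ^ 2 * x' i = (u + v) * s j + expVal D (f j) := by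
      have h7 := he'.expVal_eq_sum hX' (f j)
      rw [expVal_add, expVal_smul, hf.expVal_eq] at h7
      rw [h7]
      exact Finset.sum_congr rfl fun i _ => by rw [norm_inner_symm, mul_comm]
    have h8 : ∀ i, s j * ‖⟪f j, e' i⟫_ℂ‖ ^ 2 * (-log y - (x' i - y) / y)
        = s j * (-log y + 1) * ‖⟪f j, e' i⟫_ℂ‖ ^ 2
          - s j / y * (‖⟪f j, e' i⟫_ℂ‖ ^ 2 * x' i) := by
      intro i; field_simp; ring
    simp_rw [h8]
    rw [Finset.sum_sub_distrib, ← Finset.mul_sum, ← Finset.mul_sum, sum_overlap_right, h6]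
    have h9 : expVal D (f j) - c = (u + v) * s j + expVal D (f j) - y := by rw [hy]; ring
    rw [h9]
    field_simp
    ring
  have h4 : ∑ j, s j * (-log ((u + v) * s j + c) - (expVal D (f j) - c) / ((u + v) * s j + c) - 1)
      = ∑ j, s j * (-log ((u + v) * s j + c)
        - (expVal D (f j) - c) / ((u + v) * s j + c)) - ∑ j, s j := by
    rw [← Finset.sum_sub_distrib]
    exact Finset.sum_congr rfl fun j _ => by ring
  rw [h4]
  have h5 := mul_le_mul_of_nonneg_left h3 hv.le
  rw [mul_sub]
  linarith

theorem sum_negMulLog_le_of_isDiagonal {X : V →L[ℂ] V} (hX : X.IsPositive)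
    {e : HilbertBasis ι ℂ V} {x : ι → ℝ} (he : IsDiagonal X e x)
    {f : HilbertBasis κ ℂ V} {y : κ → ℝ} (hf : IsDiagonal X f y) :
    ∑ i, negMulLog (x i) ≤ ∑ j, negMulLog (y j) := by
  have h1 := sum_negMulLog_le hX he f (hf.nonneg hX) fun j hj => by rw [hf.expVal_eq, hj]
  rw [← hf.sum_expVal hX e] at h1
  simp_rw [he.expVal_eq, hf.expVal_eq] at h1
  simp_rw [negMulLog, neg_mul, ← mul_neg] at h1 ⊢
  linarith

theorem sum_negMulLog_eq {X : V →L[ℂ] V} (hX : X.IsPositive) {e : HilbertBasis ι ℂ V} {x : ι → ℝ}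
    (he : IsDiagonal X e x) {f : HilbertBasis κ ℂ V} {y : κ → ℝ} (hf : IsDiagonal X f y) :
    ∑ i, negMulLog (x i) = ∑ j, negMulLog (y j) :=
  le_antisymm (sum_negMulLog_le_of_isDiagonal hX he hf) (sum_negMulLog_le_of_isDiagonal hX hf he)

/-- In terms of the relative entropy this is `D(S + D ‖ S + c) ≤ D(D ‖ c)`, a case of joint
convexity. Along the path `u S + D` with reference `u S + c`, the function `G` is minus the relative
entropy; the first-order terms in the lower bound for its increments cancel. -/
theorem negMulLog_sum_add_le {S D : V →L[ℂ] V} (hS : S.IsPositive) (hD : D.IsPositive)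
    {f : HilbertBasis κ ℂ V} {s : κ → ℝ} (hf : IsDiagonal S f s) {c : ℝ} (hc : 0 < c)
    {ι' : Type*} [Fintype ι'] {e : HilbertBasis ι ℂ V} {x : ι → ℝ} (he : IsDiagonal D e x)
    {e' : HilbertBasis ι' ℂ V} {x' : ι' → ℝ} (he' : IsDiagonal (S + D) e' x') :
    ∑ i, negMulLog (x i) + (∑ j, expVal D (f j)) * log c
      ≤ ∑ i, negMulLog (x' i) + ∑ j, (s j + expVal D (f j)) * log (s j + c) := by
  have hs := hf.nonneg hS
  have hsa : ∀ u : ℝ, IsSelfAdjoint ((u : ℂ) • S + D) := fun u =>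
    (IsSelfAdjoint.smul (by simp [IsSelfAdjoint]) hS.isSelfAdjoint).add hD.isSelfAdjoint
  choose b t ht using fun u : ℝ => exists_isDiagonal_fin (hsa u)
  let G : ℝ → ℝ := fun u => ∑ i, negMulLog (t u i)
    + ∑ j, (u * s j + expVal D (f j)) * log (u * s j + c)
  have hG : G 0 ≤ G 1 := by
    -- The second-order loss in coordinate `j` is `(v * s j)² / y'`, and `y' ≥ c`.
    refine le_of_forall_sub_sq_le (C := ∑ j, s j ^ 2 / c) fun u v hu hv => ?_
    have h1 := entropy_increment_ge hS hD hf hc hu hv (ht u) (ht (u + v))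
    have h2 : ∀ j, (u * s j + expVal D (f j)) * log (u * s j + c) - s j ^ 2 / c * v ^ 2
        ≤ v * (s j * (-log ((u + v) * s j + c)
          - (expVal D (f j) - c) / ((u + v) * s j + c) - 1))
          + ((u + v) * s j + expVal D (f j)) * log ((u + v) * s j + c) := by
      intro j
      have hsj := hs j
      have hdj := expVal_nonneg hD (f j)
      set y := u * s j + c with hy
      set y' := (u + v) * s j + c with hy'
      have hyp : 0 < y := by positivity
      have hyp' : 0 < y' := by positivity
      have hyy : y' = y + v * s j := by rw [hy, hy']; ring
      have hcy : c ≤ y' := by rw [hy']; nlinarith [mul_nonneg (add_nonneg hu hv.le) hsj]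
      have h3 := neg_log_ge_tangent hyp hyp'
      have h4 : (y - y') / y' = -(v * s j) / y' := by rw [hyy]; ring
      rw [h4] at h3
      have h5 : (u * s j + expVal D (f j)) * (log y + v * s j / y')
          ≤ (u * s j + expVal D (f j)) * log y' := by
        refine mul_le_mul_of_nonneg_left ?_ (by positivity)
        have : -(v * s j) / y' = -(v * s j / y') := by ring
        linarith
      have h6 : (v * s j) ^ 2 / y' ≤ s j ^ 2 / c * v ^ 2 := by
        rw [mul_pow, div_mul_eq_mul_div, mul_comm]
        gcongr
      have h7 : v * (s j * (-log y' - (expVal D (f j) - c) / y' - 1))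
          + ((u + v) * s j + expVal D (f j)) * log y'
          = (u * s j + expVal D (f j)) * log y' - (u * s j + expVal D (f j)) * (v * s j / y')
            - (v * s j) ^ 2 / y' := by
        have h8 : expVal D (f j) - c = u * s j + expVal D (f j) + v * s j - y' := by
          rw [hyy, hy]; ring
        rw [h8]
        field_simp
        ring
      rw [h7]
      linarith
    have h3 := Finset.sum_le_sum fun j (_ : j ∈ Finset.univ) => h2 j
    rw [Finset.sum_sub_distrib, Finset.sum_add_distrib, ← Finset.sum_mul, ← Finset.mul_sum] at h3
    simp only [G]
    linarith
  have h0 : ∑ i, negMulLog (x i) = ∑ i, negMulLog (t 0 i) :=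
    sum_negMulLog_eq hD he (by simpa using ht 0)
  have h1 : ∑ i, negMulLog (x' i) = ∑ i, negMulLog (t 1 i) :=
    sum_negMulLog_eq (hS.add hD) he' (by simpa using ht 1)
  rw [h0, h1, Finset.sum_mul]
  simpa [G] using hG

/-- An Alicki–Fannes–Winter argument with the reference fixed by constants `abar`, `ebar` instead of
by `a`, `e`. The right-hand side is then linear in `e`, and in `a` except for `a log a`, so that it
can later be averaged over the ensemble. -/
theorem afw_bound {A σ Dp Dm : V →L[ℂ] V} (hA : A.IsPositive) (hσ : σ.IsPositive)
    (hDp : Dp.IsPositive) (hDm : Dm.IsPositive) {f : HilbertBasis κ ℂ V} {s : κ → ℝ}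
    (hf : IsDiagonal σ f s) (hs1 : ∑ j, s j = 1) {a e : ℝ} (ha : ∑ j, expVal A (f j) = a)
    (hp : ∑ j, expVal Dp (f j) = e) (hm : ∑ j, expVal Dm (f j) = e)
    (hW : A + Dm = (a : ℂ) • σ + Dp) {abar ebar : ℝ} (habar : 0 < abar) (hebar : 0 < ebar)
    {b : HilbertBasis ι ℂ V} {α : ι → ℝ} (hb : IsDiagonal A b α) :
    ∑ j, expVal A (f j) * (-log (abar * s j + ebar / Fintype.card κ)) - ∑ i, negMulLog (α i)
      ≤ a * (log a - log abar)
        + e * (log (Fintype.card κ) - log ebar + log (abar + ebar)) := by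
  have hs := hf.nonneg hσ
  have hκ : Nonempty κ := by
    by_contra hne
    rw [not_nonempty_iff] at hne
    simp at hs1
  set d : ℝ := (Fintype.card κ : ℝ) with hd
  have hd1 : 1 ≤ d := by rw [hd]; exact_mod_cast Fintype.card_pos
  have hd0 : 0 < d := by linarith
  have ha0 : 0 ≤ a := ha ▸ Finset.sum_nonneg fun j _ => expVal_nonneg hA _
  have he0 : 0 ≤ e := hp ▸ Finset.sum_nonneg fun j _ => expVal_nonneg hDp _
  have hm0 : 0 < abar + ebar := by positivity
  rcases ha0.eq_or_lt with h0 | hapos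
  · have h1 : ∀ j, expVal A (f j) = 0 := fun j =>
      (Finset.sum_eq_zero_iff_of_nonneg fun j _ => expVal_nonneg hA (f j)).1
        (ha.trans h0.symm) j (Finset.mem_univ j)
    have h2 : ∑ i, α i = 0 := by rw [← hb.sum_expVal hA f, ha, h0]
    have h3 : ∀ i, α i = 0 := fun i =>
      (Finset.sum_eq_zero_iff_of_nonneg fun i _ => hb.nonneg hA i).1 h2 i (Finset.mem_univ i)
    have h4 : log ebar ≤ log (abar + ebar) := Real.log_le_log hebar (by linarith)
    have h5 : 0 ≤ log d := Real.log_nonneg hd1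
    simp only [h1, h3, ← h0, Real.negMulLog_zero, zero_mul, Finset.sum_const_zero, sub_zero,
      zero_add]
    exact mul_nonneg he0 (by linarith)
  · set τ : κ → ℝ := fun j => abar * s j + ebar / d with hτ
    have hτ0 : ∀ j, 0 < τ j := fun j => by have := hs j; positivity
    have hτ1 : ∑ j, τ j = abar + ebar := by
      simp only [hτ]
      rw [Finset.sum_add_distrib, ← Finset.mul_sum, hs1, Finset.sum_const, Finset.card_univ,
        nsmul_eq_mul, ← hd]
      field_simp
    obtain ⟨em, δ, hδ⟩ := exists_isDiagonal_fin hDm.isSelfAdjoint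
    obtain ⟨ep, π, hπ⟩ := exists_isDiagonal_fin hDp.isSelfAdjoint
    obtain ⟨ew, w, hw⟩ := exists_isDiagonal_fin (hA.add hDm).isSelfAdjoint
    have h1 := sum_negMulLog_add_le hA hDm hb hδ hw
    have hfa : IsDiagonal ((a : ℂ) • σ) f fun j => a * s j := fun j => by
      rw [smul_apply, hf j, smul_smul, Complex.ofReal_mul]
    -- With this constant the reference `a s + c` equals `(a / abar) τ`.
    have hc : 0 < a / abar * (ebar / d) := by positivity
    have h2 := negMulLog_sum_add_le (isPositive_smul hσ ha0) hDp hfa hc hπ (hW ▸ hw)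
    have h3 : negMulLog e ≤ ∑ i, negMulLog (π i) := by
      rw [← hp, hπ.sum_expVal hDp]
      exact negMulLog_sum_le (hπ.nonneg hDp)
    have hδe : ∑ i, δ i = e := by rw [← hδ.sum_expVal hDm f, hm]
    have h4 : ∑ i, negMulLog (δ i)
        ≤ ∑ j, expVal Dm (f j) * (-log (τ j)) - e * (log e - log (abar + ebar)) := by
      rcases he0.eq_or_lt with h0 | hepos
      · have h5 : ∀ i, δ i = 0 := fun i =>
          (Finset.sum_eq_zero_iff_of_nonneg fun i _ => hδ.nonneg hDm i).1 (hδe.trans h0.symm) i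
            (Finset.mem_univ i)
        have h6 : ∀ j, expVal Dm (f j) = 0 := fun j =>
          (Finset.sum_eq_zero_iff_of_nonneg fun j _ => expVal_nonneg hDm (f j)).1
            (hm.trans h0.symm) j (Finset.mem_univ j)
        simp [h5, h6, ← h0]
      -- The reference is `τ` rescaled to trace `e`, so the trace terms of Klein's inequality
      -- cancel.
      · have h5 := sum_negMulLog_le hDm hδ f (y := fun j => e / (abar + ebar) * τ j)
          (fun j => by have := hτ0 j; positivity)
          (fun j hj => absurd hj (by have := hτ0 j; positivity))
        rw [← Finset.mul_sum, hτ1, hδe, div_mul_cancel₀ _ hm0.ne', add_sub_cancel_right] at h5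
        refine h5.trans (le_of_eq ?_)
        rw [← hm, Finset.sum_mul, ← Finset.sum_sub_distrib]
        refine Finset.sum_congr rfl fun j _ => ?_
        rw [hm, Real.log_mul (by positivity) (hτ0 j).ne', Real.log_div hepos.ne' hm0.ne']
        ring
    have h5 : ∀ j, (a * s j + expVal Dp (f j)) * log (a * s j + a / abar * (ebar / d))
        = (expVal A (f j) + expVal Dm (f j)) * (log a - log abar + log (τ j)) := by
      intro j
      have h6 : a * s j + a / abar * (ebar / d) = a / abar * τ j := by
        simp only [hτ]; field_simp
      have h7 : a * s j + expVal Dp (f j) = expVal A (f j) + expVal Dm (f j) := by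
        rw [← expVal_add A Dm, hW, expVal_add, expVal_smul, hf.expVal_eq]
      rw [h6, h7, Real.log_mul (by positivity) (hτ0 j).ne', Real.log_div hapos.ne' habar.ne']
    simp_rw [h5, mul_add, add_mul, Finset.sum_add_distrib, ← Finset.sum_mul, ha, hm, hp] at h2
    have h8 : log (a / abar * (ebar / d)) = log a - log abar + (log ebar - log d) := by
      rw [Real.log_mul (by positivity) (by positivity), Real.log_div hapos.ne' habar.ne',
        Real.log_div hebar.ne' hd0.ne']
    rw [h8] at h2
    simp_rw [mul_neg, Finset.sum_neg_distrib] at h4 ⊢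
    rw [negMulLog] at h3
    nlinarith

end FiniteDim

/-! ### Entropy and relative entropy as series -/

section Entropy

open Real (negMulLog log)

variable {𝓗 : Type*} [NormedAddCommGroup 𝓗] [InnerProductSpace ℂ 𝓗] [CompleteSpace 𝓗]
variable {ι κ : Type*}

theorem IsDiagonal.opTrace_eq {T : 𝓗 →L[ℂ] 𝓗} {b : HilbertBasis ι ℂ 𝓗} {t : ι → ℝ}
    (h : IsDiagonal T b t) (hT : T.IsPositive) : opTrace T = ∑' i, ENNReal.ofReal (t i) := by
  rw [opTrace_eq_tsum hT b]
  simp_rw [h.expVal_eq]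

theorem QState.expVal_le_one (ρ : QState 𝓗) {x : 𝓗} (hx : ‖x‖ = 1) : expVal ρ.op x ≤ 1 := by
  have := ofReal_expVal_le_opTrace ρ.isPositive hx
  rwa [ρ.trace_eq_one, ENNReal.ofReal_le_one] at this

theorem IsDiagonal.le_one {ρ : QState 𝓗} {b : HilbertBasis ι ℂ 𝓗} {p : ι → ℝ}
    (h : IsDiagonal ρ.op b p) (i : ι) : p i ≤ 1 := by
  rw [← h.expVal_eq i]; exact ρ.expVal_le_one (HilbertBasis.norm_eq_one b i)

theorem entropy_eq_tsum {ρ : QState 𝓗} {b : HilbertBasis ι ℂ 𝓗} {p : ι → ℝ}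
    (h : IsDiagonal ρ.op b p) : entropy ρ.op = ∑' i, ENNReal.ofReal (negMulLog (p i)) := by
  have h0 : 0 ≤ ρ.op := (ContinuousLinearMap.nonneg_iff_isPositive _).2 ρ.isPositive
  have hspec : ∀ r ∈ spectrum ℝ ρ.op, 0 ≤ negMulLog r := by
    intro r hr
    refine Real.negMulLog_nonneg (spectrum_nonneg_of_nonneg h0 hr) ?_
    have h2 : ‖(1 : 𝓗 →L[ℂ] 𝓗)‖ ≤ 1 := ContinuousLinearMap.norm_id_le
    calc r ≤ ‖r‖ := Real.le_norm_self r
      _ ≤ ‖ρ.op‖ * ‖(1 : 𝓗 →L[ℂ] 𝓗)‖ := spectrum.norm_le_norm_mul_of_mem hr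
      _ ≤ 1 * 1 := by gcongr; exact ρ.norm_op_le
      _ = 1 := one_mul 1
  have hpos : (cfc negMulLog ρ.op).IsPositive :=
    (ContinuousLinearMap.nonneg_iff_isPositive _).1 (cfc_nonneg hspec)
  exact (h.cfc ρ.isPositive.isSelfAdjoint
    Real.continuous_negMulLog.continuousOn).opTrace_eq hpos

theorem QState.exists_isEigenbasis (ρ : QState 𝓗) :
    ∃ (w : Set 𝓗) (b : HilbertBasis w ℂ 𝓗), IsEigenbasis ρ.op b :=
  exists_isEigenbasis_of_opTrace_ne_top ρ.isPositive (by simp [ρ.trace_eq_one])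

theorem relTerm_add_eq {c p s : ℝ} (hc : 0 ≤ c) (hp : 0 ≤ p) (hp1 : p ≤ 1) (hs : 0 ≤ s)
    (hs1 : s ≤ 1) (h0 : s = 0 → c * p = 0) :
    ENNReal.ofReal c * relTerm p s
        + (ENNReal.ofReal c * ENNReal.ofReal (negMulLog p) + ENNReal.ofReal c * ENNReal.ofReal p)
      = ENNReal.ofReal (-log s) * (ENNReal.ofReal p * ENNReal.ofReal c)
        + ENNReal.ofReal c * ENNReal.ofReal s := by
  rcases hs.eq_or_lt with rfl | hs
  · rcases mul_eq_zero.1 (h0 rfl) with rfl | rfl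
    · simp
    · simp [relTerm]
  · have h1 : 0 ≤ negMulLog p := Real.negMulLog_nonneg hp hp1
    have h2 : 0 ≤ -log s := by have := Real.log_nonpos hs.le hs1; linarith
    have h3 := negMulLog_le_tangent hp hs
    have h4 : 0 ≤ p * log p - p * log s + s - p := by
      rw [negMulLog] at h3; linarith
    rw [relTerm, if_neg hs.ne', ← mul_add, ← mul_add, ← ENNReal.ofReal_add h1 hp,
      ← ENNReal.ofReal_add h4 (by positivity), ← ENNReal.ofReal_mul hc, ← ENNReal.ofReal_mul hp,
      ← ENNReal.ofReal_mul h2, ← ENNReal.ofReal_mul hc,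
      ← ENNReal.ofReal_add (by positivity) (by positivity)]
    congr 1
    rw [negMulLog]
    ring

/-- The identity `D(ρ ‖ s) + H(ρ) = -Tr ρ log s`, with the trace corrections arranged so that all
terms are nonnegative. It then holds in `[0, ∞]` by exchanging sums, with no finiteness assumption.
-/
theorem tsum_relTerm_add_entropy {ρ : QState 𝓗} {e : HilbertBasis ι ℂ 𝓗} {p : ι → ℝ}
    (he : IsDiagonal ρ.op e p) (f : HilbertBasis κ ℂ 𝓗) {s : κ → ℝ} (hs : ∀ j, 0 ≤ s j)
    (hs1 : ∀ j, s j ≤ 1) (hs0 : ∀ j, s j = 0 → expVal ρ.op (f j) = 0) :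
    ∑' i, ∑' j, ENNReal.ofReal (‖⟪e i, f j⟫_ℂ‖ ^ 2) * relTerm (p i) (s j) + (entropy ρ.op + 1)
      = ∑' j, ENNReal.ofReal (-log (s j)) * ENNReal.ofReal (expVal ρ.op (f j))
        + ∑' j, ENNReal.ofReal (s j) := by
  have hp := he.nonneg ρ.isPositive
  have hone : ∀ i, ∑' j, ENNReal.ofReal (‖⟪e i, f j⟫_ℂ‖ ^ 2) = 1 := fun i => by
    rw [tsum_norm_inner_sq', HilbertBasis.norm_eq_one]; simp
  have hone' : ∀ j, ∑' i, ENNReal.ofReal (‖⟪e i, f j⟫_ℂ‖ ^ 2) = 1 := fun j => by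
    rw [tsum_norm_inner_sq, HilbertBasis.norm_eq_one]; simp
  have hzero : ∀ i j, s j = 0 → ‖⟪e i, f j⟫_ℂ‖ ^ 2 * p i = 0 := by
    intro i j hj
    have h1 := he.hasSum_expVal ρ.isPositive.isSelfAdjoint (f j)
    rw [hs0 j hj, hasSum_zero_iff_of_nonneg fun i => mul_nonneg (hp i) (by positivity)] at h1
    rw [mul_comm]
    exact congrFun h1 i
  have hent : entropy ρ.op = ∑' i, ∑' j,
      ENNReal.ofReal (‖⟪e i, f j⟫_ℂ‖ ^ 2) * ENNReal.ofReal (negMulLog (p i)) := by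
    simp_rw [ENNReal.tsum_mul_right, hone, one_mul]
    exact entropy_eq_tsum he
  have htr : 1 = ∑' i, ∑' j,
      ENNReal.ofReal (‖⟪e i, f j⟫_ℂ‖ ^ 2) * ENNReal.ofReal (p i) := by
    simp_rw [ENNReal.tsum_mul_right, hone, one_mul]
    rw [← he.opTrace_eq ρ.isPositive, ρ.trace_eq_one]
  have hN : ∑' j, ENNReal.ofReal (-log (s j)) * ENNReal.ofReal (expVal ρ.op (f j))
      = ∑' i, ∑' j, ENNReal.ofReal (-log (s j))
        * (ENNReal.ofReal (p i) * ENNReal.ofReal (‖⟪e i, f j⟫_ℂ‖ ^ 2)) := by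
    rw [ENNReal.tsum_comm]
    refine tsum_congr fun j => ?_
    rw [ENNReal.tsum_mul_left, he.tsum_expVal ρ.isPositive]
  have hS : ∑' j, ENNReal.ofReal (s j)
      = ∑' i, ∑' j, ENNReal.ofReal (‖⟪e i, f j⟫_ℂ‖ ^ 2) * ENNReal.ofReal (s j) := by
    rw [ENNReal.tsum_comm]
    simp_rw [ENNReal.tsum_mul_right, hone', one_mul]
  rw [hN, hS, hent]
  nth_rewrite 1 [htr]
  simp_rw [← ENNReal.tsum_add]
  exact tsum_congr fun i => tsum_congr fun j =>
    relTerm_add_eq (by positivity) (hp i) (he.le_one i) (hs j) (hs1 j) (hzero i j)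

theorem entropy_add_one_le (ρ : QState 𝓗) (f : HilbertBasis κ ℂ 𝓗) {s : κ → ℝ}
    (hs : ∀ j, 0 ≤ s j) (hs1 : ∀ j, s j ≤ 1) (hs0 : ∀ j, s j = 0 → expVal ρ.op (f j) = 0) :
    entropy ρ.op + 1
      ≤ ∑' j, ENNReal.ofReal (-log (s j)) * ENNReal.ofReal (expVal ρ.op (f j))
        + ∑' j, ENNReal.ofReal (s j) := by
  obtain ⟨w, e, he⟩ := ρ.exists_isEigenbasis
  rw [← tsum_relTerm_add_entropy (isDiagonal_of_isEigenbasis ρ.isPositive.isSelfAdjoint he)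
    f hs hs1 hs0]
  exact le_add_self

/-- The relative entropy is an infimum over eigenbases, so one choice suffices for this direction.
-/
theorem relEntropy_add_entropy_le (ρ τ : QState 𝓗) {v : Set 𝓗} {f : HilbertBasis v ℂ 𝓗}
    (hf : IsEigenbasis τ.op f)
    (h0 : ∀ j, expVal τ.op (f j) = 0 → expVal ρ.op (f j) = 0) :
    relEntropy ρ.op τ.op + entropy ρ.op
      ≤ ∑' j, ENNReal.ofReal (-log (expVal τ.op (f j))) * ENNReal.ofReal (expVal ρ.op (f j)) := by
  obtain ⟨w, e, he⟩ := ρ.exists_isEigenbasis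
  have h1 := tsum_relTerm_add_entropy
    (isDiagonal_of_isEigenbasis ρ.isPositive.isSelfAdjoint he) f
    (fun j => expVal_nonneg τ.isPositive (f j))
    (fun j => τ.expVal_le_one (HilbertBasis.norm_eq_one f j)) h0
  rw [← opTrace_eq_tsum τ.isPositive f, τ.trace_eq_one, ← add_assoc] at h1
  rw [← (ENNReal.add_left_inj ENNReal.one_ne_top).1 h1]
  gcongr
  exact iInf₂_le_of_le w e (iInf₂_le_of_le he v (iInf₂_le_of_le f hf le_rfl))

/-! ### Compression to a closed subspace and extension by zero -/

section Compression

variable (K : Submodule ℂ 𝓗) [CompleteSpace K]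

/-- The compression of an operator to a closed subspace. -/
def compress (T : 𝓗 →L[ℂ] 𝓗) : K →L[ℂ] K :=
  (ContinuousLinearMap.adjoint K.subtypeL) ∘L T ∘L K.subtypeL

/-- The extension by zero of an operator on a closed subspace. -/
def extend (A : K →L[ℂ] K) : 𝓗 →L[ℂ] 𝓗 :=
  K.subtypeL ∘L A ∘L (ContinuousLinearMap.adjoint K.subtypeL)

variable {K}

theorem expVal_compress (T : 𝓗 →L[ℂ] 𝓗) (x : K) : expVal (compress K T) x = expVal T x := by
  rw [expVal, expVal, compress, ContinuousLinearMap.comp_apply,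
    ContinuousLinearMap.adjoint_inner_right]
  rfl

theorem expVal_extend (A : K →L[ℂ] K) (x : 𝓗) :
    expVal (extend K A) x = expVal A (ContinuousLinearMap.adjoint K.subtypeL x) := by
  rw [expVal, expVal, extend, ContinuousLinearMap.comp_apply,
    ← ContinuousLinearMap.adjoint_inner_left]
  rfl

theorem isPositive_compress {T : 𝓗 →L[ℂ] 𝓗} (hT : T.IsPositive) : (compress K T).IsPositive :=
  hT.adjoint_conj _

theorem isPositive_extend {A : K →L[ℂ] K} (hA : A.IsPositive) : (extend K A).IsPositive :=
  hA.conj_adjoint _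

theorem adjoint_subtypeL_coe (x : K) : ContinuousLinearMap.adjoint K.subtypeL (x : 𝓗) = x := by
  refine ext_inner_left ℂ fun v => ?_
  rw [ContinuousLinearMap.adjoint_inner_right]
  rfl

theorem adjoint_subtypeL_of_mem_orthogonal {x : 𝓗} (hx : x ∈ Kᗮ) :
    ContinuousLinearMap.adjoint K.subtypeL x = 0 := by
  refine ext_inner_left ℂ fun v => ?_
  rw [ContinuousLinearMap.adjoint_inner_right, inner_zero_right]
  exact (Submodule.mem_orthogonal _ _).1 hx v v.2

variable {κ' : Type*}

theorem orthonormal_sum (f : HilbertBasis κ ℂ K) (g : HilbertBasis κ' ℂ Kᗮ) :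
    Orthonormal ℂ (Sum.elim (fun j => (f j : 𝓗)) fun j => (g j : 𝓗)) := by
  constructor
  · rintro (j | j)
    · exact f.orthonormal.1 j
    · exact g.orthonormal.1 j
  · rintro (i | i) (j | j) hij
    · exact f.orthonormal.2 fun h => hij (congrArg _ h)
    · exact (Submodule.mem_orthogonal _ _).1 (g j).2 _ (f i).2
    · exact (Submodule.mem_orthogonal' _ _).1 (g i).2 _ (f j).2
    · exact g.orthonormal.2 fun h => hij (congrArg _ h)

theorem eq_zero_of_inner_hilbertBasis_eq_zero {K : Submodule ℂ 𝓗} (f : HilbertBasis κ ℂ K) {x : 𝓗}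
    (h : ∀ j, ⟪(f j : 𝓗), x⟫_ℂ = 0) : x ∈ Kᗮ := by
  rw [Submodule.mem_orthogonal']
  intro y hy
  have h1 := ((f.hasSum_repr ⟨y, hy⟩).mapL K.subtypeL).mapL (innerSL ℂ x)
  refine h1.unique ?_
  convert hasSum_zero with i
  have h2 : ⟪x, (f i : 𝓗)⟫_ℂ = 0 := by rw [← inner_conj_symm, h i, map_zero]
  simp [h2]

/-- The orthonormal basis formed of bases of a closed subspace and of its complement. -/
def sumBasis (f : HilbertBasis κ ℂ K) (g : HilbertBasis κ' ℂ Kᗮ) :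
    HilbertBasis (κ ⊕ κ') ℂ 𝓗 :=
  HilbertBasis.mkOfOrthogonalEqBot (orthonormal_sum f g) (by
    rw [Submodule.eq_bot_iff]
    intro x hx
    have h1 : ∀ i, ⟪Sum.elim (fun j => (f j : 𝓗)) (fun j => (g j : 𝓗)) i, x⟫_ℂ = 0 := fun i =>
      (Submodule.mem_orthogonal _ _).1 hx _ (Submodule.subset_span ⟨i, rfl⟩)
    have h2 := eq_zero_of_inner_hilbertBasis_eq_zero f fun j => h1 (Sum.inl j)
    have h3 := eq_zero_of_inner_hilbertBasis_eq_zero g fun j => h1 (Sum.inr j)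
    exact inner_self_eq_zero.1 ((Submodule.mem_orthogonal _ _).1 h3 x h2))

theorem sumBasis_inl (f : HilbertBasis κ ℂ K) (g : HilbertBasis κ' ℂ Kᗮ) (j : κ) :
    sumBasis f g (Sum.inl j) = f j := by
  rw [sumBasis, HilbertBasis.coe_mkOfOrthogonalEqBot]; rfl

theorem sumBasis_inr (f : HilbertBasis κ ℂ K) (g : HilbertBasis κ' ℂ Kᗮ) (j : κ') :
    sumBasis f g (Sum.inr j) = g j := by
  rw [sumBasis, HilbertBasis.coe_mkOfOrthogonalEqBot]; rfl

theorem opTrace_eq_tsum_add_tsum {T : 𝓗 →L[ℂ] 𝓗} (hT : T.IsPositive) (f : HilbertBasis κ ℂ K)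
    (g : HilbertBasis κ' ℂ Kᗮ) :
    opTrace T = ∑' j, ENNReal.ofReal (expVal T (f j)) + ∑' j, ENNReal.ofReal (expVal T (g j)) := by
  rw [opTrace_eq_tsum hT (sumBasis f g), ENNReal.summable.tsum_sum ENNReal.summable]
  simp_rw [sumBasis_inl, sumBasis_inr]

theorem isDiagonal_extend {A : K →L[ℂ] K} {f : HilbertBasis κ ℂ K} {t : κ → ℝ}
    (hA : IsDiagonal A f t) (g : HilbertBasis κ' ℂ Kᗮ) :
    IsDiagonal (extend K A) (sumBasis f g) (Sum.elim t fun _ => 0) := by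
  rintro (j | j)
  · rw [sumBasis_inl]
    simp [extend, adjoint_subtypeL_coe, hA j]
  · rw [sumBasis_inr]
    simp [extend, adjoint_subtypeL_of_mem_orthogonal (g j).2]

theorem isDiagonal_extend_orthogonal {A : Kᗮ →L[ℂ] Kᗮ} (f : HilbertBasis κ ℂ K)
    {g : HilbertBasis κ' ℂ Kᗮ} {t : κ' → ℝ} (hA : IsDiagonal A g t) :
    IsDiagonal (extend Kᗮ A) (sumBasis f g) (Sum.elim (fun _ => 0) t) := by
  rintro (j | j)
  · rw [sumBasis_inl]
    have h : (f j : 𝓗) ∈ Kᗮᗮ := K.le_orthogonal_orthogonal (f j).2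
    simp [extend, adjoint_subtypeL_of_mem_orthogonal h]
  · rw [sumBasis_inr]
    simp [extend, adjoint_subtypeL_coe, hA j]

theorem sum_expVal_le_opTrace [Fintype κ] {T : 𝓗 →L[ℂ] 𝓗} (hT : T.IsPositive)
    (f : HilbertBasis κ ℂ K) : ENNReal.ofReal (∑ j, expVal T (f j)) ≤ opTrace T := by
  obtain ⟨w, g, -⟩ := exists_hilbertBasis ℂ Kᗮ
  rw [opTrace_eq_tsum_add_tsum hT f g, tsum_fintype,
    ENNReal.ofReal_sum_of_nonneg fun j _ => expVal_nonneg hT _]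
  exact le_self_add

end Compression

end Entropy

/-! ### Lower bounds for the entropy of a state by its compression -/

section Compressed

open Real (negMulLog log)

variable {𝓗 : Type*} [NormedAddCommGroup 𝓗] [InnerProductSpace ℂ 𝓗] [CompleteSpace 𝓗]
variable {ι κ : Type*} [Fintype κ] {K : Submodule ℂ 𝓗} [CompleteSpace K]

theorem mul_norm_inner_sq_le_expVal {ρ : 𝓗 →L[ℂ] 𝓗} (hρ : ρ.IsPositive) {e : HilbertBasis ι ℂ 𝓗}
    {p : ι → ℝ} (he : IsDiagonal ρ e p) (i : ι) (x : 𝓗) :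
    p i * ‖⟪e i, x⟫_ℂ‖ ^ 2 ≤ expVal ρ x :=
  le_hasSum (he.hasSum_expVal hρ.isSelfAdjoint x) i
    fun k _ => mul_nonneg (he.nonneg hρ k) (by positivity)

/-- The test vector is the inverse of the compression applied to the projection of `e i`, as in
`mul_sum_overlap_div_le`. -/
theorem mul_sum_div_compress_le {ρ : 𝓗 →L[ℂ] 𝓗} (hρ : ρ.IsPositive) {e : HilbertBasis ι ℂ 𝓗}
    {p : ι → ℝ} (he : IsDiagonal ρ e p) {g : HilbertBasis κ ℂ K} {α : κ → ℝ}
    (hg : IsDiagonal (compress K ρ) g α) (i : ι) :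
    p i * ∑ j, ‖⟪e i, (g j : 𝓗)⟫_ℂ‖ ^ 2 / α j ≤ 1 := by
  have hA := isPositive_compress (K := K) hρ
  set q := ∑ j, ‖⟪e i, (g j : 𝓗)⟫_ℂ‖ ^ 2 / α j with hq
  have hq0 : 0 ≤ q := Finset.sum_nonneg fun j _ => div_nonneg (by positivity) (hg.nonneg hA j)
  set v : K := ∑ j, (⟪(g j : 𝓗), e i⟫_ℂ / (α j : ℂ)) • g j with hv
  have h1 : ⟪e i, (v : 𝓗)⟫_ℂ = (q : ℂ) := by
    rw [hv, Submodule.coe_sum, inner_sum, hq, Complex.ofReal_sum]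
    refine Finset.sum_congr rfl fun j _ => ?_
    rw [Submodule.coe_smul, inner_smul_right, ← inner_conj_symm (g j : 𝓗) (e i),
      div_mul_eq_mul_div, ← Complex.normSq_eq_conj_mul_self, Complex.normSq_eq_norm_sq,
      Complex.ofReal_div]
  have h2 : ∀ j, ⟪g j, v⟫_ℂ = ⟪(g j : 𝓗), e i⟫_ℂ / (α j : ℂ) := by
    classical
    intro j
    simp_rw [hv, inner_sum, inner_smul_right, orthonormal_iff_ite.1 g.orthonormal]
    simp
  have h3 : expVal ρ v = q := by
    rw [← expVal_compress, hg.expVal_eq_sum hA, hq]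
    refine Finset.sum_congr rfl fun j _ => ?_
    rw [h2, norm_div, Complex.norm_real, div_pow, Real.norm_eq_abs, sq_abs, norm_inner_symm]
    by_cases hw : α j = 0
    · simp [hw]
    · field_simp
  have h4 := mul_norm_inner_sq_le_expVal hρ he i (v : 𝓗)
  rw [h1, h3, Complex.norm_real, Real.norm_eq_abs, sq_abs] at h4
  rcases hq0.eq_or_lt with h0 | h0
  · rw [← h0]; simp
  · by_contra hcon
    nlinarith

theorem entropy_term_le {p n α a : ℝ} (hp : 0 ≤ p) (hp1 : p ≤ 1) (hn : 0 ≤ n) (hα : 0 ≤ α)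
    (hαa : α ≤ a) (h0 : α = 0 → p * n = 0) :
    ENNReal.ofReal (log a - log α) * (ENNReal.ofReal p * ENNReal.ofReal n)
        + ENNReal.ofReal p * ENNReal.ofReal n
      ≤ ENNReal.ofReal (negMulLog p) * ENNReal.ofReal n
        + ENNReal.ofReal a * (ENNReal.ofReal p * ENNReal.ofReal (p * (n / α))) := by
  rw [← ENNReal.ofReal_mul hp]
  rcases hα.eq_or_lt with hα | hα
  · rw [h0 hα.symm]; simp
  rcases hp.eq_or_lt with rfl | hp
  · simp
  have ha : 0 < a := hα.trans_le hαa
  have h1 : 0 ≤ log a - log α := sub_nonneg.2 (Real.log_le_log hα hαa)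
  have h2 : 0 ≤ negMulLog p := Real.negMulLog_nonneg hp.le hp1
  rw [← ENNReal.ofReal_mul h1, ← ENNReal.ofReal_mul h2, ← ENNReal.ofReal_mul hp.le,
    ← ENNReal.ofReal_mul ha.le, ← ENNReal.ofReal_add (by positivity) (by positivity),
    ← ENNReal.ofReal_add (by positivity) (by positivity)]
  refine ENNReal.ofReal_le_ofReal ?_
  have h3 := Real.log_le_sub_one_of_pos (show 0 < a * p / α by positivity)
  rw [Real.log_div (by positivity) hα.ne', Real.log_mul ha.ne' hp.ne'] at h3
  have h4 : (p * n) * (log a + log p - log α) ≤ (p * n) * (a * p / α - 1) := by gcongr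
  have h5 : a * (p * (p * (n / α))) = (p * n) * (a * p / α) := by field_simp
  rw [h5, negMulLog]
  linarith

/-- Sum `entropy_term_le`, which is `log x ≤ x - 1` at `x = a p / α`, over the overlaps of both
bases. Bessel's inequality bounds the entropy term and `mul_sum_div_compress_le` the other one by
`a`; this cancels the `a` on the left, the total weight in `K`. -/
theorem entropy_compress_le (ρ : QState 𝓗) {g : HilbertBasis κ ℂ K} {α : κ → ℝ}
    (hg : IsDiagonal (compress K ρ.op) g α) :
    ENNReal.ofReal (∑ j, negMulLog (α j) - negMulLog (∑ j, α j)) ≤ entropy ρ.op := by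
  obtain ⟨w, e, he'⟩ := ρ.exists_isEigenbasis
  have he := isDiagonal_of_isEigenbasis ρ.isPositive.isSelfAdjoint he'
  set p : w → ℝ := fun i => expVal ρ.op (e i)
  have hp := he.nonneg ρ.isPositive
  have hα := hg.nonneg (isPositive_compress ρ.isPositive)
  set a := ∑ j, α j with ha
  have hαa : ∀ j, α j ≤ a := fun j => Finset.single_le_sum (fun j _ => hα j) (Finset.mem_univ j)
  have ha0 : 0 ≤ a := Finset.sum_nonneg fun j _ => hα j
  have hαρ : ∀ j, α j = expVal ρ.op (g j) := fun j => by rw [← hg.expVal_eq, expVal_compress]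
  have hterm := fun i j => entropy_term_le (hp i) (he.le_one i)
    (sq_nonneg ‖⟪e i, (g j : 𝓗)⟫_ℂ‖) (hα j) (hαa j) fun h0 => by
      have h1 := mul_norm_inner_sq_le_expVal ρ.isPositive he i (g j : 𝓗)
      rw [← hαρ, h0] at h1
      exact le_antisymm h1 (mul_nonneg (hp i) (by positivity))
  have hsum := ENNReal.tsum_le_tsum fun i =>
    Finset.sum_le_sum fun j (_ : j ∈ Finset.univ) => hterm i j
  have hcol : ∀ j, ∑' i, ENNReal.ofReal (p i) * ENNReal.ofReal (‖⟪e i, (g j : 𝓗)⟫_ℂ‖ ^ 2)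
      = ENNReal.ofReal (α j) := fun j => by rw [he.tsum_expVal ρ.isPositive, hαρ]
  have hlhs : ∑' i, ∑ j, (ENNReal.ofReal (log a - log (α j))
        * (ENNReal.ofReal (p i) * ENNReal.ofReal (‖⟪e i, (g j : 𝓗)⟫_ℂ‖ ^ 2))
        + ENNReal.ofReal (p i) * ENNReal.ofReal (‖⟪e i, (g j : 𝓗)⟫_ℂ‖ ^ 2))
      = ENNReal.ofReal (∑ j, negMulLog (α j) - negMulLog a) + ENNReal.ofReal a := by
    rw [Summable.tsum_finsetSum fun _ _ => ENNReal.summable]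
    simp_rw [ENNReal.tsum_add, ENNReal.tsum_mul_left, hcol]
    rw [Finset.sum_add_distrib, ← ENNReal.ofReal_sum_of_nonneg fun j _ => hα j]
    congr 1
    have h1 : ∑ j, negMulLog (α j) - negMulLog a = ∑ j, α j * (log a - log (α j)) := by
      simp_rw [negMulLog, mul_sub, Finset.sum_sub_distrib, ← Finset.sum_mul, neg_mul,
        Finset.sum_neg_distrib, ← ha]
      ring
    have h2 : ∀ j, 0 ≤ α j * (log a - log (α j)) := by
      intro j
      rcases (hα j).eq_or_lt with h0 | h0
      · rw [← h0]; simp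
      · exact mul_nonneg h0.le (sub_nonneg.2 (Real.log_le_log h0 (hαa j)))
    rw [h1, ENNReal.ofReal_sum_of_nonneg fun j _ => h2 j]
    refine Finset.sum_congr rfl fun j _ => ?_
    rw [ENNReal.ofReal_mul (hα j), mul_comm]
  rw [hlhs] at hsum
  have hrhs : ∑' i, ∑ j, (ENNReal.ofReal (negMulLog (p i))
        * ENNReal.ofReal (‖⟪e i, (g j : 𝓗)⟫_ℂ‖ ^ 2)
        + ENNReal.ofReal a * (ENNReal.ofReal (p i)
          * ENNReal.ofReal (p i * (‖⟪e i, (g j : 𝓗)⟫_ℂ‖ ^ 2 / α j))))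
      ≤ entropy ρ.op + ENNReal.ofReal a := by
    have h1 : ENNReal.ofReal a = ∑' i, ENNReal.ofReal a * ENNReal.ofReal (p i) := by
      rw [ENNReal.tsum_mul_left, ← he.opTrace_eq ρ.isPositive, ρ.trace_eq_one, mul_one]
    rw [entropy_eq_tsum he]
    nth_rewrite 2 [h1]
    rw [← ENNReal.tsum_add]
    refine ENNReal.tsum_le_tsum fun i => ?_
    rw [Finset.sum_add_distrib, ← Finset.mul_sum]
    have hb : ∑ j, ENNReal.ofReal (‖⟪e i, (g j : 𝓗)⟫_ℂ‖ ^ 2) ≤ 1 := by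
      rw [← ENNReal.ofReal_sum_of_nonneg fun j _ => by positivity, ENNReal.ofReal_le_one]
      have ho : Orthonormal ℂ fun j => (g j : 𝓗) :=
        g.orthonormal.comp_linearIsometry K.subtypeₗᵢ
      have h3 := ho.sum_inner_products_le (e i) (s := Finset.univ)
      rw [HilbertBasis.norm_eq_one, one_pow] at h3
      simpa only [norm_inner_symm] using h3
    have hc : ∑ j, ENNReal.ofReal (p i * (‖⟪e i, (g j : 𝓗)⟫_ℂ‖ ^ 2 / α j)) ≤ 1 := by
      rw [← ENNReal.ofReal_sum_of_nonneg
        fun j _ => mul_nonneg (hp i) (div_nonneg (by positivity) (hα j)), ENNReal.ofReal_le_one,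
        ← Finset.mul_sum]
      exact mul_sum_div_compress_le ρ.isPositive he hg i
    rw [← Finset.mul_sum, ← Finset.mul_sum]
    gcongr
    · exact mul_le_of_le_one_right' hb
    · exact mul_le_of_le_one_right' hc
  exact (ENNReal.add_le_add_iff_right ENNReal.ofReal_ne_top).1 (hsum.trans hrhs)

/-- The positive and negative parts of `ρ - σ` have equal traces because `ρ` and `σ` do, so each
carries half of the trace norm. -/
theorem exists_jordan (ρ σ : QState 𝓗) (htop : traceNorm (ρ.op - σ.op) ≠ ⊤) :
    ∃ Np Nm : 𝓗 →L[ℂ] 𝓗, Np.IsPositive ∧ Nm.IsPositive ∧ ρ.op + Nm = σ.op + Np ∧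
      opTrace Np = ENNReal.ofReal (1 / 2 * (traceNorm (ρ.op - σ.op)).toReal) ∧
      opTrace Nm = ENNReal.ofReal (1 / 2 * (traceNorm (ρ.op - σ.op)).toReal) := by
  have hsa : IsSelfAdjoint (ρ.op - σ.op) :=
    ρ.isPositive.isSelfAdjoint.sub σ.isPositive.isSelfAdjoint
  have hp : ((ρ.op - σ.op)⁺).IsPositive :=
    (ContinuousLinearMap.nonneg_iff_isPositive _).1 (CFC.posPart_nonneg _)
  have hm : ((ρ.op - σ.op)⁻).IsPositive :=
    (ContinuousLinearMap.nonneg_iff_isPositive _).1 (CFC.negPart_nonneg _)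
  have heq : ρ.op + (ρ.op - σ.op)⁻ = σ.op + (ρ.op - σ.op)⁺ := by
    have := CFC.posPart_sub_negPart (ρ.op - σ.op) hsa
    rw [sub_eq_sub_iff_add_eq_add] at this
    rw [← this, add_comm]
  have htr : opTrace (ρ.op - σ.op)⁻ = opTrace (ρ.op - σ.op)⁺ := by
    have := congrArg opTrace heq
    rw [opTrace_add ρ.isPositive hm, opTrace_add σ.isPositive hp, ρ.trace_eq_one,
      σ.trace_eq_one] at this
    exact (ENNReal.add_right_inj ENNReal.one_ne_top).1 this
  have hsum : traceNorm (ρ.op - σ.op) = opTrace (ρ.op - σ.op)⁺ + opTrace (ρ.op - σ.op)⁺ := by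
    rw [traceNorm, ← CFC.posPart_add_negPart (ρ.op - σ.op) hsa, opTrace_add hp hm, htr]
  have hfin : opTrace (ρ.op - σ.op)⁺ ≠ ⊤ := fun h => htop (by rw [hsum, h]; simp)
  have hval : opTrace (ρ.op - σ.op)⁺
      = ENNReal.ofReal (1 / 2 * (traceNorm (ρ.op - σ.op)).toReal) := by
    rw [hsum, ENNReal.toReal_add hfin hfin, ← two_mul, ← mul_assoc]
    norm_num [ENNReal.ofReal_toReal hfin]
  exact ⟨_, _, hp, hm, heq, hval, htr.trans hval⟩

variable [FiniteDimensional ℂ K]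

/-- A normalized version of the compression of a state, with an arbitrary value if the latter is
zero. -/
theorem exists_normalized (σ : QState 𝓗) (hK : 0 < Module.finrank ℂ K) :
    ∃ (f : HilbertBasis (Fin (Module.finrank ℂ K)) ℂ K) (s : Fin (Module.finrank ℂ K) → ℝ)
      (τ : K →L[ℂ] K), τ.IsPositive ∧ IsDiagonal τ f s ∧ ∑ j, s j = 1 ∧
      compress K σ.op = ((∑ j, expVal σ.op (f j) : ℝ) : ℂ) • τ := by
  have hB := isPositive_compress (K := K) σ.isPositive
  obtain ⟨f, s, hf⟩ := exists_isDiagonal_fin hB.isSelfAdjoint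
  have hs := hf.nonneg hB
  have hsσ : ∀ j, s j = expVal σ.op (f j) := fun j => by rw [← hf.expVal_eq, expVal_compress]
  set β := ∑ j, s j with hβ
  have hβ0 : 0 ≤ β := Finset.sum_nonneg fun j _ => hs j
  have hβσ : ∑ j, expVal σ.op (f j) = β := Finset.sum_congr rfl fun j _ => (hsσ j).symm
  rcases hβ0.eq_or_lt with h0 | h0
  -- If the compression of `σ` vanishes, any state serves; the maximally mixed one is diagonal in
  -- every basis.
  · refine ⟨f, fun _ => (Module.finrank ℂ K : ℝ)⁻¹,
      (((Module.finrank ℂ K : ℝ)⁻¹ : ℝ) : ℂ) • 1, ?_, fun j => ?_, ?_, ?_⟩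
    · exact isPositive_smul ContinuousLinearMap.isPositive_one (by positivity)
    · simp
    · have : (Module.finrank ℂ K : ℝ) ≠ 0 := by exact_mod_cast hK.ne'
      simp [this]
    · have hs0 : ∀ j, s j = 0 := fun j =>
        (Finset.sum_eq_zero_iff_of_nonneg fun i _ => hs i).1 h0.symm j (Finset.mem_univ j)
      refine ContinuousLinearMap.ext_on
        (Submodule.dense_iff_topologicalClosure_eq_top.2 f.dense_span) ?_
      rintro _ ⟨j, rfl⟩
      rw [hf j, hs0, hβσ, ← h0]
      simp
  · refine ⟨f, fun j => β⁻¹ * s j, ((β⁻¹ : ℝ) : ℂ) • compress K σ.op,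
      isPositive_smul hB (by positivity), fun j => ?_, ?_, ?_⟩
    · rw [smul_apply, hf j, smul_smul, Complex.ofReal_mul]
    · rw [← Finset.mul_sum, ← hβ, inv_mul_cancel₀ h0.ne']
    · rw [hβσ, smul_smul, ← Complex.ofReal_mul, mul_inv_cancel₀ h0.ne', Complex.ofReal_one,
        one_smul]

/-- The term `a log a` of `afw_bound` cancels against the trace correction in `entropy_compress_le`.
Up to the trace-norm term, what is left is linear in `ρ`. -/
theorem affine_le_entropy_compress (ρ σ : QState 𝓗) (htop : traceNorm (ρ.op - σ.op) ≠ ⊤)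
    {f : HilbertBasis κ ℂ K} {s : κ → ℝ} {τ : K →L[ℂ] K} (hτ : τ.IsPositive)
    (hf : IsDiagonal τ f s) (hs1 : ∑ j, s j = 1)
    (hστ : compress K σ.op = ((∑ j, expVal σ.op (f j) : ℝ) : ℂ) • τ)
    {abar ebar : ℝ} (habar : 0 < abar) (hebar : 0 < ebar) :
    ENNReal.ofReal (∑ j, expVal ρ.op (f j)
        * (-log (abar * s j + ebar / Fintype.card κ) + log abar)
      - 1 / 2 * (traceNorm (ρ.op - σ.op)).toReal
        * (log (Fintype.card κ) - log ebar + log (abar + ebar))) ≤ entropy ρ.op := by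
  obtain ⟨Np, Nm, hNp, hNm, hJ, htp, htm⟩ := exists_jordan ρ σ htop
  set e := 1 / 2 * (traceNorm (ρ.op - σ.op)).toReal with he
  have he0 : 0 ≤ e := by positivity
  have hA := isPositive_compress (K := K) ρ.isPositive
  obtain ⟨b, α, hb⟩ := exists_isDiagonal_fin hA.isSelfAdjoint
  set x := ∑ j, expVal Np (f j) with hx
  set y := ∑ j, expVal Nm (f j) with hy
  have hxe : x ≤ e := by
    have := sum_expVal_le_opTrace hNp f
    rwa [htp, ENNReal.ofReal_le_ofReal_iff he0] at this
  have hye : y ≤ e := by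
    have := sum_expVal_le_opTrace hNm f
    rwa [htm, ENNReal.ofReal_le_ofReal_iff he0] at this
  set a := ∑ j, expVal ρ.op (f j) with ha
  have hab : a + y = ∑ j, expVal σ.op (f j) + x := by
    rw [ha, hy, hx, ← Finset.sum_add_distrib, ← Finset.sum_add_distrib]
    exact Finset.sum_congr rfl fun j _ => by rw [← expVal_add, hJ, expVal_add]
  -- Compression may lower the traces of the Jordan parts; multiples of `τ` restore both to `e`, and
  -- the excess on the two sides turns the factor of `τ` into `a`.
  have hDp : (compress K Np + ((e - x : ℝ) : ℂ) • τ).IsPositive :=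
    (isPositive_compress hNp).add (isPositive_smul hτ (by linarith))
  have hDm : (compress K Nm + ((e - y : ℝ) : ℂ) • τ).IsPositive :=
    (isPositive_compress hNm).add (isPositive_smul hτ (by linarith))
  have htrace : ∀ (N : 𝓗 →L[ℂ] 𝓗) (c : ℝ),
      ∑ j, expVal (compress K N + (c : ℂ) • τ) (f j) = ∑ j, expVal N (f j) + c := by
    intro N c
    simp_rw [expVal_add, expVal_smul, hf.expVal_eq, expVal_compress]
    rw [Finset.sum_add_distrib, ← Finset.mul_sum, hs1, mul_one]
  have hW : compress K ρ.op + (compress K Nm + ((e - y : ℝ) : ℂ) • τ)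
      = (a : ℂ) • τ + (compress K Np + ((e - x : ℝ) : ℂ) • τ) := by
    have h1 : compress K ρ.op + compress K Nm = compress K σ.op + compress K Np := by
      have h2 : ∀ S T : 𝓗 →L[ℂ] 𝓗, compress K S + compress K T = compress K (S + T) := by
        intro S T; ext; simp [compress]
      rw [h2, h2, hJ]
    rw [← add_assoc, h1, hστ]
    have h3 : ∑ j, expVal σ.op (f j) = a + y - x := by linarith
    rw [h3]
    push_cast
    module
  have hafw := afw_bound hA hτ hDp hDm hf hs1 (a := a) (e := e)
    (by simp_rw [expVal_compress, ← ha]) (by rw [htrace]; linarith) (by rw [htrace]; linarith)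
    hW habar hebar hb
  refine le_trans (ENNReal.ofReal_le_ofReal ?_) (entropy_compress_le ρ hb)
  have hsum : ∑ i, α i = a := by
    rw [← hb.sum_expVal hA f]
    simp_rw [expVal_compress, ← ha]
  rw [hsum, negMulLog]
  simp_rw [expVal_compress] at hafw
  simp_rw [mul_add, Finset.sum_add_distrib, ← Finset.sum_mul, ← ha]
  linarith

end Compressed

/-! ### Averaging over the ensemble and splitting at an energy level -/

section Ensemble

open Real (negMulLog log)

variable {𝓗 : Type*} [NormedAddCommGroup 𝓗] [InnerProductSpace ℂ 𝓗] [CompleteSpace 𝓗]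
variable {ι κ κ' : Type*}

theorem ofReal_neg_log_mul {s : ℝ} (hs : 0 ≤ s) :
    ENNReal.ofReal (-log s) * ENNReal.ofReal s = ENNReal.ofReal (negMulLog s) := by
  rw [← ENNReal.ofReal_mul' hs, negMulLog, neg_mul, neg_mul, mul_comm]

/-- The lower bound `v` may be negative, so the difference is formed in the reals; its nonnegativity
lets it be integrated in either sense. -/
theorem le_ofReal_toReal_sub {x y N : ℝ≥0∞} {v : ℝ} (h : x + y ≤ N) (hv : ENNReal.ofReal v ≤ y)
    (hN : N ≠ ⊤) : x ≤ ENNReal.ofReal (N.toReal - v) ∧ 0 ≤ N.toReal - v := by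
  have h1 : ENNReal.ofReal v ≤ N := hv.trans (le_add_self.trans h)
  rw [ENNReal.ofReal_le_iff_le_toReal hN] at h1
  refine ⟨?_, by linarith⟩
  rcases le_total 0 v with h0 | h0
  · rw [ENNReal.ofReal_sub _ h0, ENNReal.ofReal_toReal hN]
    refine ENNReal.le_sub_of_add_le_right ENNReal.ofReal_ne_top (le_trans ?_ h)
    gcongr
  · refine (le_self_add.trans h).trans ?_
    rw [← ENNReal.ofReal_toReal hN]
    refine ENNReal.ofReal_le_ofReal ?_
    rw [ENNReal.toReal_ofReal ENNReal.toReal_nonneg]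
    linarith

section Measure

variable [TopologicalSpace.SeparableSpace 𝓗] (μ : Measure (QState 𝓗)) [IsProbabilityMeasure μ]

theorem ae_expVal_eq_zero (x : 𝓗) (hx : expVal (barycenter μ) x = 0) :
    ∀ᵐ ρ ∂μ, expVal (QState.op ρ) x = 0 := by
  have h1 := ofReal_expVal_barycenter μ x
  rw [hx, ENNReal.ofReal_zero, eq_comm, lintegral_eq_zero_iff
    (continuous_expVal x).measurable.ennreal_ofReal] at h1
  filter_upwards [h1] with ρ hρ
  exact le_antisymm (ENNReal.ofReal_eq_zero.1 hρ) (expVal_nonneg ρ.isPositive x)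

theorem integral_traceNorm {σ : QState 𝓗} {ε : ℝ} (hε : ε = metricDivergence μ σ) (hε₀ : 0 < ε) :
    (∀ᵐ ρ ∂μ, traceNorm (QState.op ρ - σ.op) < ⊤) ∧
      Integrable (fun ρ : QState 𝓗 => 1 / 2 * (traceNorm (ρ.op - σ.op)).toReal) μ ∧
      ∫ ρ : QState 𝓗, 1 / 2 * (traceNorm (ρ.op - σ.op)).toReal ∂μ = ε := by
  have hm := measurable_traceNorm_sub σ
  have htop : ∫⁻ ρ : QState 𝓗, traceNorm (ρ.op - σ.op) ∂μ ≠ ⊤ := by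
    intro h
    rw [metricDivergence, h] at hε
    simp at hε
    linarith
  have hae := ae_lt_top hm htop
  refine ⟨hae, (integrable_toReal_of_lintegral_ne_top hm.aemeasurable htop).const_mul _, ?_⟩
  rw [integral_const_mul, integral_toReal hm.aemeasurable hae, hε, metricDivergence]

variable [Fintype κ] {K : Submodule ℂ 𝓗} [CompleteSpace K] [FiniteDimensional ℂ K]

/-- For almost every `ρ`, the relative entropy is at most `-Tr ρ log ρ̄` minus the affine lower
bound for the entropy of `ρ`. The first term integrates to the entropy of `ρ̄`, the second to its
value at `ρ̄` and `ε`. -/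
theorem holevo_le_entropy_sub {σ : QState 𝓗} {ε : ℝ} (hε : ε = metricDivergence μ σ) (hε₀ : 0 < ε)
    (hent : entropy (barycenter μ) ≠ ⊤)
    {f : HilbertBasis κ ℂ K} {s : κ → ℝ} {τ : K →L[ℂ] K} (hτ : τ.IsPositive)
    (hf : IsDiagonal τ f s) (hs1 : ∑ j, s j = 1)
    (hστ : compress K σ.op = ((∑ j, expVal σ.op (f j) : ℝ) : ℂ) • τ) {abar : ℝ} (habar : 0 < abar) :
    holevo μ ≤ ENNReal.ofReal ((entropy (barycenter μ)).toReal
      - (∑ j, expVal (barycenter μ) (f j) * (-log (abar * s j + ε / Fintype.card κ) + log abar)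
        - ε * (log (Fintype.card κ) - log ε + log (abar + ε)))) := by
  obtain ⟨hae, htn, hval⟩ := integral_traceNorm μ hε hε₀
  obtain ⟨v, g, hg⟩ := (meanState μ).exists_isEigenbasis
  have hdg := isDiagonal_of_isEigenbasis (meanState μ).isPositive.isSelfAdjoint hg
  have hcount := countable_of_hilbertBasis g
  let N : QState 𝓗 → ℝ≥0∞ := fun ρ =>
    ∑' j, ENNReal.ofReal (-log (expVal (meanState μ).op (g j))) * ENNReal.ofReal (expVal ρ.op (g j))
  have hmj : ∀ j, Measurable fun ρ : QState 𝓗 => ENNReal.ofReal (expVal ρ.op (g j)) := fun j =>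
    (continuous_expVal (g j : 𝓗)).measurable.ennreal_ofReal
  have hNm : Measurable N := Measurable.tsum fun j => (hmj j).const_mul _
  have hNint : ∫⁻ ρ, N ρ ∂μ = entropy (barycenter μ) := by
    simp only [N]
    rw [lintegral_tsum fun j => ((hmj j).const_mul _).aemeasurable]
    refine Eq.trans ?_ (entropy_eq_tsum hdg).symm
    refine tsum_congr fun j => ?_
    rw [lintegral_const_mul _ (hmj j), ← ofReal_expVal_barycenter]
    exact ofReal_neg_log_mul (expVal_nonneg (meanState μ).isPositive _)
  have hNae := ae_lt_top hNm (hNint ▸ hent)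
  have hker : ∀ᵐ ρ ∂μ, ∀ j, expVal (meanState μ).op (g j) = 0 → expVal (QState.op ρ) (g j) = 0 := by
    rw [ae_all_iff]
    intro j
    by_cases h0 : expVal (barycenter μ) (g j) = 0
    · filter_upwards [ae_expVal_eq_zero μ (g j : 𝓗) h0] with ρ hρ _ using hρ
    · exact Eventually.of_forall fun ρ h => absurd h h0
  let A : QState 𝓗 → ℝ := fun ρ =>
    ∑ j, expVal ρ.op (f j) * (-log (abar * s j + ε / Fintype.card κ) + log abar)
  let e : QState 𝓗 → ℝ := fun ρ => 1 / 2 * (traceNorm (ρ.op - σ.op)).toReal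
    * (log (Fintype.card κ) - log ε + log (abar + ε))
  have hpt : ∀ᵐ ρ ∂μ, relEntropy (QState.op ρ) (barycenter μ)
      ≤ ENNReal.ofReal ((N ρ).toReal - (A ρ - e ρ)) ∧ 0 ≤ (N ρ).toReal - (A ρ - e ρ) := by
    filter_upwards [hae, hNae, hker] with ρ h1 h2 h3
    exact le_ofReal_toReal_sub (relEntropy_add_entropy_le ρ (meanState μ) hg h3)
      (affine_le_entropy_compress ρ σ h1.ne hτ hf hs1 hστ habar hε₀) h2.ne
  have hNi : Integrable (fun ρ => (N ρ).toReal) μ :=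
    integrable_toReal_of_lintegral_ne_top hNm.aemeasurable (hNint ▸ hent)
  have hAi : Integrable A μ :=
    integrable_finsetSum _ fun j _ => (integrable_expVal μ (f j : 𝓗)).mul_const _
  have hei : Integrable e μ := htn.mul_const _
  have hAe : Integrable (fun ρ => A ρ - e ρ) μ := hAi.sub hei
  -- Only the majorant has to be integrable, so no measurability of the relative entropy is needed.
  calc holevo μ ≤ ∫⁻ ρ, ENNReal.ofReal ((N ρ).toReal - (A ρ - e ρ)) ∂μ :=
        lintegral_mono_ae (hpt.mono fun ρ h => h.1)
    _ = ENNReal.ofReal (∫ ρ, ((N ρ).toReal - (A ρ - e ρ)) ∂μ) :=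
        (ofReal_integral_eq_lintegral_ofReal (hNi.sub hAe)
          (hpt.mono fun ρ h => h.2)).symm
    _ = _ := by
        congr 1
        rw [integral_sub hNi hAe, integral_sub hAi hei,
          integral_toReal hNm.aemeasurable hNae, hNint, integral_mul_const, hval,
          integral_finsetSum _ fun j _ => (integrable_expVal μ (f j : 𝓗)).mul_const _]
        simp_rw [integral_mul_const, ← expVal_barycenter]

end Measure

/-- Klein's inequality with weights `y` on `K` and the diagonal of `ρ` itself on the complement; the
weights sum to one, which removes the trace terms. -/
theorem entropy_le_of_sumBasis [Fintype κ] {K : Submodule ℂ 𝓗} [CompleteSpace K] (ρ : QState 𝓗)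
    (f : HilbertBasis κ ℂ K) (g : HilbertBasis κ' ℂ Kᗮ) {y : κ → ℝ} (hy0 : ∀ j, 0 < y j)
    (hy1 : ∀ j, y j ≤ 1) (hy : ∑ j, y j = ∑ j, expVal ρ.op (f j)) :
    entropy ρ.op ≤ ENNReal.ofReal (∑ j, expVal ρ.op (f j) * (-log (y j)))
      + ∑' j, ENNReal.ofReal (negMulLog (expVal ρ.op (g j))) := by
  have h1 := entropy_add_one_le ρ (sumBasis f g)
    (s := Sum.elim y fun j => expVal ρ.op (g j))
    (by
      rintro (j | j)
      · exact (hy0 j).le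
      · exact expVal_nonneg ρ.isPositive _)
    (by
      rintro (j | j)
      · exact hy1 j
      · exact ρ.expVal_le_one (g.orthonormal.1 j))
    (by
      rintro (j | j) h
      · exact absurd h (hy0 j).ne'
      · rwa [sumBasis_inr])
  rw [ENNReal.summable.tsum_sum ENNReal.summable, ENNReal.summable.tsum_sum ENNReal.summable] at h1
  simp only [Sum.elim_inl, Sum.elim_inr, sumBasis_inl, sumBasis_inr, tsum_fintype] at h1
  have h2 : ∑ j, ENNReal.ofReal (y j) + ∑' j, ENNReal.ofReal (expVal ρ.op (g j)) = 1 := by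
    rw [← ENNReal.ofReal_sum_of_nonneg fun j _ => (hy0 j).le, hy,
      ENNReal.ofReal_sum_of_nonneg fun j _ => expVal_nonneg ρ.isPositive _, ← ρ.trace_eq_one,
      opTrace_eq_tsum_add_tsum ρ.isPositive f g,
      tsum_fintype fun j => ENNReal.ofReal (expVal ρ.op (f j))]
  rw [h2] at h1
  refine ((ENNReal.add_le_add_iff_right ENNReal.one_ne_top).1 h1).trans (le_of_eq ?_)
  congr 1
  · have h3 : ∀ j, 0 ≤ -log (y j) := fun j => by
      have := Real.log_nonpos (hy0 j).le (hy1 j); linarith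
    rw [ENNReal.ofReal_sum_of_nonneg
      fun j _ => mul_nonneg (expVal_nonneg ρ.isPositive _) (h3 j)]
    refine Finset.sum_congr rfl fun j _ => ?_
    rw [ENNReal.ofReal_mul (expVal_nonneg ρ.isPositive _), mul_comm]
  · exact tsum_congr fun j => ofReal_neg_log_mul (expVal_nonneg ρ.isPositive _)

/-- The span of the basis vectors of energy at most `c`. -/
def lowSpace (b : HilbertBasis ι ℂ 𝓗) (h : ι → ℝ) (c : ℝ) : Submodule ℂ 𝓗 :=
  Submodule.span ℂ (Set.range fun k : {k // h k ≤ c} => b k)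

namespace Hamiltonian

variable {H : Hamiltonian 𝓗} {b : HilbertBasis ι ℂ 𝓗} {h : ι → ℝ}

theorem IsEnergyBasis.finiteDimensional (hb : H.IsEnergyBasis b h) (c : ℝ) :
    FiniteDimensional ℂ (lowSpace b h c) :=
  have : Finite {k // h k ≤ c} := (hb.finite_le c).to_subtype
  FiniteDimensional.span_of_finite ℂ (Set.finite_range _)

theorem IsEnergyBasis.finrank_lowSpace (hb : H.IsEnergyBasis b h) (c : ℝ) :
    Module.finrank ℂ (lowSpace b h c) = Nat.card {k // h k ≤ c} := by
  have : Finite {k // h k ≤ c} := (hb.finite_le c).to_subtype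
  have := Fintype.ofFinite {k // h k ≤ c}
  rw [Nat.card_eq_fintype_card]
  exact finrank_span_eq_card (b.orthonormal.linearIndependent.comp _ Subtype.val_injective)

theorem mem_lowSpace {k : ι} {c : ℝ} (hk : h k ≤ c) : b k ∈ lowSpace b h c :=
  Submodule.subset_span ⟨⟨k, hk⟩, rfl⟩

theorem finrank_lowSpace_pos {k : ι} {c : ℝ} [FiniteDimensional ℂ (lowSpace b h c)]
    (hk : h k ≤ c) : 0 < Module.finrank ℂ (lowSpace b h c) :=
  have : Nontrivial (lowSpace b h c) :=
    ⟨⟨b k, mem_lowSpace hk⟩, 0, fun h0 => HilbertBasis.ne_zero b k (congrArg Subtype.val h0)⟩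
  Module.finrank_pos

theorem mem_lowSpace_orthogonal {k : ι} {c : ℝ} (hk : c < h k) : b k ∈ (lowSpace b h c)ᗮ := by
  rw [Submodule.mem_orthogonal]
  intro u hu
  induction hu using Submodule.span_induction with
  | mem x hx =>
    obtain ⟨i, rfl⟩ := hx
    exact b.orthonormal.2 fun heq => absurd i.2 (by rw [heq]; exact not_le.2 hk)
  | zero => exact inner_zero_left _
  | add x y _ _ hx hy => rw [inner_add_left, hx, hy, add_zero]
  | smul a x _ hx => rw [inner_smul_left, hx, mul_zero]

theorem IsEnergyBasis.entropy_le (hb : H.IsEnergyBasis b h) {F : ℝ → ℝ} (hF : H.IsEntropyBound F)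
    {c : ℝ} (hc : ∃ k, h k ≤ c) (ρ : QState 𝓗) (hρ : H.energy ρ.op ≤ ENNReal.ofReal c) :
    entropy ρ.op ≤ ENNReal.ofReal (F c) := by
  obtain ⟨k, hk⟩ := hc
  refine le_trans ?_ (hF.maxEntropy_le c ((hb.groundEnergy_le k).trans hk))
  exact le_iSup₂_of_le ρ hρ le_rfl

/-- The maximally mixed state on the low-energy space has entropy `log d` and energy at most `c`. -/
theorem IsEnergyBasis.log_finrank_le (hb : H.IsEnergyBasis b h) {F : ℝ → ℝ}
    (hF : H.IsEntropyBound F) {c : ℝ} (hc : ∃ k, h k ≤ c) (hc0 : 0 < c) :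
    log (Module.finrank ℂ (lowSpace b h c)) ≤ F c := by
  have hfd := hb.finiteDimensional c
  set K := lowSpace b h c with hK
  have : CompleteSpace K := FiniteDimensional.complete ℂ K
  obtain ⟨k₀, hk₀⟩ := hc
  have hd : 0 < Module.finrank ℂ K := finrank_lowSpace_pos hk₀
  set d := Module.finrank ℂ K with hdK
  have hd' : (0 : ℝ) < d := by exact_mod_cast hd
  set A : K →L[ℂ] K := (((d : ℝ)⁻¹ : ℝ) : ℂ) • 1 with hA
  have hApos : A.IsPositive :=
    isPositive_smul ContinuousLinearMap.isPositive_one (by positivity)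
  obtain ⟨f, -, -⟩ := exists_isDiagonal_fin hApos.isSelfAdjoint
  have hf : IsDiagonal A f fun _ => (d : ℝ)⁻¹ := fun j => by simp [hA]
  obtain ⟨w, g, -⟩ := exists_hilbertBasis ℂ Kᗮ
  have hdiag := isDiagonal_extend hf g
  have hpos := isPositive_extend hApos
  have htr : opTrace (extend K A) = 1 := by
    rw [hdiag.opTrace_eq hpos, ENNReal.summable.tsum_sum ENNReal.summable]
    simp only [Sum.elim_inl, Sum.elim_inr, tsum_fintype, Finset.sum_const, Finset.card_univ,
      Fintype.card_fin, ENNReal.ofReal_zero, tsum_zero, add_zero, nsmul_eq_mul, ← hdK]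
    rw [← ENNReal.ofReal_natCast, ← ENNReal.ofReal_mul hd'.le, mul_inv_cancel₀ hd'.ne',
      ENNReal.ofReal_one]
  let ρ : QState 𝓗 := ⟨extend K A, hpos, htr⟩
  have hen : H.energy ρ.op ≤ ENNReal.ofReal c := by
    rw [hb.energy_eq ρ.isPositive]
    have h1 : ENNReal.ofReal c = ∑' k, ENNReal.ofReal c * ENNReal.ofReal (expVal ρ.op (b k)) := by
      rw [ENNReal.tsum_mul_left, ← opTrace_eq_tsum ρ.isPositive b, ρ.trace_eq_one, mul_one]
    rw [h1]
    refine ENNReal.tsum_le_tsum fun k => ?_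
    rcases le_or_gt (h k) c with hk | hk
    · gcongr
    · have h2 : expVal ρ.op (b k) = 0 := by
        change expVal (extend K A) (b k) = 0
        rw [expVal_extend, adjoint_subtypeL_of_mem_orthogonal (mem_lowSpace_orthogonal hk)]
        simp [expVal]
      rw [h2]; simp
  have hle := hb.entropy_le hF ⟨k₀, hk₀⟩ ρ hen
  have hent : entropy ρ.op = ENNReal.ofReal (log d) := by
    rw [entropy_eq_tsum (ρ := ρ) hdiag, ENNReal.summable.tsum_sum ENNReal.summable]
    simp only [Sum.elim_inl, Sum.elim_inr, tsum_fintype, Finset.sum_const, Finset.card_univ,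
      Fintype.card_fin, Real.negMulLog_zero, ENNReal.ofReal_zero, tsum_zero, add_zero,
      nsmul_eq_mul, ← hdK]
    rw [← ENNReal.ofReal_natCast, ← ENNReal.ofReal_mul hd'.le, negMulLog, Real.log_inv]
    congr 1
    field_simp
  rw [hent] at hle
  exact (ENNReal.ofReal_le_ofReal_iff (hF.pos c hc0).le).1 hle

theorem adjoint_subtypeL_orthogonal_lowSpace {c : ℝ} [CompleteSpace (lowSpace b h c)] (k : ι) :
    ((ContinuousLinearMap.adjoint (lowSpace b h c)ᗮ.subtypeL (b k) : (lowSpace b h c)ᗮ) : 𝓗)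
      = if h k ≤ c then 0 else b k := by
  split_ifs with hk
  · rw [adjoint_subtypeL_of_mem_orthogonal
      (Submodule.le_orthogonal_orthogonal _ (mem_lowSpace hk))]
    rfl
  · exact congrArg Subtype.val (adjoint_subtypeL_coe
      (⟨b k, mem_lowSpace_orthogonal (not_le.1 hk)⟩ : (lowSpace b h c)ᗮ))

theorem expVal_extend_compress_orthogonal_lowSpace {c : ℝ} [CompleteSpace (lowSpace b h c)]
    (ρ : 𝓗 →L[ℂ] 𝓗) (k : ι) :
    expVal (extend (lowSpace b h c)ᗮ (compress (lowSpace b h c)ᗮ ρ)) (b k)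
      = if h k ≤ c then 0 else expVal ρ (b k) := by
  rw [expVal_extend, expVal_compress, adjoint_subtypeL_orthogonal_lowSpace]
  split_ifs
  · simp [expVal]
  · rfl

theorem opTrace_extend_compress_orthogonal {K : Submodule ℂ 𝓗} [CompleteSpace K] {ρ : 𝓗 →L[ℂ] 𝓗}
    (hρ : ρ.IsPositive) (g : HilbertBasis κ' ℂ Kᗮ) :
    opTrace (extend Kᗮ (compress Kᗮ ρ)) = ∑' j, ENNReal.ofReal (expVal ρ (g j)) := by
  obtain ⟨w, f, -⟩ := exists_hilbertBasis ℂ K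
  rw [opTrace_eq_tsum_add_tsum (isPositive_extend (isPositive_compress hρ)) f g]
  have h1 : ∀ j, expVal (extend Kᗮ (compress Kᗮ ρ)) (f j) = 0 := fun j => by
    rw [expVal_extend, adjoint_subtypeL_of_mem_orthogonal
      (Submodule.le_orthogonal_orthogonal _ (f j).2)]
    simp [expVal]
  have h2 : ∀ j, expVal (extend Kᗮ (compress Kᗮ ρ)) (g j) = expVal ρ (g j) := fun j => by
    rw [expVal_extend, adjoint_subtypeL_coe, expVal_compress]
  simp [h1, h2]

/-- Markov's inequality: basis vectors outside the low-energy space have energy above `c`. -/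
theorem IsEnergyBasis.mul_tail_le (hb : H.IsEnergyBasis b h) {c : ℝ}
    [CompleteSpace (lowSpace b h c)] {ρ : 𝓗 →L[ℂ] 𝓗} (hρ : ρ.IsPositive)
    (g : HilbertBasis κ' ℂ (lowSpace b h c)ᗮ) :
    ENNReal.ofReal c * ∑' j, ENNReal.ofReal (expVal ρ (g j)) ≤ H.energy ρ := by
  rw [← opTrace_extend_compress_orthogonal hρ g,
    opTrace_eq_tsum (isPositive_extend (isPositive_compress hρ)) b, hb.energy_eq hρ,
    ← ENNReal.tsum_mul_left]
  refine ENNReal.tsum_le_tsum fun k => ?_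
  rw [expVal_extend_compress_orthogonal_lowSpace]
  split_ifs with hk
  · simp
  · gcongr
    exact (not_le.1 hk).le

/-- Divided by its trace `r`, the compression to the complement is a state of energy at most `E /
r`; undoing the normalization multiplies its entropy by `r` and adds `-r log r`. -/
theorem IsEnergyBasis.tail_entropy_le (hb : H.IsEnergyBasis b h) {F : ℝ → ℝ}
    (hF : H.IsEntropyBound F) {c : ℝ} [CompleteSpace (lowSpace b h c)] (ρ : QState 𝓗)
    {g : HilbertBasis κ' ℂ (lowSpace b h c)ᗮ} {t : κ' → ℝ}
    (hg : IsDiagonal (compress (lowSpace b h c)ᗮ ρ.op) g t) {r E : ℝ} (hr : 0 < r) (hr1 : r ≤ 1)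
    (hgr : ∑' j, ENNReal.ofReal (expVal ρ.op (g j)) = ENNReal.ofReal r)
    (hE : H.energy ρ.op = ENNReal.ofReal E) (hk : ∃ k, h k ≤ E / r) (hE0 : 0 < E) :
    ∑' j, ENNReal.ofReal (negMulLog (expVal ρ.op (g j)))
      ≤ ENNReal.ofReal (r * F (E / r) + negMulLog r) := by
  have hC := isPositive_compress (K := (lowSpace b h c)ᗮ) ρ.isPositive
  have htg : ∀ j, expVal ρ.op (g j) = t j := fun j => by rw [← hg.expVal_eq, expVal_compress]
  have ht0 := hg.nonneg hC
  set A : (lowSpace b h c)ᗮ →L[ℂ] (lowSpace b h c)ᗮ := ((r⁻¹ : ℝ) : ℂ) • compress (lowSpace b h c)ᗮ ρ.op with hA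
  have hApos : A.IsPositive := isPositive_smul hC (by positivity)
  have hAd : IsDiagonal A g fun j => r⁻¹ * t j := fun j => by
    rw [hA, smul_apply, hg j, smul_smul, Complex.ofReal_mul]
  have hext : extend (lowSpace b h c)ᗮ A = ((r⁻¹ : ℝ) : ℂ) • extend (lowSpace b h c)ᗮ (compress (lowSpace b h c)ᗮ ρ.op) := by
    ext x; simp [extend, hA]
  have hpos := isPositive_extend hApos
  obtain ⟨w, f, -⟩ := exists_hilbertBasis ℂ (lowSpace b h c)
  have hdiag := isDiagonal_extend_orthogonal f hAd
  have htr : opTrace (extend (lowSpace b h c)ᗮ A) = 1 := by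
    rw [hext, opTrace_smul (isPositive_extend hC) (by positivity),
      opTrace_extend_compress_orthogonal ρ.isPositive g, hgr, ← ENNReal.ofReal_mul (by positivity),
      inv_mul_cancel₀ hr.ne', ENNReal.ofReal_one]
  let ω : QState 𝓗 := ⟨extend (lowSpace b h c)ᗮ A, hpos, htr⟩
  have hen : H.energy ω.op ≤ ENNReal.ofReal (E / r) := by
    rw [hb.energy_eq ω.isPositive, div_eq_inv_mul, ENNReal.ofReal_mul (by positivity), ← hE,
      hb.energy_eq ρ.isPositive, ← ENNReal.tsum_mul_left]
    refine ENNReal.tsum_le_tsum fun k => ?_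
    change ENNReal.ofReal (h k) * ENNReal.ofReal (expVal (extend (lowSpace b h c)ᗮ A) (b k)) ≤ _
    rw [hext, expVal_smul, expVal_extend_compress_orthogonal_lowSpace,
      ENNReal.ofReal_mul (by positivity), mul_left_comm]
    gcongr
    split_ifs
    · exact expVal_nonneg ρ.isPositive _
    · exact le_rfl
  have hle := hb.entropy_le hF hk ω hen
  have hent : entropy ω.op = ∑' j, ENNReal.ofReal (negMulLog (r⁻¹ * t j)) := by
    rw [entropy_eq_tsum (ρ := ω) hdiag, ENNReal.summable.tsum_sum ENNReal.summable]
    simp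
  rw [hent] at hle
  have ht1 : ∀ j, r⁻¹ * t j ≤ 1 := fun j => by
    have := IsDiagonal.le_one (ρ := ω) hdiag (Sum.inr j)
    simpa using this
  have hη : 0 ≤ negMulLog r := Real.negMulLog_nonneg hr.le hr1
  have hterm : ∀ j, ENNReal.ofReal (negMulLog (expVal ρ.op (g j)))
      = ENNReal.ofReal r * ENNReal.ofReal (negMulLog (r⁻¹ * t j))
        + ENNReal.ofReal (r⁻¹ * negMulLog r) * ENNReal.ofReal (t j) := by
    intro j
    have h0 : 0 ≤ negMulLog (r⁻¹ * t j) :=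
      Real.negMulLog_nonneg (mul_nonneg (by positivity) (ht0 j)) (ht1 j)
    rw [← ENNReal.ofReal_mul hr.le, ← ENNReal.ofReal_mul (by positivity),
      ← ENNReal.ofReal_add (by positivity) (mul_nonneg (by positivity) (ht0 j)), htg]
    congr 1
    have h1 : t j = r * (r⁻¹ * t j) := by field_simp
    conv_lhs => rw [h1, Real.negMulLog_mul]
    ring
  simp_rw [hterm]
  simp_rw [htg] at hgr
  rw [ENNReal.tsum_add, ENNReal.tsum_mul_left, ENNReal.tsum_mul_left, hgr,
    ENNReal.ofReal_add (mul_nonneg hr.le (hF.pos _ (by positivity)).le) hη,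
    ENNReal.ofReal_mul hr.le, ← ENNReal.ofReal_mul (by positivity)]
  gcongr
  refine le_of_eq ?_
  field_simp

end Hamiltonian

end Ensemble

/-! ### Elementary estimates for `g` -/

section Numerics

open Real (negMulLog log)

theorem mul_log_add_div_le {p q e : ℝ} (hp : 0 < p) (hpq : p ≤ q) (he : 0 < e) :
    p * log ((p + e) / p) ≤ q * log ((q + e) / q) := by
  have hq : 0 < q := hp.trans_le hpq
  have h1 : log ((p + e) / p) - log ((q + e) / q) ≤ (p + e) / p / ((q + e) / q) - 1 := by
    rw [← Real.log_div (by positivity) (by positivity)]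
    exact Real.log_le_sub_one_of_pos (by positivity)
  have h2 : e / (q + e) ≤ log ((q + e) / q) := by
    have := Real.one_sub_inv_le_log_of_pos (show 0 < (q + e) / q by positivity)
    refine le_trans (le_of_eq ?_) this
    field_simp
    ring
  have h3 : p * ((p + e) / p / ((q + e) / q) - 1) = (q - p) * (e / (q + e)) := by
    field_simp
    ring
  have h4 := mul_le_mul_of_nonneg_left h1 hp.le
  have h5 := mul_le_mul_of_nonneg_left h2 (sub_nonneg.2 hpq)
  rw [h3] at h4
  linarith

theorem gFun_eq {x : ℝ} (hx : 0 < x) :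
    gFun x = log (1 + x) + x * log ((x + 1) / x) := by
  have h1 : 1 - x / (1 + x) = (1 + x)⁻¹ := by field_simp; ring
  rw [gFun, Real.binEntropy_eq_negMulLog_add_negMulLog_one_sub, h1, negMulLog, negMulLog,
    Real.log_inv, Real.log_div hx.ne' (by positivity), Real.log_div (by positivity) hx.ne',
    add_comm x 1]
  field_simp
  ring

theorem gFun_nonneg {x : ℝ} (hx : 0 ≤ x) : 0 ≤ gFun x :=
  mul_nonneg (by positivity)
    (Real.binEntropy_nonneg (by positivity) (div_le_one_of_le₀ (by linarith) (by positivity)))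

/-- The left side is `p log (1 + e/p) + e log (1 + p/e)`, increasing in both variables, and equals
`g x` at `p = 1`, `e = x`. This also shows that `g` is increasing. -/
theorem mixing_le_gFun {p e x : ℝ} (hp : 0 < p) (hp1 : p ≤ 1) (he : 0 < e) (hex : e ≤ x) :
    (p + e) * log (p + e) - p * log p - e * log e ≤ gFun x := by
  have hx := he.trans_le hex
  have h1 : (p + e) * log (p + e) - p * log p - e * log e
      = p * log ((p + e) / p) + e * log ((e + p) / e) := by
    rw [Real.log_div (by positivity) hp.ne', Real.log_div (by positivity) he.ne', add_comm e p]
    ring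
  have h2 : p * log ((p + e) / p) ≤ log (1 + x) := by
    refine (mul_log_add_div_le hp hp1 he).trans ?_
    rw [one_mul, div_one]
    exact Real.log_le_log (by positivity) (by linarith)
  have h3 : e * log ((e + p) / e) ≤ x * log ((x + 1) / x) := by
    refine le_trans ?_ (mul_log_add_div_le he hex one_pos)
    gcongr
  rw [h1, gFun_eq hx]
  exact add_le_add h2 h3

theorem continuousOn_gFun : ContinuousOn gFun (Set.Ici 0) := by
  unfold gFun
  refine (continuousOn_const.add continuousOn_id).mul
    (Real.binEntropy_continuous.comp_continuousOn
      (continuousOn_id.div (continuousOn_const.add continuousOn_id) fun x hx => ?_))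
  have : (0 : ℝ) ≤ x := hx
  change 1 + x ≠ 0
  positivity

end Numerics

/-! ### Properties of the entropy bound and the main estimate -/

namespace Hamiltonian

open Real (negMulLog log)

variable {𝓗 : Type*} [NormedAddCommGroup 𝓗] [InnerProductSpace ℂ 𝓗] [CompleteSpace 𝓗]
variable {ι : Type*} {H : Hamiltonian 𝓗} {F : ℝ → ℝ} {b : HilbertBasis ι ℂ 𝓗} {h : ι → ℝ}

theorem IsEntropyBound.concaveOn (hF : H.IsEntropyBound F) : ConcaveOn ℝ (Set.Ioi 0) F := by
  have hd : ContDiffOn ℝ 1 (deriv F) (Set.Ioi 0) :=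
    hF.contDiffOn.deriv_of_isOpen isOpen_Ioi (by norm_num)
  refine concaveOn_of_deriv2_nonpos (convex_Ioi 0) hF.contDiffOn.continuousOn ?_ ?_ ?_
  · rw [interior_Ioi]; exact hF.contDiffOn.differentiableOn (by norm_num)
  · rw [interior_Ioi]; exact hd.differentiableOn (by norm_num)
  · rw [interior_Ioi]; exact fun x hx => hF.deriv_deriv_nonpos x hx

/-- A positive concave function has decreasing `F x / x`. Nothing is assumed about `F` near `0`, so
concavity is used between `z > 0` and `y`, the value `F z ≥ 0` is dropped, and `z → 0`. -/
theorem IsEntropyBound.mul_le_mul (hF : H.IsEntropyBound F) {x y : ℝ} (hx : 0 < x) (hxy : x ≤ y) :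
    x * F y ≤ y * F x := by
  rcases hxy.eq_or_lt with rfl | hlt
  · exact le_rfl
  have hy := hx.trans hlt
  have key : ∀ᶠ z in 𝓝[>] (0 : ℝ), (x - z) * F y ≤ (y - z) * F x := by
    filter_upwards [Ioo_mem_nhdsGT hx] with z hz
    have hyz : 0 < y - z := by linarith [hz.2]
    have h1 := hF.concaveOn.2 (show z ∈ Set.Ioi (0 : ℝ) from hz.1) (show y ∈ Set.Ioi (0 : ℝ) from hy)
      (show 0 ≤ (y - x) / (y - z) from div_nonneg (by linarith) hyz.le)
      (show 0 ≤ (x - z) / (y - z) from div_nonneg (by linarith [hz.2]) hyz.le)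
      (by field_simp; ring)
    have h2 : (y - x) / (y - z) * z + (x - z) / (y - z) * y = x := by field_simp; ring
    simp only [smul_eq_mul] at h1
    rw [h2] at h1
    have h3 := mul_le_mul_of_nonneg_left h1 hyz.le
    have h4 : (y - z) * ((y - x) / (y - z) * F z + (x - z) / (y - z) * F y)
        = (y - x) * F z + (x - z) * F y := by field_simp
    rw [h4] at h3
    have h5 := mul_nonneg (sub_nonneg.2 hxy) (hF.pos z hz.1).le
    linarith
  have hl : Tendsto (fun z => (x - z) * F y) (𝓝[>] 0) (𝓝 ((x - 0) * F y)) :=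
    tendsto_nhdsWithin_of_tendsto_nhds (Continuous.tendsto (by fun_prop) 0)
  have hr : Tendsto (fun z => (y - z) * F x) (𝓝[>] 0) (𝓝 ((y - 0) * F x)) :=
    tendsto_nhdsWithin_of_tendsto_nhds (Continuous.tendsto (by fun_prop) 0)
  simpa using le_of_tendsto_of_tendsto hl hr key

/-- The perspective `r ↦ r F(E / r)` is increasing. -/
theorem IsEntropyBound.mul_div_le (hF : H.IsEntropyBound F) {E r δ : ℝ} (hE : 0 < E) (hr : 0 < r)
    (hrδ : r ≤ δ) : r * F (E / r) ≤ δ * F (E / δ) := by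
  have hδ := hr.trans_le hrδ
  have h1 := hF.mul_le_mul (div_pos hE hδ) (div_le_div_of_nonneg_left hE.le hr hrδ)
  have h2 : r * F (E / r) = r * δ / E * (E / δ * F (E / r)) := by field_simp
  have h3 : δ * F (E / δ) = r * δ / E * (E / r * F (E / δ)) := by field_simp
  rw [h2, h3]
  exact mul_le_mul_of_nonneg_left h1 (by positivity)

theorem IsEnergyBasis.exists_le (hb : H.IsEnergyBasis b h) (ρ : QState 𝓗) {c : ℝ}
    (hc : H.energy ρ.op < ENNReal.ofReal c) : ∃ k, h k ≤ c := by
  by_contra! hcon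
  refine absurd hc (not_lt.2 ?_)
  rw [hb.energy_eq ρ.isPositive, ← mul_one (ENNReal.ofReal c), ← ρ.trace_eq_one,
    opTrace_eq_tsum ρ.isPositive b, ← ENNReal.tsum_mul_left]
  refine ENNReal.tsum_le_tsum fun k => ?_
  gcongr
  exact (hcon k).le

/-- Take `n` basis vectors with `log n > M`; above the sum of their energies the low-energy space
contains all of them. -/
theorem IsEnergyBasis.exists_log_le [Infinite ι] (hb : H.IsEnergyBasis b h)
    (hF : H.IsEntropyBound F) (M : ℝ) : ∃ c₀ > 0, ∀ c, c₀ ≤ c → M < F c := by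
  obtain ⟨n, hn, hn1⟩ := ((Real.tendsto_log_atTop.comp tendsto_natCast_atTop_atTop).eventually_gt_atTop
    M |>.and (eventually_ge_atTop 1)).exists
  obtain ⟨s, hs⟩ := Infinite.exists_subset_card_eq ι n
  have hle : ∀ c, 1 + ∑ k ∈ s, h k ≤ c → ∀ k ∈ s, h k ≤ c := fun c hc k hk =>
    (Finset.single_le_sum (f := h) (fun i _ => hb.nonneg i) hk).trans (by linarith)
  have h0 : 0 ≤ ∑ k ∈ s, h k := Finset.sum_nonneg fun i _ => hb.nonneg i
  refine ⟨1 + ∑ k ∈ s, h k, by linarith, fun c hc => ?_⟩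
  obtain ⟨k, hk⟩ : s.Nonempty := Finset.card_pos.1 (by omega)
  refine lt_of_lt_of_le ?_ (hb.log_finrank_le hF ⟨k, hle c hc k hk⟩ (by linarith))
  refine lt_of_lt_of_le hn (Real.log_le_log (by exact_mod_cast hn1) ?_)
  rw [hb.finrank_lowSpace, ← hs]
  norm_cast
  have : Finite {k // h k ≤ c} := (hb.finite_le c).to_subtype
  rw [← Nat.card_eq_finsetCard]
  exact Nat.card_le_card_of_injective (fun i : s => (⟨i.1, hle c hc i.1 i.2⟩ : {k // h k ≤ c}))
    fun i j hij => Subtype.ext (congrArg (fun z => z.1) hij)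

theorem IsEnergyBasis.holevo_le [TopologicalSpace.SeparableSpace 𝓗] (hb : H.IsEnergyBasis b h)
    (hF : H.IsEntropyBound F) (μ : Measure (QState 𝓗)) [IsProbabilityMeasure μ] (σ : QState 𝓗)
    {E ε δ : ℝ} (hE : H.energy (barycenter μ) = ENNReal.ofReal E) (hE₀ : 0 < E)
    (hε : ε = metricDivergence μ σ) (hε₀ : 0 < ε) (hδ : 0 < δ) (hδ' : δ ≤ 1 / 2) :
    holevo μ ≤ ENNReal.ofReal ((ε + δ) * F (E / δ) + Real.binEntropy δ + gFun ε) := by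
  set c := E / δ with hc
  have hc0 : 0 < c := by positivity
  obtain ⟨k₀, hk₀⟩ : ∃ k, h k ≤ c := hb.exists_le (meanState μ) (by
    rw [show (meanState μ).op = barycenter μ from rfl, hE, ENNReal.ofReal_lt_ofReal_iff hc0, hc,
      lt_div_iff₀ hδ]
    nlinarith)
  have hfd := hb.finiteDimensional c
  have hcomp : CompleteSpace (lowSpace b h c) := FiniteDimensional.complete ℂ _
  have hd := finrank_lowSpace_pos (b := b) hk₀
  have hlogd := hb.log_finrank_le hF ⟨k₀, hk₀⟩ hc0
  obtain ⟨f, s, τ, hτ, hf, hs1, hστ⟩ := exists_normalized σ hd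
  have hs0 := hf.nonneg hτ
  set ρ := meanState μ with hρ
  have hρop : ρ.op = barycenter μ := rfl
  have hcpt : IsCompactOperator (compress (lowSpace b h c)ᗮ ρ.op) :=
    ((isCompactOperator_of_opTrace_ne_top ρ.isPositive
      (by rw [ρ.trace_eq_one]; exact ENNReal.one_ne_top)).comp_clm
      (lowSpace b h c)ᗮ.subtypeL).clm_comp
      (ContinuousLinearMap.adjoint (lowSpace b h c)ᗮ.subtypeL)
  have hCpos := isPositive_compress (K := (lowSpace b h c)ᗮ) ρ.isPositive
  obtain ⟨w, g, hg⟩ := exists_isEigenbasis hcpt hCpos.isSelfAdjoint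
  have hgd := isDiagonal_of_isEigenbasis hCpos.isSelfAdjoint hg
  set p := ∑ j, expVal ρ.op (f j) with hp
  have hw0 : ∀ j, 0 ≤ expVal ρ.op (f j) := fun j => expVal_nonneg ρ.isPositive _
  have hp0 : 0 ≤ p := Finset.sum_nonneg fun j _ => hw0 j
  have hsum : ENNReal.ofReal p + ∑' j, ENNReal.ofReal (expVal ρ.op (g j)) = 1 := by
    rw [← ρ.trace_eq_one, opTrace_eq_tsum_add_tsum ρ.isPositive f g,
      tsum_fintype fun j => ENNReal.ofReal (expVal ρ.op (f j)), hp,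
      ENNReal.ofReal_sum_of_nonneg fun j _ => hw0 j]
  have hp1 : p ≤ 1 := by
    rw [← ENNReal.ofReal_le_one, ← hsum]; exact le_self_add
  set r := 1 - p with hr
  have htail : ∑' j, ENNReal.ofReal (expVal ρ.op (g j)) = ENNReal.ofReal r := by
    rw [hr, ENNReal.ofReal_sub _ hp0, ENNReal.ofReal_one, ← hsum,
      ENNReal.add_sub_cancel_left ENNReal.ofReal_ne_top]
  have hr0 : 0 ≤ r := sub_nonneg.2 hp1
  have hrδ : r ≤ δ := by
    have h1 := hb.mul_tail_le ρ.isPositive g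
    rw [htail, hρop, hE, ← ENNReal.ofReal_mul hc0.le, ENNReal.ofReal_le_ofReal_iff hE₀.le, hc,
      div_mul_eq_mul_div, div_le_iff₀ hδ] at h1
    exact le_of_mul_le_mul_left h1 hE₀
  have hp2 : 1 / 2 ≤ p := by linarith
  have hp3 : 0 < p := by linarith
  have hm : 0 < p + ε := by positivity
  have hFc := hF.pos c hc0
  have hη : 0 ≤ negMulLog r := Real.negMulLog_nonneg hr0 (by linarith)
  have hR : ∑' j, ENNReal.ofReal (negMulLog (expVal ρ.op (g j)))
      ≤ ENNReal.ofReal (δ * F c + negMulLog r) := by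
    -- A tail of weight zero cannot be normalized, but then all its terms vanish.
    rcases hr0.eq_or_lt with h0 | h0
    · rw [← h0, ENNReal.ofReal_zero, ENNReal.tsum_eq_zero] at htail
      have hz : ∀ j, expVal ρ.op (g j) = 0 := fun j =>
        le_antisymm (ENNReal.ofReal_eq_zero.1 (htail j)) (expVal_nonneg ρ.isPositive _)
      simp [hz]
    · refine (hb.tail_entropy_le hF ρ hgd h0 (by linarith) htail hE
        ⟨k₀, hk₀.trans (div_le_div_of_nonneg_left hE₀.le h0 hrδ)⟩ hE₀).trans ?_
      exact ENNReal.ofReal_le_ofReal (add_le_add (hF.mul_div_le hE₀ h0 hrδ) le_rfl)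
  set d : ℝ := (Module.finrank ℂ (lowSpace b h c) : ℝ) with hdd
  have hd' : 0 < d := Nat.cast_pos.2 hd
  have hT0 : ∀ j, 0 < p * s j + ε / d := fun j =>
    add_pos_of_nonneg_of_pos (mul_nonneg hp0 (hs0 j)) (by positivity)
  have hTsum : ∑ j, (p * s j + ε / d) = p + ε := by
    rw [Finset.sum_add_distrib, ← Finset.mul_sum, hs1, mul_one, Finset.sum_const, Finset.card_univ,
      Fintype.card_fin, nsmul_eq_mul, mul_div_cancel₀ _ hd'.ne']
  -- The reference of the lower bound, rescaled from trace `p + ε` to the weight `p` of the average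
  -- state in the low-energy space, so that its logarithm cancels below.
  have hy0 : ∀ j, 0 < p / (p + ε) * (p * s j + ε / d) := fun j => mul_pos (by positivity) (hT0 j)
  have hysum : ∑ j, p / (p + ε) * (p * s j + ε / d) = p := by
    rw [← Finset.mul_sum, hTsum, div_mul_cancel₀ _ hm.ne']
  have hy1 : ∀ j, p / (p + ε) * (p * s j + ε / d) ≤ 1 := fun j =>
    (Finset.single_le_sum (fun i _ => (hy0 i).le) (Finset.mem_univ j)).trans (hysum.le.trans hp1)
  have hent := (entropy_le_of_sumBasis ρ f g hy0 hy1 hysum).trans (add_le_add le_rfl hR)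
  have hlogy : ∀ j, 0 ≤ -log (p / (p + ε) * (p * s j + ε / d)) := fun j => by
    have := Real.log_nonpos (hy0 j).le (hy1 j); linarith
  rw [← ENNReal.ofReal_add (Finset.sum_nonneg fun j _ => mul_nonneg (hw0 j) (hlogy j))
    (by positivity)] at hent
  have hentt : entropy (barycenter μ) ≠ ⊤ := ne_top_of_le_ne_top ENNReal.ofReal_ne_top hent
  have hentr := ENNReal.toReal_le_of_le_ofReal (add_nonneg
    (Finset.sum_nonneg fun j _ => mul_nonneg (hw0 j) (hlogy j)) (by positivity)) hent
  refine (holevo_le_entropy_sub μ hε hε₀ hentt hτ hf hs1 hστ hp3).trans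
    (ENNReal.ofReal_le_ofReal ?_)
  rw [Fintype.card_fin, ← hdd, ← hρop]
  have hlog : ∑ j, expVal ρ.op (f j) * (-log (p / (p + ε) * (p * s j + ε / d)))
      = ∑ j, expVal ρ.op (f j) * (-log (p * s j + ε / d) + log p)
        + p * (log (p + ε) - 2 * log p) := by
    conv_rhs => rw [hp, Finset.sum_mul, ← Finset.sum_add_distrib]
    refine Finset.sum_congr rfl fun j _ => ?_
    rw [← hp, Real.log_mul (by positivity) (hT0 j).ne', Real.log_div hp3.ne' hm.ne']
    ring
  rw [hlog] at hentr
  -- The left side is the binary entropy of `r ≤ δ`, and binary entropy increases on `[0, 1/2]`.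
  have hbin : negMulLog r + negMulLog p ≤ Real.binEntropy δ := by
    have h1 := Real.binEntropy_strictMonoOn.monotoneOn (a := r) (b := δ)
      ⟨hr0, by linarith⟩ ⟨hδ.le, by linarith⟩ hrδ
    rw [Real.binEntropy_eq_negMulLog_add_negMulLog_one_sub r] at h1
    rwa [show 1 - r = p by rw [hr]; ring] at h1
  have hmix := mixing_le_gFun hp3 hp1 hε₀ le_rfl
  have hdF := mul_le_mul_of_nonneg_left hlogd hε₀.le
  rw [negMulLog, negMulLog] at hbin
  rw [negMulLog] at hentr
  linarith

end Hamiltonian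

end HolevoBound

end

/-! ### The bound and the attainment of the minimum -/

open HolevoBound in
theorem proposition2 {𝓗 : Type*} [NormedAddCommGroup 𝓗] [InnerProductSpace ℂ 𝓗]
    [CompleteSpace 𝓗] [TopologicalSpace.SeparableSpace 𝓗]
    (H : Hamiltonian 𝓗) (hH : ∃ l : ℝ, 0 < l ∧ opTrace (H.expNeg l) < ⊤)
    (F : ℝ → ℝ) (hF : H.IsEntropyBound F)
    (μ : MeasureTheory.Measure (QState 𝓗)) [MeasureTheory.IsProbabilityMeasure μ]
    (σ : QState 𝓗)
    (hμ : H.energy (barycenter μ) < ⊤) (hμ₀ : 0 < H.energy (barycenter μ))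
    (hσ : H.energy σ.op < ⊤)
    (E ε κ : ℝ) (hE : E = (H.energy (barycenter μ)).toReal)
    (hε : ε = metricDivergence μ σ) (hε₀ : 0 < ε)
    (hκ : κ = (1 / 2) * (1 + (H.energy σ.op).toReal / E))
    (B : ℝ → ℝ)
    (hB : ∀ t, B t = ε * ((1 + κ * t) / (1 - ε * t) + t) * F (E / (ε * t))
      + Real.binEntropy (ε * t) + gFun ((1 + κ * t) / (1 - ε * t) * ε)) :
    (holevo μ ≤ ⨅ t ∈ Set.Ioc 0 (1 / (2 * ε)), ENNReal.ofReal (B t)) ∧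
      (¬ FiniteDimensional ℂ 𝓗 →
        ∃ t₀ ∈ Set.Ioc 0 (1 / (2 * ε)), IsMinOn B (Set.Ioc 0 (1 / (2 * ε))) t₀) := by
  obtain ⟨w, b, h, hb⟩ := H.exists_isEnergyBasis hH
  have hE₀ : 0 < E := hE ▸ ENNReal.toReal_pos hμ₀.ne' hμ.ne
  have hE' : H.energy (barycenter μ) = ENNReal.ofReal E := by rw [hE, ENNReal.ofReal_toReal hμ.ne]
  have hκ₀ : 0 ≤ κ := by rw [hκ]; positivity
  have hδ : ∀ t ∈ Set.Ioc 0 (1 / (2 * ε)), 0 < ε * t ∧ ε * t ≤ 1 / 2 := fun t ht => by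
    refine ⟨mul_pos hε₀ ht.1, ?_⟩
    have := (le_div_iff₀ (by positivity)).1 ht.2
    linarith
  have hq : ∀ t ∈ Set.Ioc 0 (1 / (2 * ε)), 1 ≤ (1 + κ * t) / (1 - ε * t) := fun t ht => by
    obtain ⟨h1, h2⟩ := hδ t ht
    rw [le_div_iff₀ (by linarith)]
    have := mul_nonneg hκ₀ ht.1.le
    linarith
  refine ⟨le_iInf₂ fun t ht => ?_, fun hdim => ?_⟩
  · obtain ⟨h1, h2⟩ := hδ t ht
    refine (hb.holevo_le hF μ σ hE' hE₀ hε hε₀ h1 h2).trans (ENNReal.ofReal_le_ofReal ?_)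
    have hFp := hF.pos (E / (ε * t)) (by positivity)
    have hg : gFun ε ≤ gFun ((1 + κ * t) / (1 - ε * t) * ε) := by
      have := mixing_le_gFun one_pos le_rfl hε₀ (le_mul_of_one_le_left hε₀.le (hq t ht))
      refine le_trans (le_of_eq ?_) this
      rw [gFun_eq hε₀, Real.log_div (by positivity) hε₀.ne', Real.log_one, add_comm ε 1]
      ring
    have hcoef : ε + ε * t ≤ ε * ((1 + κ * t) / (1 - ε * t) + t) := by
      have := mul_le_mul_of_nonneg_left (hq t ht) hε₀.le
      linarith
    rw [hB]
    gcongr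
  · have hinf : Infinite w := by
      by_contra hfin
      rw [not_infinite_iff_finite] at hfin
      have := Fintype.ofFinite w
      exact hdim (b.toOrthonormalBasis.toBasis.finiteDimensional_of_finite)
    set T := 1 / (2 * ε) with hT
    have hT0 : 0 < T := by positivity
    have hlow : ∀ t ∈ Set.Ioc 0 T, ε * F (E / (ε * t)) ≤ B t := fun t ht => by
      obtain ⟨h1, h2⟩ := hδ t ht
      have hFp := hF.pos (E / (ε * t)) (by positivity)
      have hbin := Real.binEntropy_nonneg h1.le (by linarith)
      have hg := gFun_nonneg (mul_nonneg (zero_le_one.trans (hq t ht)) hε₀.le)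
      have hcoef : ε * F (E / (ε * t))
          ≤ ε * ((1 + κ * t) / (1 - ε * t) + t) * F (E / (ε * t)) := by
        refine mul_le_mul_of_nonneg_right ?_ hFp.le
        exact le_mul_of_one_le_right hε₀.le (by linarith [hq t ht, ht.1])
      rw [hB]
      linarith
    have hcont : ContinuousOn B (Set.Ioc 0 T) := by
      rw [show B = _ from funext hB]
      have hquot : ContinuousOn (fun t => (1 + κ * t) / (1 - ε * t)) (Set.Ioc 0 T) :=
        ContinuousOn.div (by fun_prop) (by fun_prop) fun t ht => by linarith [(hδ t ht).2]
      refine ((((continuousOn_const.mul (hquot.add continuousOn_id)).mul ?_).add ?_).add ?_)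
      · refine hF.contDiffOn.continuousOn.comp (continuousOn_const.div (by fun_prop) fun t ht =>
          (hδ t ht).1.ne') fun t ht => ?_
        exact div_pos hE₀ (hδ t ht).1
      · exact (Real.binEntropy_continuous.comp (by fun_prop)).continuousOn
      · refine continuousOn_gFun.comp (hquot.mul continuousOn_const) fun t ht => ?_
        exact mul_nonneg (zero_le_one.trans (hq t ht)) hε₀.le
    obtain ⟨c₀, hc₀, hc⟩ := hb.exists_log_le hF (B T / ε)
    -- For `t < t₁` the argument `E / (ε t)` is at least `c₀`, hence `B t ≥ ε F(E / (ε t)) > B T`: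
    -- such `t` cannot beat the endpoint `T`, and a minimum over `[t₁, T]` is one over the whole
    -- interval.
    set t₁ := min T (E / (ε * c₀)) with ht₁
    have ht₁0 : 0 < t₁ := lt_min hT0 (by positivity)
    have hsub : Set.Icc t₁ T ⊆ Set.Ioc 0 T := fun t ht => ⟨ht₁0.trans_le ht.1, ht.2⟩
    have hTmem : T ∈ Set.Icc t₁ T := ⟨min_le_left _ _, le_rfl⟩
    obtain ⟨t₀, ht₀, hmin⟩ := isCompact_Icc.exists_isMinOn ⟨T, hTmem⟩ (hcont.mono hsub)
    refine ⟨t₀, hsub ht₀, fun t ht => ?_⟩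
    rcases le_or_gt t₁ t with h1 | h1
    · exact hmin ⟨h1, ht.2⟩
    · have h2 : c₀ ≤ E / (ε * t) := by
        have := h1.le.trans (min_le_right _ _)
        rw [le_div_iff₀ (by positivity)] at this
        rw [le_div_iff₀ (hδ t ht).1]
        linarith
      have h3 := (div_lt_iff₀' hε₀).1 (hc _ h2)
      exact (hmin hTmem).trans (h3.le.trans (hlow t ht))
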